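/- Let $V$ be a profile of $n\ge 1$ votes, each a ranking (complete order) of a set $C$ of $m\ge 1$ candidates (equal votes are allowed). The Kendall--Tau distance of two rankings is the number of pairs of candidates that they order differently. The Kemeny score of a ranking is the sum of its Kendall--Tau distances to the votes, and $K(V)$ is the set of Kemeny rankings, i.e. of the rankings of minimum Kemeny score. The unanimity order of $V$ puts $a$ before $b$ if all votes rank $a$ before $b$. Its cocomparability graph has vertex set $C$, with two distinct candidates adjacent if they are incomparable in the unanimity order. The unanimity width $w$ of $V$ is the pathwidth of this graph: the minimum, over all sequences $B_1,\dots,B_t\subseteq C$ of sets (bags) such that every candidate lies in a bag, every edge lies inside a bag, and $B_i\cap B_k\subseteq B_j$ for $i<j<k$, of $\max_i|B_i|-1$. In the problem Distinct OPT Kemeny Ranking Aggregation, the input is a profile $V$ and an integer $r\ge 1$ (written in binary), and the task is to output $\min\{r,|K(V)|\}$ distinct Kemeny rankings of $V$. **Theorem.** Distinct OPT Kemeny Ranking Aggregation admits an algorithm that runs in time $O^*(2^{O(w)}\cdot r)$, where $w$ is the unanimity width of the input profile, and is therefore fixed-parameter tractable in the combined parameter $(w,r)$. That is, there are a single program of a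 random access machine and a constant $c$ such that on every instance $(V,r)$ the program halts with a correct output after time at most $c\cdot 2^{c w}\cdot r\cdot N^{c}$, where $N$ is the size of the input in bits. Time is measured by the logarithmic cost criterion: each instruction costs one plus the binary lengths of the numbers and addresses that it handles. -/

import Mathlib

/-! ### Rankings and the Kemeny score -/

namespace Kemeny

/-- A ranking (complete order) of the candidates `0, …, m - 1`: `σ k` is the candidate that
`σ` places at position `k`, where position `0` is the most preferred one. -/
abbrev Ranking (m : ℕ) : Type := Equiv.Perm (Fin m)

/-- `a ≻_σ b`: the ranking `σ` places `a` before `b`. -/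
def Prefers {m : ℕ} (σ : Ranking m) (a b : Fin m) : Prop := σ.symm a < σ.symm b

instance {m : ℕ} (σ : Ranking m) (a b : Fin m) : Decidable (Prefers σ a b) :=
  inferInstanceAs (Decidable (σ.symm a < σ.symm b))

/-- Kendall-Tau distance: the number of pairs of candidates that `σ` and `τ` order differently.
Each such pair `{a, b}` is counted once, as the `(a, b)` with `a ≻_σ b` and `b ≻_τ a`. -/
def ktDist {m : ℕ} (σ τ : Ranking m) : ℕ :=
  (Finset.univ.filter fun p : Fin m × Fin m => Prefers σ p.1 p.2 ∧ Prefers τ p.2 p.1).card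

/-- A profile: a list of `n` votes, each of them a ranking of `m` candidates (equal votes are
allowed). -/
abbrev Profile (m n : ℕ) : Type := Fin n → Ranking m

/-- The Kemeny score of a ranking with respect to a profile. -/
def score {m n : ℕ} (V : Profile m n) (Q : Ranking m) : ℕ := ∑ i, ktDist Q (V i)

/-- `K(V)`: the set of Kemeny rankings, i.e. of the rankings with minimum Kemeny score. -/
def kemenyRankings {m n : ℕ} (V : Profile m n) : Finset (Ranking m) :=
  Finset.univ.filter fun Q => ∀ Q' : Ranking m, score V Q ≤ score V Q'

/-- `L` is a correct answer to the instance `(V, r)` of Distinct OPT Kemeny Ranking Aggregation: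
it consists of `min {r, |K(V)|}` pairwise distinct Kemeny rankings. -/
def IsSolution {m n : ℕ} (V : Profile m n) (r : ℕ) (L : List (Ranking m)) : Prop :=
  L.Nodup ∧ (∀ Q ∈ L, Q ∈ kemenyRankings V) ∧ L.length = min r (kemenyRankings V).card

/-! ### Pathwidth and unanimity width -/

/-- A path decomposition of a graph. -/
structure PathDecomposition {C : Type*} (G : SimpleGraph C) where
  /-- the number of bags -/
  t : ℕ
  /-- the sequence of bags -/
  bag : Fin t → Finset C
  /-- every vertex is in some bag -/
  vertex_mem : ∀ v, ∃ i, v ∈ bag i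
  /-- every edge is inside some bag -/
  edge_mem : ∀ u v, G.Adj u v → ∃ i, u ∈ bag i ∧ v ∈ bag i
  /-- the bags containing a given vertex are consecutive -/
  interpolation : ∀ i j k, i < j → j < k → ∀ v, v ∈ bag i → v ∈ bag k → v ∈ bag j

/-- The width of a path decomposition: the maximum size of a bag, minus one. -/
def PathDecomposition.width {C : Type*} {G : SimpleGraph C} (D : PathDecomposition G) : ℕ :=
  (Finset.univ.sup fun i => (D.bag i).card) - 1

/-- The pathwidth of a graph: the minimum width of a path decomposition. -/
noncomputable def pathwidth {C : Type*} (G : SimpleGraph C) : ℕ :=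
  sInf (Set.range fun D : PathDecomposition G => D.width)

/-- The unanimity order of a profile: all votes place `a` before `b`. -/
def Unanimous {m n : ℕ} (V : Profile m n) (a b : Fin m) : Prop := ∀ i, Prefers (V i) a b

/-- The cocomparability graph of the unanimity order: the complement of the graph in which two
different candidates are adjacent if they are comparable in the unanimity order. -/
def cocomparabilityGraph {m n : ℕ} (V : Profile m n) : SimpleGraph (Fin m) :=
  (SimpleGraph.fromRel (Unanimous V))ᶜ

/-- The unanimity width of a profile. -/
noncomputable def unanimityWidth {m n : ℕ} (V : Profile m n) : ℕ :=
  pathwidth (cocomparabilityGraph V)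

/-! ### Inputs and outputs as sequences of natural numbers -/

/-- A ranking written out: its candidates, from the most to the least preferred one. -/
def encodeRanking {m : ℕ} (σ : Ranking m) : List ℕ := List.ofFn fun k => (σ k : ℕ)

/-- The input of an algorithm on the instance `(V, r)`: `m`, `n`, `r`, and then the `n` votes. -/
def encodeInstance {m n : ℕ} (V : Profile m n) (r : ℕ) : List ℕ :=
  m :: n :: r :: (List.ofFn fun i => encodeRanking (V i)).flatten

/-- The output of an algorithm: the number of rankings, and then the rankings. -/
def encodeOutput {m : ℕ} (L : List (Ranking m)) : List ℕ :=
  L.length :: (L.map encodeRanking).flatten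

/-- The size of a sequence of natural numbers in bits: the numbers are written in binary, each of
them followed by a separator. In particular `r` contributes only its binary length. -/
def bitSize (l : List ℕ) : ℕ := (l.map fun x => Nat.size x + 1).sum

end Kemeny

/-! ### Random access machines with logarithmic cost -/

namespace Ram

/-- Programs of a random access machine. It has registers (of which a program uses the finitely
many that it mentions), an addressable memory whose cells hold natural numbers, an input tape
that is read from left to right, and an output tape to which numbers are appended. -/
inductive Prog : Type
  /-- do nothing -/
  | skip : Prog
  /-- `R i := c` -/
  | const (i c : ℕ) : Prog
  /-- `R i := R j + R k` -/
  | add (i j k : ℕ) : Prog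
  /-- `R i := max (R j - R k) 0` -/
  | sub (i j k : ℕ) : Prog
  /-- `R i := M (R j)` -/
  | load (i j : ℕ) : Prog
  /-- `M (R i) := R j` -/
  | store (i j : ℕ) : Prog
  /-- `R i :=` the next number on the input tape (`0` if there is none) -/
  | read (i : ℕ) : Prog
  /-- append `R i` to the output tape -/
  | write (i : ℕ) : Prog
  /-- first `p`, then `q` -/
  | seq (p q : Prog) : Prog
  /-- if `R i ≠ 0` then `p`, else `q` -/
  | ite (i : ℕ) (p q : Prog) : Prog
  /-- while `R i ≠ 0` do `p` -/
  | loop (i : ℕ) (p : Prog) : Prog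

/-- States of the machine: contents of the registers, contents of the memory, the part of the
input not yet read, and the output written so far. -/
structure State : Type where
  reg : ℕ → ℕ
  mem : ℕ → ℕ
  inp : List ℕ
  out : List ℕ

/-- Assignment of a value to a register. -/
def State.setReg (s : State) (i x : ℕ) : State := { s with reg := Function.update s.reg i x }

/-- Assignment of a value to a memory cell. -/
def State.setMem (s : State) (a x : ℕ) : State := { s with mem := Function.update s.mem a x }

/-- The state in which a program is started on an input. -/
def State.init (input : List ℕ) : State := ⟨fun _ => 0, fun _ => 0, input, []⟩

/-- `Exec p s s' t`: started in the state `s`, the program `p` halts in the state `s'` after time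
`t`. Logarithmic cost criterion: every elementary instruction and every test takes one unit of
time plus the binary lengths of all numbers and memory addresses that it handles. -/
inductive Exec : Prog → State → State → ℕ → Prop
  | skip (s : State) : Exec .skip s s 1
  | const (s : State) (i c : ℕ) : Exec (.const i c) s (s.setReg i c) (1 + Nat.size c)
  | add (s : State) (i j k : ℕ) :
      Exec (.add i j k) s (s.setReg i (s.reg j + s.reg k))
        (1 + Nat.size (s.reg j) + Nat.size (s.reg k))
  | sub (s : State) (i j k : ℕ) :
      Exec (.sub i j k) s (s.setReg i (s.reg j - s.reg k))
        (1 + Nat.size (s.reg j) + Nat.size (s.reg k))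
  | load (s : State) (i j : ℕ) :
      Exec (.load i j) s (s.setReg i (s.mem (s.reg j)))
        (1 + Nat.size (s.reg j) + Nat.size (s.mem (s.reg j)))
  | store (s : State) (i j : ℕ) :
      Exec (.store i j) s (s.setMem (s.reg i) (s.reg j))
        (1 + Nat.size (s.reg i) + Nat.size (s.reg j))
  | read (s : State) (i : ℕ) :
      Exec (.read i) s { s.setReg i (s.inp.headD 0) with inp := s.inp.tail }
        (1 + Nat.size (s.inp.headD 0))
  | write (s : State) (i : ℕ) :
      Exec (.write i) s { s with out := s.out ++ [s.reg i] } (1 + Nat.size (s.reg i))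
  | seq {p q : Prog} {s s' s'' : State} {t t' : ℕ} (hp : Exec p s s' t) (hq : Exec q s' s'' t') :
      Exec (.seq p q) s s'' (t + t')
  | ite_true {i : ℕ} {p q : Prog} {s s' : State} {t : ℕ} (hi : s.reg i ≠ 0) (hp : Exec p s s' t) :
      Exec (.ite i p q) s s' (1 + Nat.size (s.reg i) + t)
  | ite_false {i : ℕ} {p q : Prog} {s s' : State} {t : ℕ} (hi : s.reg i = 0) (hq : Exec q s s' t) :
      Exec (.ite i p q) s s' (1 + Nat.size (s.reg i) + t)
  | loop_exit {i : ℕ} {p : Prog} {s : State} (hi : s.reg i = 0) :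
      Exec (.loop i p) s s (1 + Nat.size (s.reg i))
  | loop_step {i : ℕ} {p : Prog} {s s' s'' : State} {t t' : ℕ} (hi : s.reg i ≠ 0)
      (hp : Exec p s s' t) (hl : Exec (.loop i p) s' s'' t') :
      Exec (.loop i p) s s'' (1 + Nat.size (s.reg i) + t + t')

/-- On the given input, the program `p` halts with the given output after time `t`. -/
def Prog.RunsIn (p : Prog) (input output : List ℕ) (t : ℕ) : Prop :=
  ∃ s : State, Exec p (State.init input) s t ∧ s.out = output

end Ram

/-! A Kemeny ranking extends the unanimity order (`prefers_of_unanimous`), so the candidates in each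
of its prefixes form an ideal of that order. The score is a sum of costs of placing one candidate
directly after a prefix, and such a cost depends on the prefix only as a set. Hence a dynamic
program over ideals computes the optimal cost of every prefix set. The Kemeny rankings are the
rankings along which every step attains the optimum of the program (`mem_kemenyRankings_iff`).

The unanimity width bounds the number of ideals (`card_ideals_le`). Two incomparable pairs separated
by the same ideal share a candidate or are joined by an edge of the cocomparability graph
(`exists_touching`). In a path decomposition each edge occupies an interval of bags, so by the Helly
property of intervals a single bag meets all pairs separated by a given ideal
(`exists_hitting_bag`). Once the bag is fixed, its intersection with the ideal and the size of the
ideal determine the ideal. This leaves at most m(m+1)2^(w+1) ideals.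

Rankings are recovered from the last candidate to the first, level by level, keeping at most r
optimal ends. Every optimal end can be prolonged to a longer one (`Tight.exists_cons`), so
truncation to r never leads to a dead end (`Beam.isBeam`), and the time is linear in r.

For the machine model, a small language with a step-counting weakest precondition is compiled to the
random access machine (`exec_of_wp`), with cost linear in the word length B per step. Sets are
stored as bit masks. The table spans addresses up to 2^m, but only cells of ideals are ever written.
The memory starts out zero, so the value 0 means "not met", and no time proportional to 2^m is
spent. Since B can be taken linear in the input size N, the total time is O(N^6 2^w r). -/

/-! ### A structured language on top of the random access machine -/

namespace Ram

/-- Commands of a small structured language with registers, eight arrays and counting loops. -/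
inductive Cmd : Type
  /-- do nothing -/
  | skip : Cmd
  /-- `R i := c` -/
  | const (i c : ℕ) : Cmd
  /-- `R i := R j` -/
  | mov (i j : ℕ) : Cmd
  /-- `R i := R i + 1` -/
  | inc (i : ℕ) : Cmd
  /-- `R i := R j + R k` -/
  | add (i j k : ℕ) : Cmd
  /-- `R i := R j - R k`, truncated -/
  | sub (i j k : ℕ) : Cmd
  /-- `R i := A a (R j)` -/
  | ld (a i j : ℕ) : Cmd
  /-- `A a (R i) := R j` -/
  | st (a i j : ℕ) : Cmd
  /-- `R i :=` the next input -/
  | read (i : ℕ) : Cmd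
  /-- append `R i` to the output -/
  | write (i : ℕ) : Cmd
  /-- first `p`, then `q` -/
  | seq (p q : Cmd) : Cmd
  /-- if `R i ≠ 0` then `p`, else `q` -/
  | ite (i : ℕ) (p q : Cmd) : Cmd
  /-- if `R i ≤ R j` then `p`, else `q` -/
  | ifle (i j : ℕ) (p q : Cmd) : Cmd
  /-- for `R i` from `R j - 1` down to `0` do `p` -/
  | rep (i j : ℕ) (p : Cmd) : Cmd

/-- Computes the address of the cell `R j` of the array `a` in register `0`. -/
def addressProg (a j : ℕ) : Prog :=
  .seq (.add 0 j j) (.seq (.add 0 0 0) (.seq (.add 0 0 0) (.seq (.const 1 a) (.add 0 0 1))))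

/-- Translation to the random access machine: registers are shifted by two, registers `0` and `1`
are scratch, and cell `i` of the array `a` is cell `8 * i + a` of the memory. -/
def Cmd.compile : Cmd → Prog
  | skip => .skip
  | const i c => .const (i + 2) c
  | mov i j => .seq (.const 0 0) (.add (i + 2) (j + 2) 0)
  | inc i => .seq (.const 0 1) (.add (i + 2) (i + 2) 0)
  | add i j k => .add (i + 2) (j + 2) (k + 2)
  | sub i j k => .sub (i + 2) (j + 2) (k + 2)
  | ld a i j => .seq (addressProg a (j + 2)) (.load (i + 2) 0)
  | st a i j => .seq (addressProg a (i + 2)) (.store 0 (j + 2))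
  | read i => .read (i + 2)
  | write i => .write (i + 2)
  | seq p q => .seq p.compile q.compile
  | ite i p q => .ite (i + 2) p.compile q.compile
  | ifle i j p q => .seq (.sub 0 (i + 2) (j + 2)) (.ite 0 q.compile p.compile)
  | rep i j p => .seq (.seq (.const 0 0) (.add (i + 2) (j + 2) 0))
      (.loop (i + 2) (.seq (.seq (.const 0 1) (.sub (i + 2) (i + 2) 0)) p.compile))

/-- States of the structured language. -/
structure Store : Type where
  reg : ℕ → ℕ
  arr : ℕ → ℕ → ℕ
  inp : List ℕ
  out : List ℕ

namespace Store

/-- Assignment to a register. -/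
def set (h : Store) (i x : ℕ) : Store := { h with reg := fun j => if j = i then x else h.reg j }

/-- Assignment to a cell of an array. -/
def setArr (h : Store) (a i x : ℕ) : Store :=
  { h with arr := fun b j => if b = a ∧ j = i then x else h.arr b j }

/-- Replacement of the remaining input. -/
def setInp (h : Store) (l : List ℕ) : Store := { h with inp := l }

/-- Replacement of the output. -/
def setOut (h : Store) (l : List ℕ) : Store := { h with out := l }

variable (h : Store) (i j x a b : ℕ) (l : List ℕ)

@[simp] theorem set_reg_self : (h.set i x).reg i = x := by simp [set]
theorem set_reg_of_ne (hij : j ≠ i) : (h.set i x).reg j = h.reg j := by simp [set, hij]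
@[simp] theorem set_arr : (h.set i x).arr = h.arr := rfl
@[simp] theorem set_inp : (h.set i x).inp = h.inp := rfl
@[simp] theorem set_out : (h.set i x).out = h.out := rfl
@[simp] theorem setArr_reg : (h.setArr a i x).reg = h.reg := rfl
@[simp] theorem setArr_inp : (h.setArr a i x).inp = h.inp := rfl
@[simp] theorem setArr_out : (h.setArr a i x).out = h.out := rfl
@[simp] theorem setArr_arr_self : (h.setArr a i x).arr a i = x := by simp [setArr]
@[simp] theorem setInp_reg : (h.setInp l).reg = h.reg := rfl
@[simp] theorem setInp_arr : (h.setInp l).arr = h.arr := rfl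
@[simp] theorem setInp_inp : (h.setInp l).inp = l := rfl
@[simp] theorem setInp_out : (h.setInp l).out = h.out := rfl
@[simp] theorem setOut_reg : (h.setOut l).reg = h.reg := rfl
@[simp] theorem setOut_arr : (h.setOut l).arr = h.arr := rfl
@[simp] theorem setOut_out : (h.setOut l).out = l := rfl
theorem setArr_arr_of_ne (hab : b ≠ a) : (h.setArr a i x).arr b = h.arr b := by
  funext j; simp [setArr, hab]
theorem setArr_arr_same : (h.setArr a i x).arr a = Function.update (h.arr a) i x := by
  funext j; simp [setArr, Function.update_apply]

end Store

/-- Iteration of a predicate transformer, with the counter in register `i`. -/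
def iterWp (w : Store → (Store → ℕ → Prop) → Prop) (i : ℕ) :
    ℕ → Store → (Store → ℕ → Prop) → Prop
  | 0, h, Q => Q h 2
  | n + 1, h, Q => w (h.set i n) fun h' k =>
      h'.reg i = n ∧ iterWp w i n h' fun h'' k' => Q h'' (k + k' + 1)

/-- Weakest precondition: started in `h`, the command keeps all numbers below `2 ^ B` and halts
in a state `h'` after `k` steps such that `Q h' k`. -/
def wp (B : ℕ) : Cmd → Store → (Store → ℕ → Prop) → Prop
  | .skip, h, Q => Q h 1
  | .const i c, h, Q => c < 2 ^ B ∧ Q (h.set i c) 1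
  | .mov i j, h, Q => Q (h.set i (h.reg j)) 1
  | .inc i, h, Q => h.reg i + 1 < 2 ^ B ∧ Q (h.set i (h.reg i + 1)) 1
  | .add i j k, h, Q => h.reg j + h.reg k < 2 ^ B ∧ Q (h.set i (h.reg j + h.reg k)) 1
  | .sub i j k, h, Q => Q (h.set i (h.reg j - h.reg k)) 1
  | .ld a i j, h, Q => a < 8 ∧ Q (h.set i (h.arr a (h.reg j))) 1
  | .st a i j, h, Q => a < 8 ∧ Q (h.setArr a (h.reg i) (h.reg j)) 1
  | .read i, h, Q => Q ((h.set i (h.inp.headD 0)).setInp h.inp.tail) 1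
  | .write i, h, Q => Q (h.setOut (h.out ++ [h.reg i])) 1
  | .seq p q, h, Q => wp B p h fun h' k => wp B q h' fun h'' k' => Q h'' (k + k')
  | .ite i p q, h, Q => (h.reg i ≠ 0 → wp B p h fun h' k => Q h' (k + 1)) ∧
      (h.reg i = 0 → wp B q h fun h' k => Q h' (k + 1))
  | .ifle i j p q, h, Q => (h.reg i ≤ h.reg j → wp B p h fun h' k => Q h' (k + 1)) ∧
      (h.reg j < h.reg i → wp B q h fun h' k => Q h' (k + 1))
  | .rep i j p, h, Q => iterWp (wp B p) i (h.reg j) (h.set i (h.reg j)) Q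

theorem iterWp_mono {w : Store → (Store → ℕ → Prop) → Prop}
    (hw : ∀ h Q Q', (∀ h' k, Q h' k → Q' h' k) → w h Q → w h Q') (i n : ℕ) :
    ∀ (h : Store) (Q Q' : Store → ℕ → Prop), (∀ h' k, Q h' k → Q' h' k) →
      iterWp w i n h Q → iterWp w i n h Q' := by
  induction n with
  | zero => exact fun h Q Q' hQ => hQ _ _
  | succ n ih =>
    exact fun h Q Q' hQ => hw _ _ _ fun h' k hk => ⟨hk.1, ih _ _ _ (fun _ _ => hQ _ _) hk.2⟩

/-- Postconditions may be weakened. This is how a specification proved for one command is used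
inside a larger one. -/
theorem wp_mono {B : ℕ} (p : Cmd) : ∀ (h : Store) (Q Q' : Store → ℕ → Prop),
    (∀ h' k, Q h' k → Q' h' k) → wp B p h Q → wp B p h Q' := by
  induction p with
  | skip => exact fun h Q Q' hQ => hQ _ _
  | const | inc | add | ld | st => exact fun h Q Q' hQ => And.imp_right (hQ _ _)
  | mov | sub | read | write => exact fun h Q Q' hQ => hQ _ _
  | seq p q hp hq => exact fun h Q Q' hQ => hp _ _ _ fun h' k => hq _ _ _ fun _ _ => hQ _ _
  | ite i p q hp hq =>
    exact fun h Q Q' hQ => And.imp (fun H hi => hp _ _ _ (fun _ _ => hQ _ _) (H hi))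
      (fun H hi => hq _ _ _ (fun _ _ => hQ _ _) (H hi))
  | ifle i j p q hp hq =>
    exact fun h Q Q' hQ => And.imp (fun H hi => hp _ _ _ (fun _ _ => hQ _ _) (H hi))
      (fun H hi => hq _ _ _ (fun _ _ => hQ _ _) (H hi))
  | rep i j p hp => exact fun h Q Q' => iterWp_mono hp _ _ _ _ _

/-- Rule for counting loops: `Inv n` holds when `n` iterations are left. -/
theorem wp_rep {B i j T : ℕ} {p : Cmd} {h : Store} {Q : Store → ℕ → Prop}
    (Inv : ℕ → Store → Prop) (init : Inv (h.reg j) (h.set i (h.reg j)))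
    (step : ∀ n h', n < h.reg j → Inv (n + 1) h' →
      wp B p (h'.set i n) fun h'' k => h''.reg i = n ∧ Inv n h'' ∧ k ≤ T)
    (fin : ∀ h' k, Inv 0 h' → k ≤ h.reg j * (T + 1) + 2 → Q h' k) :
    wp B (.rep i j p) h Q := by
  -- The postcondition is generalised because the steps already spent are absorbed into it as the
  -- loop unfolds.
  have key : ∀ n ≤ h.reg j, ∀ (h' : Store) (Q' : Store → ℕ → Prop), Inv n h' →
      (∀ h'' k, Inv 0 h'' → k ≤ n * (T + 1) + 2 → Q' h'' k) →
      iterWp (wp B p) i n h' Q' := by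
    intro n
    induction n with
    | zero => exact fun _ h' Q' h0 H => H _ _ h0 (by simp)
    | succ n ih =>
      intro hn h' Q' h0 H
      refine wp_mono p _ _ _ ?_ (step n h' (by omega) h0)
      rintro h'' k ⟨h1, h2, h3⟩
      refine ⟨h1, ih (by omega) _ _ h2 fun h3 k' h4 h5 => H _ _ h4 ?_⟩
      rw [add_mul]
      omega
  exact key _ le_rfl _ _ init fin

section

variable (B : ℕ) (h : Store) (Q : Store → ℕ → Prop) (i j k a c : ℕ) (p q : Cmd)

theorem wp_skip : wp B .skip h Q = Q h 1 := rfl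
theorem wp_const : wp B (.const i c) h Q = (c < 2 ^ B ∧ Q (h.set i c) 1) := rfl
theorem wp_mov : wp B (.mov i j) h Q = Q (h.set i (h.reg j)) 1 := rfl
theorem wp_inc :
    wp B (.inc i) h Q = (h.reg i + 1 < 2 ^ B ∧ Q (h.set i (h.reg i + 1)) 1) := rfl
theorem wp_add : wp B (.add i j k) h Q =
    (h.reg j + h.reg k < 2 ^ B ∧ Q (h.set i (h.reg j + h.reg k)) 1) := rfl
theorem wp_sub : wp B (.sub i j k) h Q = Q (h.set i (h.reg j - h.reg k)) 1 := rfl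
theorem wp_ld : wp B (.ld a i j) h Q = (a < 8 ∧ Q (h.set i (h.arr a (h.reg j))) 1) := rfl
theorem wp_st : wp B (.st a i j) h Q = (a < 8 ∧ Q (h.setArr a (h.reg i) (h.reg j)) 1) := rfl
theorem wp_read :
    wp B (.read i) h Q = Q ((h.set i (h.inp.headD 0)).setInp h.inp.tail) 1 := rfl
theorem wp_write : wp B (.write i) h Q = Q (h.setOut (h.out ++ [h.reg i])) 1 := rfl
theorem wp_seq : wp B (.seq p q) h Q =
    wp B p h fun h' k => wp B q h' fun h'' k' => Q h'' (k + k') := rfl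
theorem wp_ite : wp B (.ite i p q) h Q = ((h.reg i ≠ 0 → wp B p h fun h' k => Q h' (k + 1)) ∧
    (h.reg i = 0 → wp B q h fun h' k => Q h' (k + 1))) := rfl
theorem wp_ifle :
    wp B (.ifle i j p q) h Q = ((h.reg i ≤ h.reg j → wp B p h fun h' k => Q h' (k + 1)) ∧
      (h.reg j < h.reg i → wp B q h fun h' k => Q h' (k + 1))) := rfl

end

/-- The state `s` of the machine represents the state `h` of the structured language, in which
all numbers are below `2 ^ B`. -/
structure Sim (B : ℕ) (h : Store) (s : State) : Prop where
  reg : ∀ i, s.reg (i + 2) = h.reg i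
  arr : ∀ a < 8, ∀ i, s.mem (8 * i + a) = h.arr a i
  inp : s.inp = h.inp
  out : s.out = h.out
  reg_lt : ∀ i, h.reg i < 2 ^ B
  arr_lt : ∀ a < 8, ∀ i, h.arr a i < 2 ^ B
  inp_lt : ∀ x ∈ h.inp, x < 2 ^ B

theorem Sim.setReg {B : ℕ} {h : Store} {s : State} (H : Sim B h s) (i : ℕ) {x : ℕ}
    (hx : x < 2 ^ B) : Sim B (h.set i x) (s.setReg (i + 2) x) where
  reg j := by simp [State.setReg, Store.set, Function.update_apply, H.reg]
  arr := H.arr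
  inp := H.inp
  out := H.out
  reg_lt j := by
    have := H.reg_lt j
    simp only [Store.set]
    split_ifs <;> assumption
  arr_lt := H.arr_lt
  inp_lt := H.inp_lt

/-- Registers 0 and 1 represent nothing, so the compiled code may use them freely. -/
theorem Sim.scratch {B : ℕ} {h : Store} {s : State} (H : Sim B h s) {i : ℕ} (hi : i < 2) (x : ℕ) :
    Sim B h (s.setReg i x) where
  reg j := by simp [State.setReg, H.reg, show j + 2 ≠ i by omega]
  arr := H.arr
  inp := H.inp
  out := H.out
  reg_lt := H.reg_lt
  arr_lt := H.arr_lt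
  inp_lt := H.inp_lt

theorem Sim.size_reg_le {B : ℕ} {h : Store} {s : State} (H : Sim B h s) (i : ℕ) :
    Nat.size (s.reg (i + 2)) ≤ B := by
  rw [H.reg, Nat.size_le]
  exact H.reg_lt i

/-- Three doublings produce 8j, and the residue modulo 8 selects the array. The intermediate values
have at most B + 3 bits, which gives the time bound. -/
theorem exec_addressProg {B : ℕ} {h : Store} {s : State} (H : Sim B h s) {a : ℕ} (ha : a < 8)
    (j : ℕ) : ∃ s' t, Exec (addressProg a (j + 2)) s s' t ∧ Sim B h s' ∧
      s'.reg 0 = 8 * h.reg j + a ∧ t ≤ 8 * B + 30 := by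
  have hj := H.reg_lt j
  have size_le : ∀ x k, x < 2 ^ k * 2 ^ B → Nat.size x ≤ B + k := fun x k hx => by
    rw [Nat.size_le, pow_add, mul_comm]
    exact hx
  refine ⟨_, _, .seq (.add _ _ _ _) (.seq (.add _ _ _ _) (.seq (.add _ _ _ _)
    (.seq (.const _ _ _) (.add _ _ _ _)))), ?_, ?_, ?_⟩
  · exact ((((H.scratch (by omega) _).scratch (by omega) _).scratch (by omega) _).scratch
      (by omega) _).scratch (by omega) _
  · simp [State.setReg, H.reg]
    omega
  · simp only [State.setReg, Function.update_apply, H.reg]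
    norm_num
    have h1 := size_le (h.reg j) 0 (by omega)
    have h2 := size_le (h.reg j + h.reg j) 1 (by omega)
    have h3 := size_le (h.reg j + h.reg j + (h.reg j + h.reg j)) 2 (by omega)
    have h4 := size_le
      (h.reg j + h.reg j + (h.reg j + h.reg j) + (h.reg j + h.reg j + (h.reg j + h.reg j))) 3
      (by omega)
    have h5 : Nat.size a ≤ 3 := Nat.size_le.2 (by omega)
    omega

/-- The time that the machine needs for one step of the structured language. -/
def stepTime (B : ℕ) : ℕ := 20 * (B + 5)

/-- The translation is correct: a command that satisfies `wp` can be run on the machine. -/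
theorem exec_of_wp {B : ℕ} (hB : 1 ≤ B) (p : Cmd) : ∀ (h : Store) (s : State)
    (Q : Store → ℕ → Prop), Sim B h s → wp B p h Q →
    ∃ h' k s' t, Exec p.compile s s' t ∧ Sim B h' s' ∧ t ≤ k * stepTime B ∧ Q h' k := by
  have one_lt : 1 < 2 ^ B := Nat.one_lt_two_pow (by omega)
  have size_one : Nat.size 1 = 1 := by decide
  induction p with
  | skip =>
    refine fun h s Q H hw => ⟨h, 1, s, _, .skip s, H, ?_, hw⟩
    simp only [stepTime]; omega
  | const i c =>
    refine fun h s Q H hw => ⟨_, 1, _, _, .const _ _ _, H.setReg i hw.1, ?_, hw.2⟩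
    have := Nat.size_le.2 hw.1
    simp only [stepTime]; omega
  | mov i j =>
    refine fun h s Q H hw => ⟨_, 1, _, _, .seq (.const _ _ _) (.add _ _ _ _), ?_, ?_, hw⟩
    · have := (H.scratch (i := 0) (by omega) 0).setReg i (H.reg_lt j)
      simpa [State.setReg, Function.update_apply, H.reg] using this
    · have := H.size_reg_le j
      simp [State.setReg, stepTime]; omega
  | inc i =>
    refine fun h s Q H hw => ⟨_, 1, _, _, .seq (.const _ _ _) (.add _ _ _ _), ?_, ?_, hw.2⟩
    · have := (H.scratch (i := 0) (by omega) 1).setReg i hw.1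
      simpa [State.setReg, Function.update_apply, H.reg] using this
    · have := H.size_reg_le i
      simp [State.setReg, stepTime]; omega
  | add i j k =>
    refine fun h s Q H hw => ⟨_, 1, _, _, .add _ _ _ _, ?_, ?_, hw.2⟩
    · rw [H.reg, H.reg]
      exact H.setReg i hw.1
    · have := H.size_reg_le j
      have := H.size_reg_le k
      simp only [stepTime]; omega
  | sub i j k =>
    refine fun h s Q H hw => ⟨_, 1, _, _, .sub _ _ _ _, ?_, ?_, hw⟩
    · rw [H.reg, H.reg]
      exact H.setReg i ((Nat.sub_le _ _).trans_lt (H.reg_lt j))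
    · have := H.size_reg_le j
      have := H.size_reg_le k
      simp only [stepTime]; omega
  | ld a i j =>
    intro h s Q H hw
    obtain ⟨s1, t1, e1, H1, h0, ht⟩ := exec_addressProg H hw.1 j
    refine ⟨_, 1, _, _, .seq e1 (.load _ _ _), ?_, ?_, hw.2⟩
    · rw [h0, H1.arr _ hw.1]
      exact H1.setReg i (H.arr_lt _ hw.1 _)
    · rw [h0, H1.arr _ hw.1]
      have h1 := Nat.size_le.2 (H.arr_lt _ hw.1 (h.reg j))
      have h2 : Nat.size (8 * h.reg j + a) ≤ B + 3 := by
        have := H.reg_lt j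
        have := hw.1
        rw [Nat.size_le, pow_add]
        omega
      simp only [stepTime]; omega
  | st a i j =>
    intro h s Q H hw
    obtain ⟨s1, t1, e1, H1, h0, ht⟩ := exec_addressProg H hw.1 i
    refine ⟨_, 1, _, _, .seq e1 (.store _ _ _), ?_, ?_, hw.2⟩
    · rw [h0, H1.reg]
      refine ⟨H1.reg, ?_, H1.inp, H1.out, H.reg_lt, ?_, H.inp_lt⟩
      · intro b hb k
        have := hw.1
        simp only [State.setMem, Function.update_apply, Store.setArr, H1.arr b hb]
        refine if_congr ?_ rfl rfl
        omega
      · intro b hb k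
        simp only [Store.setArr]
        split_ifs
        exacts [H.reg_lt _, H.arr_lt _ hb _]
    · rw [h0, H1.reg]
      have h1 := Nat.size_le.2 (H.reg_lt j)
      have h2 : Nat.size (8 * h.reg i + a) ≤ B + 3 := by
        have := H.reg_lt i
        have := hw.1
        rw [Nat.size_le, pow_add]
        omega
      simp only [stepTime]; omega
  | read i =>
    intro h s Q H hw
    have hlt : h.inp.headD 0 < 2 ^ B := by
      have := H.inp_lt
      revert this
      cases h.inp <;> simp +contextual
    have := H.setReg i hlt
    refine ⟨_, 1, _, _, .read _ _, ?_, ?_, hw⟩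
    · rw [H.inp]
      exact ⟨this.reg, this.arr, rfl, this.out, this.reg_lt, this.arr_lt,
        fun x hx => H.inp_lt x (List.mem_of_mem_tail hx)⟩
    · rw [H.inp]
      have := Nat.size_le.2 hlt
      simp only [stepTime]; omega
  | write i =>
    refine fun h s Q H hw => ⟨_, 1, _, _, .write _ _, ?_, ?_, hw⟩
    · exact ⟨H.reg, H.arr, H.inp, by simp [H.out, H.reg, Store.setOut], H.reg_lt, H.arr_lt, H.inp_lt⟩
    · have := H.size_reg_le i
      simp only [stepTime]; omega
  | seq p q hp hq =>
    intro h s Q H hw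
    obtain ⟨h1, k1, s1, t1, e1, H1, ht1, hw1⟩ := hp _ _ _ H hw
    obtain ⟨h2, k2, s2, t2, e2, H2, ht2, hw2⟩ := hq _ _ _ H1 hw1
    refine ⟨h2, k1 + k2, s2, _, .seq e1 e2, H2, ?_, hw2⟩
    rw [add_mul]
    omega
  | ite i p q hp hq =>
    intro h s Q H hw
    have hsize := H.size_reg_le i
    by_cases hi : h.reg i = 0
    · obtain ⟨h1, k1, s1, t1, e1, H1, ht1, hw1⟩ := hq _ _ _ H (hw.2 hi)
      refine ⟨h1, k1 + 1, s1, _, .ite_false (by rw [H.reg, hi]) e1, H1, ?_, hw1⟩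
      rw [add_mul]
      simp only [stepTime] at *; omega
    · obtain ⟨h1, k1, s1, t1, e1, H1, ht1, hw1⟩ := hp _ _ _ H (hw.1 hi)
      refine ⟨h1, k1 + 1, s1, _, .ite_true (by rwa [H.reg]) e1, H1, ?_, hw1⟩
      rw [add_mul]
      simp only [stepTime] at *; omega
  | ifle i j p q hp hq =>
    intro h s Q H hw
    have hi := H.size_reg_le i
    have hj := H.size_reg_le j
    have hd : Nat.size (s.reg (i + 2) - s.reg (j + 2)) ≤ B := by
      rw [Nat.size_le, H.reg, H.reg]
      exact (Nat.sub_le _ _).trans_lt (H.reg_lt i)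
    have hsub := Exec.sub s 0 (i + 2) (j + 2)
    have H0 := H.scratch (i := 0) (by omega) (s.reg (i + 2) - s.reg (j + 2))
    have h0 : (s.setReg 0 (s.reg (i + 2) - s.reg (j + 2))).reg 0 =
      s.reg (i + 2) - s.reg (j + 2) := by simp [State.setReg]
    by_cases hle : h.reg i ≤ h.reg j
    · obtain ⟨h1, k1, s1, t1, e1, H1, ht1, hw1⟩ := hp _ _ _ H0 (hw.1 hle)
      refine ⟨h1, k1 + 1, s1, _, .seq hsub (.ite_false ?_ e1), H1, ?_, hw1⟩
      · rw [h0, H.reg, H.reg]; omega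
      · rw [h0, add_mul]
        simp only [stepTime] at *; omega
    · obtain ⟨h1, k1, s1, t1, e1, H1, ht1, hw1⟩ := hq _ _ _ H0 (hw.2 (by omega))
      refine ⟨h1, k1 + 1, s1, _, .seq hsub (.ite_true ?_ e1), H1, ?_, hw1⟩
      · rw [h0, H.reg, H.reg]; omega
      · rw [h0, add_mul]
        simp only [stepTime] at *; omega
  | rep i j p hp =>
    -- An exhausted loop is charged two steps. One pays for the final test; the other is the
    -- `stepTime B` reserved on the left, which pays for loading the counter before the loop.
    have key : ∀ n (h : Store) (s : State) (Q : Store → ℕ → Prop), h.reg i = n → Sim B h s →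
        iterWp (wp B p) i n h Q → ∃ h' k s' t, Exec (.loop (i + 2)
          (.seq (.seq (.const 0 1) (.sub (i + 2) (i + 2) 0)) p.compile)) s s' t ∧ Sim B h' s' ∧
          t + stepTime B ≤ k * stepTime B ∧ Q h' k := by
      intro n
      induction n with
      | zero =>
        refine fun h s Q hn H hw => ⟨h, 2, s, _, .loop_exit (by rw [H.reg, hn]), H, ?_, hw⟩
        have := H.size_reg_le i
        simp only [stepTime]; omega
      | succ n ih =>
        intro h s Q hn H hw
        have hi := H.size_reg_le i
        have H1 : Sim B (h.set i n) ((s.setReg 0 1).setReg (i + 2)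
            ((s.setReg 0 1).reg (i + 2) - (s.setReg 0 1).reg 0)) := by
          have := (H.scratch (i := 0) (by omega) 1).setReg i (x := n) (by
            have := H.reg_lt i; omega)
          simpa [State.setReg, Function.update_apply, H.reg, hn] using this
        obtain ⟨h1, k1, s1, t1, e1, H1, ht1, hn1, hw1⟩ := hp _ _ _ H1 hw
        obtain ⟨h2, k2, s2, t2, e2, H2, ht2, hw2⟩ := ih h1 s1 _ hn1 H1 hw1
        refine ⟨h2, k1 + k2 + 1, s2, _, .loop_step (by rw [H.reg, hn]; omega)
          (.seq (.seq (.const _ _ _) (.sub _ _ _ _)) e1) e2, H2, ?_, hw2⟩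
        simp only [add_mul, one_mul]
        have : 1 + Nat.size (s.reg (i + 2)) + ((1 + Nat.size 1) + (1 +
          Nat.size ((s.setReg 0 1).reg (i + 2)) + Nat.size ((s.setReg 0 1).reg 0))) ≤
            stepTime B := by
          simp [State.setReg, stepTime]
          omega
        omega
    intro h s Q H hw
    have H1 : Sim B (h.set i (h.reg j)) ((s.setReg 0 0).setReg (i + 2)
        ((s.setReg 0 0).reg (j + 2) + (s.setReg 0 0).reg 0)) := by
      have := (H.scratch (i := 0) (by omega) 0).setReg i (H.reg_lt j)
      simpa [State.setReg, Function.update_apply, H.reg] using this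
    obtain ⟨h2, k2, s2, t2, e2, H2, ht2, hw2⟩ := key _ _ _ Q (by simp) H1 hw
    refine ⟨h2, k2, s2, _, .seq (.seq (.const _ _ _) (.add _ _ _ _)) e2, H2, ?_, hw2⟩
    have := H.size_reg_le j
    have : (1 + Nat.size 0) + (1 + Nat.size ((s.setReg 0 0).reg (j + 2)) +
        Nat.size ((s.setReg 0 0).reg 0)) ≤ stepTime B := by
      simp [State.setReg, stepTime]
      omega
    omega

end Ram

/-! ### Counting the ideals of the unanimity order -/

namespace Kemeny

/-- `S` is an ideal (down-set) of the unanimity order. -/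
def IsIdeal {m n : ℕ} (V : Profile m n) (S : Finset (Fin m)) : Prop :=
  ∀ x ∈ S, ∀ y, Unanimous V y x → y ∈ S

open Classical in
/-- The set of all ideals of the unanimity order. -/
noncomputable def ideals {m n : ℕ} (V : Profile m n) : Finset (Finset (Fin m)) :=
  Finset.univ.filter (IsIdeal V)

theorem mem_ideals {m n : ℕ} {V : Profile m n} {S : Finset (Fin m)} :
    S ∈ ideals V ↔ IsIdeal V S := by
  simp [ideals]

theorem Unanimous.trans {m n : ℕ} {V : Profile m n} {a b c : Fin m} (hab : Unanimous V a b)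
    (hbc : Unanimous V b c) : Unanimous V a c := fun i => lt_trans (hab i) (hbc i)

theorem not_unanimous_self {m n : ℕ} (hn : 1 ≤ n) (V : Profile m n) (a : Fin m) :
    ¬ Unanimous V a a := fun h => lt_irrefl _ (h ⟨0, hn⟩)

theorem cocomparabilityGraph_adj {m n : ℕ} {V : Profile m n} {a b : Fin m} :
    (cocomparabilityGraph V).Adj a b ↔ a ≠ b ∧ ¬ Unanimous V a b ∧ ¬ Unanimous V b a := by
  simp only [cocomparabilityGraph, SimpleGraph.compl_adj, SimpleGraph.fromRel_adj]
  tauto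

/-- Two incomparable pairs that are separated by the same ideal have a common vertex or are joined
by an edge of the cocomparability graph. -/
theorem exists_touching {m n : ℕ} {V : Profile m n} {S : Finset (Fin m)} (hS : IsIdeal V S)
    {x y x' y' : Fin m} (hx : x ∈ S) (hy : y ∉ S) (hx' : x' ∈ S) (hy' : y' ∉ S)
    (h : (cocomparabilityGraph V).Adj x y) (h' : (cocomparabilityGraph V).Adj x' y') :
    ∃ a b, (a = x ∨ a = y) ∧ (b = x' ∨ b = y') ∧
      (a = b ∨ (cocomparabilityGraph V).Adj a b) := by
  by_contra! H
  have h1 := H x x' (.inl rfl) (.inl rfl)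
  have h2 := H x y' (.inl rfl) (.inr rfl)
  have h3 := H y x' (.inr rfl) (.inl rfl)
  simp only [cocomparabilityGraph_adj] at h h' h1 h2 h3
  -- The two candidates are comparable, and since `S` is down-closed the one inside `S` must be the
  -- smaller. The same argument gives `h3'`; then either order between `x` and `x'` makes one of the
  -- incomparable pairs comparable.
  have h2' : Unanimous V x y' := by
    by_contra hn
    exact h2.2 ⟨h2.1, hn, fun hu => hy' (hS _ hx _ hu)⟩
  have h3' : Unanimous V x' y := by
    by_contra hn
    exact h3.2 ⟨h3.1, fun hu => hy (hS _ hx' _ hu), hn⟩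
  by_cases hu : Unanimous V x x'
  · exact h.2.1 (hu.trans h3')
  · by_cases hu' : Unanimous V x' x
    · exact h'.2.1 (hu'.trans h2')
    · exact h1.2 ⟨h1.1, hu, hu'⟩

namespace PathDecomposition

variable {C : Type*} {G : SimpleGraph C} (D : PathDecomposition G)

theorem mem_bag_of_le {i j k : Fin D.t} (hij : i ≤ j) (hjk : j ≤ k) {v : C} (hi : v ∈ D.bag i)
    (hk : v ∈ D.bag k) : v ∈ D.bag j := by
  rcases hij.eq_or_lt with rfl | hij
  · exact hi
  rcases hjk.eq_or_lt with rfl | hjk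
  · exact hk
  exact D.interpolation i j k hij hjk v hi hk

theorem exists_first (v : C) : ∃ i, v ∈ D.bag i ∧ ∀ j, v ∈ D.bag j → i ≤ j := by
  classical
  obtain ⟨i, hi⟩ := D.vertex_mem v
  have hne : (Finset.univ.filter fun i => v ∈ D.bag i).Nonempty := ⟨i, by simpa using hi⟩
  exact ⟨_, (Finset.mem_filter.1 (Finset.min'_mem _ hne)).2,
    fun j hj => Finset.min'_le _ j (Finset.mem_filter.2 ⟨Finset.mem_univ _, hj⟩)⟩

/-- The index of the first bag that contains `v`. -/
noncomputable def first (v : C) : Fin D.t := (D.exists_first v).choose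

theorem mem_first (v : C) : v ∈ D.bag (D.first v) := (D.exists_first v).choose_spec.1

theorem first_le {v : C} {j : Fin D.t} (h : v ∈ D.bag j) : D.first v ≤ j :=
  (D.exists_first v).choose_spec.2 j h

/-- The truncated subtraction in the width is harmless in this direction. -/
theorem card_bag_le (i : Fin D.t) : (D.bag i).card ≤ D.width + 1 := by
  have := Finset.le_sup (f := fun i => (D.bag i).card) (Finset.mem_univ i)
  simp only [width] at *
  omega

/-- Helly property: pairwise touching edges are all hit by one of the first bags of vertices. -/
theorem exists_hitting_bag [Finite C] [Nonempty C] (E : C → C → Prop)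
    (hE : ∀ x y, E x y → G.Adj x y)
    (touch : ∀ x y x' y', E x y → E x' y' →
      ∃ a b, (a = x ∨ a = y) ∧ (b = x' ∨ b = y') ∧ (a = b ∨ G.Adj a b)) :
    ∃ v, ∀ x y, E x y → x ∈ D.bag (D.first v) ∨ y ∈ D.bag (D.first v) := by
  by_cases hne : ∃ p : C × C, E p.1 p.2
  swap
  · obtain ⟨v⟩ := ‹Nonempty C›
    exact ⟨v, fun x y h => absurd ⟨(x, y), h⟩ hne⟩
  -- The bags meeting an edge form an interval, because its ends share a bag, and the minimum below
  -- is the left end of that interval. The edge whose left end lies furthest right is chosen. Every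
  -- other interval starts no later and touches the chosen one, so it contains this left end.
  obtain ⟨⟨x, y⟩, hxy, hmax⟩ := Set.exists_max_image {p : C × C | E p.1 p.2}
    (fun p => min (D.first p.1) (D.first p.2)) (Set.toFinite _) hne
  simp only [Set.mem_ofPred_eq, Prod.forall] at hxy hmax
  obtain ⟨v, hv⟩ : ∃ v, D.first v = min (D.first x) (D.first y) := by
    rcases le_total (D.first x) (D.first y) with h | h
    · exact ⟨x, by simp [h]⟩
    · exact ⟨y, by simp [h]⟩
  refine ⟨v, fun x' y' h' => ?_⟩
  obtain ⟨a, b, ha, hb, hab⟩ := touch x y x' y' hxy h'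
  obtain ⟨i, hai, hbi⟩ : ∃ i, a ∈ D.bag i ∧ b ∈ D.bag i := by
    rcases hab with rfl | hab
    · obtain ⟨i, hi⟩ := D.vertex_mem a
      exact ⟨i, hi, hi⟩
    · exact D.edge_mem a b hab
  have hvi : D.first v ≤ i := by
    rw [hv]
    refine le_trans ?_ (D.first_le hai)
    rcases ha with rfl | rfl
    exacts [min_le_left _ _, min_le_right _ _]
  obtain ⟨j, hxj, hyj⟩ := D.edge_mem x' y' (hE _ _ h')
  have hle := hmax x' y' h'
  rw [← hv, min_le_iff] at hle
  have hjv := le_total (D.first v) j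
  -- One end of the edge occurs no later than bag `first v`, and `b` occurs in bag `i`, no earlier
  -- than it. If these are the same end, its bags are consecutive and cover `first v`. If not, the
  -- common bag `j` decides: the early end covers when `j` lies to the right of `first v`, and `b`
  -- covers when `j` lies to the left.
  rcases hle with hle | hle <;> rcases hb with rfl | rfl
  · exact .inl (D.mem_bag_of_le hle hvi (D.mem_first _) hbi)
  · rcases hjv with hj | hj
    · exact .inl (D.mem_bag_of_le hle hj (D.mem_first _) hxj)
    · exact .inr (D.mem_bag_of_le hj hvi hyj hbi)
  · rcases hjv with hj | hj
    · exact .inr (D.mem_bag_of_le hle hj (D.mem_first _) hyj)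
    · exact .inl (D.mem_bag_of_le hj hvi hxj hbi)
  · exact .inr (D.mem_bag_of_le hle hvi (D.mem_first _) hbi)

end PathDecomposition

/-- The decomposition with a single bag exists, so the infimum is taken over a nonempty set and is
attained. -/
theorem exists_pathDecomposition {C : Type*} [Fintype C] (G : SimpleGraph C) :
    ∃ D : PathDecomposition G, D.width = pathwidth G :=
  Nat.sInf_mem (s := Set.range fun D : PathDecomposition G => D.width)
    ⟨_, ⟨1, fun _ => Finset.univ, by simp, by simp, by simp⟩, rfl⟩

/-- Ideals are grouped by a bag that hits all incomparable pairs they separate. Taking only first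
bags of candidates leaves m groups, however many bags the decomposition has. Within a group an ideal
is encoded by its intersection with the bag, at most 2^(w+1) choices, and by its size, m+1 choices.
-/
theorem card_ideals_le {m n : ℕ} (hm : 1 ≤ m) (V : Profile m n) :
    (ideals V).card ≤ m * ((m + 1) * 2 ^ (unanimityWidth V + 1)) := by
  classical
  obtain ⟨D, hD⟩ := exists_pathDecomposition (cocomparabilityGraph V)
  have : Nonempty (Fin m) := ⟨⟨0, hm⟩⟩
  let hits (v : Fin m) (S : Finset (Fin m)) : Prop := ∀ x ∈ S, ∀ y ∉ S,
    (cocomparabilityGraph V).Adj x y → x ∈ D.bag (D.first v) ∨ y ∈ D.bag (D.first v)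
  have hsub : ideals V ⊆ Finset.univ.biUnion fun v => (ideals V).filter (hits v) := by
    intro S hS
    have hS' := mem_ideals.1 hS
    obtain ⟨v, hv⟩ := D.exists_hitting_bag
      (fun x y => x ∈ S ∧ y ∉ S ∧ (cocomparabilityGraph V).Adj x y) (fun x y h => h.2.2)
      fun x y x' y' h h' => exists_touching hS' h.1 h.2.1 h'.1 h'.2.1 h.2.2 h'.2.2
    simp only [Finset.mem_biUnion, Finset.mem_univ, true_and, Finset.mem_filter]
    exact ⟨v, hS, fun x hx y hy h => hv x y ⟨hx, hy, h⟩⟩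
  have hcard (v : Fin m) :
      ((ideals V).filter (hits v)).card ≤ (m + 1) * 2 ^ (unanimityWidth V + 1) := by
    have hle : ((D.bag (D.first v)).powerset ×ˢ Finset.range (m + 1)).card ≤
        (m + 1) * 2 ^ (unanimityWidth V + 1) := by
      rw [Finset.card_product, Finset.card_powerset, Finset.card_range, mul_comm]
      refine Nat.mul_le_mul_left _ (Nat.pow_le_pow_right (by omega) ?_)
      exact (D.card_bag_le _).trans_eq (by rw [hD, unanimityWidth])
    -- Two different sets of equal size each have an element outside the other. If they agree on the
    -- bag, both of these elements lie outside it.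
    refine (Finset.card_le_card_of_injOn (fun S => (S ∩ D.bag (D.first v), S.card)) ?_ ?_).trans hle
    · intro S _
      have := Finset.card_le_univ S
      simp only [Fintype.card_fin] at this
      simp only [Finset.coe_product, Set.mem_prod, Finset.mem_coe, Finset.mem_powerset,
        Finset.mem_range]
      exact ⟨Finset.inter_subset_right, by omega⟩
    · intro S hS S' hS' heq
      simp only [Finset.coe_filter, Set.mem_ofPred_eq, mem_ideals] at hS hS'
      simp only [Prod.mk.injEq] at heq
      obtain ⟨hB, hc⟩ := heq
      by_contra hne
      obtain ⟨x, hx, hx'⟩ : ∃ x ∈ S, x ∉ S' := by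
        by_contra! hss
        exact hne (Finset.eq_of_subset_of_card_le hss hc.ge)
      obtain ⟨y, hy', hy⟩ : ∃ y ∈ S', y ∉ S := by
        by_contra! hss
        exact hne (Finset.eq_of_subset_of_card_le hss hc.le).symm
      have hxB : x ∉ D.bag (D.first v) := fun hb => hx' (Finset.mem_of_mem_inter_left
        (hB ▸ Finset.mem_inter.2 ⟨hx, hb⟩ : x ∈ S' ∩ D.bag (D.first v)))
      have hyB : y ∉ D.bag (D.first v) := fun hb => hy (Finset.mem_of_mem_inter_left
        (hB ▸ Finset.mem_inter.2 ⟨hy', hb⟩ : y ∈ S ∩ D.bag (D.first v)))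
      -- Both sets are down-closed, so neither `x` nor `y` can precede the other. They form an
      -- incomparable pair separated by `S` that avoids the bag.
      have hadj : (cocomparabilityGraph V).Adj x y := cocomparabilityGraph_adj.2
        ⟨by rintro rfl; exact hy hx, fun hu => hx' (hS'.1 y hy' x hu),
          fun hu => hy (hS.1 x hx y hu)⟩
      exact (hS.2 x hx y hy hadj).elim hxB hyB
  calc (ideals V).card ≤ _ := Finset.card_le_card hsub
    _ ≤ ∑ v, ((ideals V).filter (hits v)).card := Finset.card_biUnion_le
    _ ≤ ∑ _v : Fin m, (m + 1) * 2 ^ (unanimityWidth V + 1) := Finset.sum_le_sum fun v _ => hcard v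
    _ = _ := by simp

end Kemeny

/-! ### Kemeny rankings and the dynamic program over ideals -/

namespace Kemeny

/-- The number of votes that place `a` before `b`. -/
def wt {m n : ℕ} (V : Profile m n) (a b : Fin m) : ℕ :=
  (Finset.univ.filter fun i => Prefers (V i) a b).card

theorem wt_self {m n : ℕ} (V : Profile m n) (a : Fin m) : wt V a a = 0 := by
  simp [wt, Prefers]

theorem wt_le {m n : ℕ} (V : Profile m n) (a b : Fin m) : wt V a b ≤ n :=
  (Finset.card_le_univ _).trans_eq (by simp)

theorem wt_eq_iff {m n : ℕ} {V : Profile m n} {a b : Fin m} :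
    wt V a b = n ↔ Unanimous V a b := by
  have : wt V a b = n ↔ wt V a b = (Finset.univ : Finset (Fin n)).card := by simp
  rw [this, wt, Finset.card_filter_eq_iff]
  simp [Unanimous]

/-- The cost of placing `x` directly after the elements of `S` and before all others. -/
def stepCost {m n : ℕ} (V : Profile m n) (S : Finset (Fin m)) (x : Fin m) : ℕ :=
  ∑ y ∈ Sᶜ, wt V y x

theorem stepCost_le {m n : ℕ} (V : Profile m n) (S : Finset (Fin m)) (x : Fin m) :
    stepCost V S x ≤ m * n := by
  refine (Finset.sum_le_card_nsmul _ _ n fun y _ => wt_le V y x).trans ?_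
  have := Finset.card_le_univ Sᶜ
  rw [Fintype.card_fin] at this
  exact Nat.mul_le_mul_right _ this

/-- The cost of a list of candidates that is the end of a ranking. -/
def listCost {m n : ℕ} (V : Profile m n) : List (Fin m) → ℕ
  | [] => 0
  | x :: l => (l.map fun y => wt V y x).sum + listCost V l

theorem listCost_ofFn {m n : ℕ} (V : Profile m n) {k : ℕ} (g : Fin k → Fin m) :
    listCost V (List.ofFn g) = ∑ i, ∑ j, if i < j then wt V (g j) (g i) else 0 := by
  induction k with
  | zero => simp [listCost]
  | succ k ih =>
    rw [List.ofFn_succ, listCost, ih, Fin.sum_univ_succ]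
    congr 1
    · simp [Fin.sum_univ_succ, List.map_ofFn, List.sum_ofFn]
    · simp [Fin.sum_univ_succ]

/-- Each pair with `a` before `b` in `Q` costs the number of votes that place `b` before `a`.
Exchanging the sum over votes with the sum over pairs gives the score. -/
theorem score_eq_listCost {m n : ℕ} (V : Profile m n) (Q : Ranking m) :
    score V Q = listCost V (List.ofFn Q) := by
  rw [listCost_ofFn, ← Q.symm.sum_comp]
  have (a : Fin m) : (∑ j, if Q.symm a < j then wt V (Q j) (Q (Q.symm a)) else 0) =
      ∑ b, if Q.symm a < Q.symm b then wt V b a else 0 := by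
    rw [← Q.symm.sum_comp]
    simp
  rw [Finset.sum_congr rfl fun a _ => this a]
  simp only [score, ktDist, wt, Finset.card_filter, Fintype.sum_prod_type]
  rw [Finset.sum_comm]
  refine Finset.sum_congr rfl fun a _ => ?_
  rw [Finset.sum_comm]
  refine Finset.sum_congr rfl fun b _ => ?_
  split_ifs with h
  · simp only [Prefers, h, true_and]
    exact Finset.sum_congr rfl fun i _ => if_congr Iff.rfl rfl rfl
  · simp [Prefers, h]

/-- Moving `a` before `b` decreases the distance to a vote that places `a` before `b`. -/
theorem ktDist_swap_lt {m : ℕ} {Q τ : Ranking m} {a b : Fin m} (hτ : Prefers τ a b)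
    (hQ : Prefers Q b a) : ktDist (Q.trans (Equiv.swap a b)) τ < ktDist Q τ := by
  have hab : a ≠ b := by
    rintro rfl
    exact lt_irrefl _ hQ
  have inj : ∀ {x y}, Q.symm x = Q.symm y → x = y := fun h => Q.symm.injective h
  have hmem : (b, a) ∈ Finset.univ.filter fun p : Fin m × Fin m =>
      Prefers Q p.1 p.2 ∧ Prefers τ p.2 p.1 := by simpa using ⟨hQ, hτ⟩
  unfold ktDist
  rw [← Finset.card_erase_add_one hmem, Nat.lt_succ_iff]
  let s := Equiv.swap a b
  have hs : ∀ x, (Q.trans (Equiv.swap a b)).symm x = Q.symm (s x) := fun x => by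
    simp [s]
  -- Disagreements after the swap are injected into the old ones other than `(b, a)`. A pair that
  -- `Q` already ordered that way is kept; any other pair has `a` and `b` exchanged in it. The two
  -- kinds of images do not meet, since the swapped ranking orders kept pairs as they stand but not
  -- the exchanged ones.
  refine Finset.card_le_card_of_injOn
    (fun p => if Prefers Q p.1 p.2 then p else (s p.1, s p.2)) ?_ ?_
  · rintro ⟨x, y⟩ hp
    simp only [Finset.coe_filter, Set.mem_ofPred_eq, Finset.mem_univ, true_and, Prefers, hs] at hp
    simp only [Finset.coe_erase, Prefers]
    simp only [Prefers] at hτ hQ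
    by_cases hxa : x = a <;> by_cases hxb : x = b <;> by_cases hya : y = a <;>
      by_cases hyb : y = b <;> simp only [s, hxa, hxb, hya, hyb, Equiv.swap_apply_left,
        Equiv.swap_apply_right, Equiv.swap_apply_of_ne_of_ne, ne_eq, not_false_eq_true] at hp ⊢ <;>
      split_ifs <;> simp_all <;> grind
  · rintro ⟨x, y⟩ hp ⟨x', y'⟩ hp' heq
    simp only [Finset.coe_filter, Set.mem_ofPred_eq, Finset.mem_univ, true_and, Prefers, hs]
      at hp hp' heq
    have hss : ∀ x, s (s x) = x := fun x => by simp [s]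
    by_cases h1 : Q.symm x < Q.symm y <;> by_cases h2 : Q.symm x' < Q.symm y' <;>
      simp only [h1, h2, if_true, if_false] at heq
    · exact heq
    · simp only [Prod.mk.injEq] at heq
      simp only [heq.1, heq.2, hss] at hp
      exact absurd hp.1 h2
    · simp only [Prod.mk.injEq] at heq
      simp only [← heq.1, ← heq.2, hss] at hp'
      exact absurd hp'.1 h1
    · simpa using heq

/-- Kemeny rankings extend the unanimity order. -/
theorem prefers_of_unanimous {m n : ℕ} (hn : 1 ≤ n) {V : Profile m n} {Q : Ranking m}
    (hQ : Q ∈ kemenyRankings V) {a b : Fin m} (h : Unanimous V a b) : Prefers Q a b := by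
  by_contra hab
  have hne : a ≠ b := by
    rintro rfl
    exact not_unanimous_self hn V _ h
  have hba : Prefers Q b a :=
    lt_of_le_of_ne (not_lt.1 hab) fun he => hne (Q.symm.injective he).symm
  have : Nonempty (Fin n) := ⟨⟨0, hn⟩⟩
  have hlt : score V (Q.trans (Equiv.swap a b)) < score V Q :=
    Finset.sum_lt_sum_of_nonempty Finset.univ_nonempty fun i _ => ktDist_swap_lt (h i) hba
  exact absurd ((Finset.mem_filter.1 hQ).2 (Q.trans (Equiv.swap a b))) (not_le.2 hlt)

/-- The candidates that do not occur in a list. -/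
def rest {m : ℕ} (l : List (Fin m)) : Finset (Fin m) := l.toFinsetᶜ

theorem mem_rest {m : ℕ} {l : List (Fin m)} {x : Fin m} : x ∈ rest l ↔ x ∉ l := by simp [rest]

theorem rest_cons {m : ℕ} (x : Fin m) (l : List (Fin m)) : rest (x :: l) = (rest l).erase x := by
  ext y
  simp [mem_rest]

theorem insert_rest_cons {m : ℕ} {x : Fin m} {l : List (Fin m)} (h : x ∉ l) :
    insert x (rest (x :: l)) = rest l := by
  rw [rest_cons, Finset.insert_erase (mem_rest.2 h)]

/-- The complement of the prefix contains `x` itself, which contributes nothing because `wt V x x =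
0`. -/
theorem stepCost_rest_cons {m n : ℕ} (V : Profile m n) {x : Fin m} {l : List (Fin m)}
    (h : (x :: l).Nodup) : stepCost V (rest (x :: l)) x = (l.map fun y => wt V y x).sum := by
  rw [stepCost, rest, compl_compl, List.sum_toFinset _ h]
  simp [wt_self]

/-- `f` solves the equations of the dynamic program over the ideals: `f S - 1` is the minimum cost
of an arrangement of `S`, and `f S = 0` if `S` is not an ideal. -/
structure IsBellman {m n : ℕ} (V : Profile m n) (f : Finset (Fin m) → ℕ) : Prop where
  ne_zero : ∀ S, f S ≠ 0 ↔ IsIdeal V S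
  le : ∀ S x, IsIdeal V S → x ∉ S → IsIdeal V (insert x S) → f (insert x S) ≤ f S + stepCost V S x
  exists_eq : ∀ S, IsIdeal V S → S.Nonempty →
    ∃ x ∈ S, IsIdeal V (S.erase x) ∧ f S = f (S.erase x) + stepCost V (S.erase x) x

/-- The list `l` is an optimal end of a ranking, according to the dynamic program. -/
def Tight {m n : ℕ} (V : Profile m n) (f : Finset (Fin m) → ℕ) : List (Fin m) → Prop
  | [] => True
  | x :: l => Tight V f l ∧ x ∉ l ∧ IsIdeal V (rest (x :: l)) ∧
      f (rest l) = f (rest (x :: l)) + stepCost V (rest (x :: l)) x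

section

variable {m n : ℕ} {V : Profile m n} {f : Finset (Fin m) → ℕ}

theorem Tight.nodup {l : List (Fin m)} (h : Tight V f l) : l.Nodup := by
  induction l with
  | nil => exact List.nodup_nil
  | cons x l ih => exact List.nodup_cons.2 ⟨h.2.1, ih h.1⟩

theorem Tight.isIdeal {l : List (Fin m)} (h : Tight V f l) : IsIdeal V (rest l) := by
  cases l with
  | nil => exact fun x _ y _ => by simp [mem_rest]
  | cons x l => exact h.2.2.1

/-- The optimum at an ideal is attained by some last candidate. Partial rankings grown from the back
therefore never get stuck, which is what makes keeping only r of them safe. -/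
theorem Tight.exists_cons (hf : IsBellman V f) {l : List (Fin m)} (h : Tight V f l)
    (hne : (rest l).Nonempty) : ∃ x, Tight V f (x :: l) := by
  obtain ⟨x, hx, hi, he⟩ := hf.exists_eq _ h.isIdeal hne
  rw [← rest_cons] at hi he
  exact ⟨x, h, mem_rest.1 hx, hi, he⟩

theorem rest_nonempty {l : List (Fin m)} (h : l.length < m) : (rest l).Nonempty := by
  rw [← Finset.card_pos, rest, Finset.card_compl, Fintype.card_fin]
  have := l.toFinset_card_le
  omega

theorem exists_tight (hf : IsBellman V f) (k : ℕ) (hk : k ≤ m) :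
    ∃ l, Tight V f l ∧ l.length = k := by
  induction k with
  | zero => exact ⟨[], trivial, rfl⟩
  | succ k ih =>
    obtain ⟨l, hl, rfl⟩ := ih (by omega)
    obtain ⟨x, hx⟩ := hl.exists_cons hf (rest_nonempty hk)
    exact ⟨_, hx, rfl⟩

theorem exists_ranking {l : List (Fin m)} (h : l.Nodup) (hl : l.length = m) :
    ∃ Q : Ranking m, List.ofFn Q = l := by
  refine ⟨Equiv.ofBijective (fun i => l.get (Fin.cast hl.symm i))
    (Finite.injective_iff_bijective.1 (h.injective_get.comp (Fin.cast_injective _))), ?_⟩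
  exact List.ext_getElem (by simp [hl]) (by simp)

theorem Tight.listCost_eq {l : List (Fin m)} (h : Tight V f l) :
    f Finset.univ = f (rest l) + listCost V l := by
  induction l with
  | nil => simp [rest, listCost]
  | cons x l ih =>
    rw [ih h.1, h.2.2.2, stepCost_rest_cons V h.nodup, listCost, add_assoc]

/-- The Bellman inequalities telescope along the suffixes of the list. Equality of the sums forces
equality in every single inequality, which is tightness. -/
theorem IsBellman.listCost_ge (hf : IsBellman V f) {l : List (Fin m)} (hl : l.Nodup)
    (hi : ∀ l', l' <:+ l → IsIdeal V (rest l')) :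
    f Finset.univ ≤ f (rest l) + listCost V l ∧
      (f Finset.univ = f (rest l) + listCost V l → Tight V f l) := by
  induction l with
  | nil => simp [rest, listCost, Tight]
  | cons x l ih =>
    have hx := (List.nodup_cons.1 hl).1
    obtain ⟨h1, h2⟩ := ih hl.of_cons fun l' h => hi l' (h.trans (List.suffix_cons _ _))
    have h3 := hf.le _ x (hi _ List.suffix_rfl) (by simp [mem_rest])
      (by rw [insert_rest_cons hx]; exact hi _ (List.suffix_cons _ _))
    rw [insert_rest_cons hx, stepCost_rest_cons V hl] at h3
    rw [listCost]
    refine ⟨by omega, fun h => ⟨h2 (by omega), hx, hi _ List.suffix_rfl, ?_⟩⟩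
    rw [stepCost_rest_cons V hl]
    omega

/-- What remains after removing a suffix of `Q` is a prefix of `Q`, and prefixes of a linear
extension are down-closed. -/
theorem isIdeal_rest_of_suffix {Q : Ranking m} (hQ : ∀ a b, Unanimous V a b → Prefers Q a b)
    {l : List (Fin m)} (hl : l <:+ List.ofFn Q) : IsIdeal V (rest l) := by
  obtain ⟨pre, hpre⟩ := hl
  have hp : (List.ofFn Q).Pairwise fun a b => Q.symm a < Q.symm b := by
    rw [List.pairwise_ofFn]
    simp
  rw [← hpre, List.pairwise_append] at hp
  intro x hx y hu
  rw [mem_rest] at hx ⊢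
  intro hy
  have hxp : x ∈ pre := by
    have : x ∈ List.ofFn Q := by
      rw [List.mem_ofFn]
      exact ⟨Q.symm x, by simp⟩
    rw [← hpre, List.mem_append] at this
    exact this.resolve_right hx
  exact lt_asymm (hp.2.2 x hxp y hy) (hQ y x hu)

theorem rest_ofFn (Q : Ranking m) : rest (List.ofFn Q) = ∅ := by
  ext x
  simp only [mem_rest, List.mem_ofFn, Finset.notMem_empty, iff_false, not_not]
  exact ⟨Q.symm x, by simp⟩

/-- Tight rankings all have score f(C) − f(∅), and at least one exists. A Kemeny ranking has ideals
as prefixes, so its score is no smaller, and equality makes it tight. Only differences of `f`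
matter, so the offset that keeps ideals away from the value 0 cancels. -/
theorem mem_kemenyRankings_iff (hn : 1 ≤ n) (hf : IsBellman V f) {Q : Ranking m} :
    Q ∈ kemenyRankings V ↔ Tight V f (List.ofFn Q) := by
  have eq_of_tight : ∀ {Q : Ranking m}, Tight V f (List.ofFn Q) →
      f Finset.univ = f ∅ + score V Q := fun {Q} h => by
    rw [h.listCost_eq, rest_ofFn, score_eq_listCost]
  have of_mem : ∀ {Q : Ranking m}, Q ∈ kemenyRankings V → f Finset.univ ≤ f ∅ + score V Q ∧
      (f Finset.univ = f ∅ + score V Q → Tight V f (List.ofFn Q)) := fun {Q} h => by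
    have := hf.listCost_ge (l := List.ofFn Q) (List.nodup_ofFn.2 Q.injective)
      fun l' hl' => isIdeal_rest_of_suffix (fun a b => prefers_of_unanimous hn h) hl'
    rwa [rest_ofFn, ← score_eq_listCost] at this
  constructor
  · intro h
    obtain ⟨l, hl, hlen⟩ := exists_tight hf m le_rfl
    obtain ⟨Q', rfl⟩ := exists_ranking hl.nodup hlen
    have h1 := of_mem h
    have h2 := eq_of_tight hl
    have h3 := (Finset.mem_filter.1 h).2 Q'
    exact h1.2 (by omega)
  · intro h
    obtain ⟨Q', -, hQ'⟩ := Finset.exists_min_image Finset.univ (score V)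
      (Finset.univ_nonempty (α := Ranking m))
    have hmem : Q' ∈ kemenyRankings V :=
      Finset.mem_filter.2 ⟨Finset.mem_univ _, fun R => hQ' R (Finset.mem_univ _)⟩
    have h1 := of_mem hmem
    have h2 := eq_of_tight h
    exact Finset.mem_filter.2 ⟨Finset.mem_univ _, fun R =>
      (by omega : score V Q ≤ score V Q').trans (hQ' R (Finset.mem_univ _))⟩

end

end Kemeny

/-! ### Sets of candidates as numbers, and the levels of the dynamic program -/

namespace Kemeny

/-- The number whose binary digits are the characteristic function of `S`. -/
def key {m : ℕ} (S : Finset (Fin m)) : ℕ := ∑ x ∈ S, 2 ^ (x : ℕ)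

/-- The part of the key that belongs to the candidates below `k`. -/
def lowKey {m : ℕ} (S : Finset (Fin m)) (k : ℕ) : ℕ := key (S.filter fun x => (x : ℕ) < k)

section

variable {m : ℕ}

theorem key_eq_sum_map (S : Finset (Fin m)) :
    key S = ∑ i ∈ S.map Fin.valEmbedding, 2 ^ i := by simp [key]

theorem key_injective : Function.Injective (key (m := m)) := fun S T h => by
  rw [key_eq_sum_map, key_eq_sum_map] at h
  exact Finset.map_injective _ (Finset.geomSum_injective le_rfl h)

theorem key_lt_of_forall {S : Finset (Fin m)} {k : ℕ} (h : ∀ x ∈ S, (x : ℕ) < k) :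
    key S < 2 ^ k := by
  rw [key_eq_sum_map]
  exact Nat.geomSum_lt le_rfl (by simpa using h)

theorem key_lt (S : Finset (Fin m)) : key S < 2 ^ m := key_lt_of_forall fun x _ => x.2

theorem key_insert {S : Finset (Fin m)} {x : Fin m} (h : x ∉ S) :
    key (insert x S) = key S + 2 ^ (x : ℕ) := by
  rw [key, Finset.sum_insert h, add_comm, key]

theorem key_erase {S : Finset (Fin m)} {x : Fin m} (h : x ∈ S) :
    key (S.erase x) = key S - 2 ^ (x : ℕ) := by
  conv_rhs => rw [← Finset.insert_erase h, key_insert (Finset.notMem_erase x S)]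
  omega

theorem lowKey_top (S : Finset (Fin m)) : lowKey S m = key S := by simp [lowKey]

theorem lowKey_lt (S : Finset (Fin m)) (k : ℕ) : lowKey S k < 2 ^ k :=
  key_lt_of_forall fun _ hx => (Finset.mem_filter.1 hx).2

theorem lowKey_succ_of_mem {S : Finset (Fin m)} {x : Fin m} (h : x ∈ S) :
    lowKey S (x + 1) = lowKey S x + 2 ^ (x : ℕ) := by
  rw [lowKey, lowKey, ← key_insert (by simp)]
  congr 1
  ext y
  simp only [Finset.mem_filter, Finset.mem_insert, Fin.ext_iff]
  constructor
  · rintro ⟨h1, h2⟩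
    exact (Nat.lt_succ_iff_lt_or_eq.1 h2).elim (fun h => .inr ⟨h1, h⟩) .inl
  · rintro (h1 | ⟨h1, h2⟩)
    · exact ⟨Fin.ext h1 ▸ h, by omega⟩
    · exact ⟨h1, by omega⟩

theorem lowKey_succ_of_notMem {S : Finset (Fin m)} {x : Fin m} (h : x ∉ S) :
    lowKey S (x + 1) = lowKey S x := by
  rw [lowKey, lowKey]
  congr 1
  refine Finset.filter_congr fun y hy => ?_
  have : (y : ℕ) ≠ x := fun he => h (Fin.ext he ▸ hy)
  omega

/-- Membership tests without bit operations: with candidates scanned downwards and the powers found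
so far subtracted, the next bit is set exactly if its power still fits into the remainder. -/
theorem two_pow_le_lowKey_iff {S : Finset (Fin m)} {x : Fin m} :
    2 ^ (x : ℕ) ≤ lowKey S (x + 1) ↔ x ∈ S := by
  constructor
  · intro h
    by_contra hx
    rw [lowKey_succ_of_notMem hx] at h
    exact absurd (lowKey_lt S x) (not_lt.2 h)
  · intro h
    rw [lowKey_succ_of_mem h]
    omega

/-- The part of the cost of placing `x` after `S` that belongs to the candidates from `k` on. -/
def highCost {n : ℕ} (V : Profile m n) (S : Finset (Fin m)) (x : Fin m) (k : ℕ) : ℕ :=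
  ∑ y ∈ Sᶜ.filter (fun y : Fin m => k ≤ (y : ℕ)), wt V y x

theorem highCost_top {n : ℕ} (V : Profile m n) (S : Finset (Fin m)) (x : Fin m) :
    highCost V S x m = 0 := by
  refine Finset.sum_eq_zero fun y hy => ?_
  have := (Finset.mem_filter.1 hy).2
  omega

theorem highCost_zero {n : ℕ} (V : Profile m n) (S : Finset (Fin m)) (x : Fin m) :
    highCost V S x 0 = stepCost V S x := by simp [highCost, stepCost]

theorem highCost_of_mem {n : ℕ} (V : Profile m n) {S : Finset (Fin m)} (x : Fin m) {y : Fin m}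
    (h : y ∈ S) : highCost V S x y = highCost V S x (y + 1) := by
  rw [highCost, highCost]
  refine Finset.sum_congr (Finset.filter_congr fun z hz => ?_) fun _ _ => rfl
  have : (y : ℕ) ≠ z := fun he => (Finset.mem_compl.1 hz) (Fin.ext he ▸ h)
  omega

theorem highCost_of_notMem {n : ℕ} (V : Profile m n) {S : Finset (Fin m)} (x : Fin m) {y : Fin m}
    (h : y ∉ S) : highCost V S x y = highCost V S x (y + 1) + wt V y x := by
  rw [highCost, highCost, add_comm, ← Finset.sum_insert (f := fun z => wt V z x) (a := y)
    (s := Sᶜ.filter fun z : Fin m => (y : ℕ) + 1 ≤ z) (by simp)]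
  refine Finset.sum_congr ?_ fun _ _ => rfl
  ext z
  simp only [Finset.mem_filter, Finset.mem_insert, Finset.mem_compl, Fin.ext_iff]
  constructor
  · rintro ⟨h1, h2⟩
    exact (Nat.eq_or_lt_of_le h2).elim (fun h => .inl h.symm) fun h => .inr ⟨h1, h⟩
  · rintro (h1 | ⟨h1, h2⟩)
    · exact ⟨(Fin.ext h1 : z = y) ▸ h, by omega⟩
    · exact ⟨h1, by omega⟩

theorem highCost_le {n : ℕ} (V : Profile m n) (S : Finset (Fin m)) (x : Fin m) (k : ℕ) :
    highCost V S x k ≤ m * n :=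
  (Finset.sum_le_sum_of_subset (Finset.filter_subset _ _)).trans (stepCost_le V S x)

end

section

variable {m n : ℕ} {V : Profile m n}

/-- The test for an admissible extension reads only the table of pair counts, so it can share the
loop that adds up the cost. The condition `1 ≤ n` takes care of `y = x`, whose count is 0. -/
theorem isIdeal_insert_iff {S : Finset (Fin m)} (hS : IsIdeal V S) (hn : 1 ≤ n) {x : Fin m} :
    IsIdeal V (insert x S) ↔ ∀ y ∉ S, wt V y x ≠ n := by
  simp only [ne_eq, wt_eq_iff]
  constructor
  · intro h y hy hu
    have := h x (Finset.mem_insert_self _ _) y hu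
    rcases Finset.mem_insert.1 this with rfl | h'
    exacts [not_unanimous_self hn V _ hu, hy h']
  · intro h z hz y hu
    rw [Finset.mem_insert] at hz ⊢
    rcases hz with rfl | hz
    · right
      by_contra hy
      exact h y hy hu
    · exact .inr (hS z hz y hu)

/-- The member placed last by any one vote is maximal in the unanimity order. -/
theorem IsIdeal.exists_erase {S : Finset (Fin m)} (hS : IsIdeal V S) (hn : 1 ≤ n)
    (hne : S.Nonempty) : ∃ x ∈ S, IsIdeal V (S.erase x) := by
  obtain ⟨x, hx, hmax⟩ := Finset.exists_max_image S (V ⟨0, hn⟩).symm hne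
  refine ⟨x, hx, fun z hz y hu => Finset.mem_erase.2
    ⟨?_, hS z (Finset.mem_of_mem_erase hz) y hu⟩⟩
  rintro rfl
  exact absurd (hmax z (Finset.mem_of_mem_erase hz)) (not_le.2 (hu ⟨0, hn⟩))

/-- State of the dynamic program: the ideals with at most `k` elements are finished, `L` lists the
ideals with `k + 1` elements met so far, and the extensions in `Pr` have been considered. -/
structure LevelInv (V : Profile m n) (k : ℕ) (f : Finset (Fin m) → ℕ) (L : List (Finset (Fin m)))
    (Pr : Set (Finset (Fin m) × Fin m)) : Prop where
  ne_zero : ∀ S, f S ≠ 0 ↔ (IsIdeal V S ∧ S.card ≤ k) ∨ S ∈ L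
  isIdeal : ∀ S ∈ L, IsIdeal V S
  card : ∀ S ∈ L, S.card = k + 1
  nodup : L.Nodup
  bound : ∀ S, f S ≤ 1 + S.card * (m * n)
  le : ∀ S x, IsIdeal V S → S.card < k → x ∉ S → IsIdeal V (insert x S) →
    f (insert x S) ≤ f S + stepCost V S x
  considered : ∀ S x, (S, x) ∈ Pr →
    S.card = k ∧ insert x S ∈ L ∧ f (insert x S) ≤ f S + stepCost V S x
  exists_eq : ∀ S, f S ≠ 0 → S.Nonempty →
    ∃ x ∈ S, IsIdeal V (S.erase x) ∧ f S = f (S.erase x) + stepCost V (S.erase x) x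

namespace LevelInv

variable {k : ℕ} {f : Finset (Fin m) → ℕ} {L : List (Finset (Fin m))}
  {Pr : Set (Finset (Fin m) × Fin m)} {S : Finset (Fin m)} {x : Fin m}

theorem init {f : Finset (Fin m) → ℕ} (h : ∀ S, f S = if S = ∅ then 1 else 0) :
    LevelInv V 0 f [] ∅ where
  ne_zero S := by
    by_cases hS : S = ∅ <;> simp [h, hS, IsIdeal]
  isIdeal := by simp
  card := by simp
  nodup := List.nodup_nil
  bound S := by
    rw [h]
    split_ifs <;> omega
  le := by simp
  considered := by simp
  exists_eq S h0 hne := by simp [h, hne.ne_empty] at h0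

/-- A nonzero entry at a set of size k + 1 can only come from the list of sets already met, so
nothing has to be written. -/
theorem consider_of_le (H : LevelInv V k f L Pr) (hk : S.card = k) (hx : x ∉ S)
    (h0 : f (insert x S) ≠ 0) (hle : f (insert x S) ≤ f S + stepCost V S x) :
    LevelInv V k f L (insert (S, x) Pr) :=
  { H with
    considered := by
      rintro S' x' (h | h)
      · obtain ⟨rfl, rfl⟩ := Prod.mk.inj h
        refine ⟨hk, ((H.ne_zero _).1 h0).resolve_left fun h => ?_, hle⟩
        have := h.2
        rw [Finset.card_insert_of_notMem hx] at this
        omega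
      · exact H.considered S' x' h }

/-- The write affects size k + 1 only, so all values on finished levels survive. For pairs
considered earlier that lead to the same set, the value appears or decreases, which keeps their
inequalities. -/
theorem consider_update (H : LevelInv V k f L Pr) (hS : IsIdeal V S) (hk : S.card = k)
    (hx : x ∉ S) (hJ : IsIdeal V (insert x S)) {L' : List (Finset (Fin m))}
    (hL : (f (insert x S) = 0 ∧ L' = L ++ [insert x S]) ∨
      (f S + stepCost V S x ≤ f (insert x S) ∧ f (insert x S) ≠ 0 ∧ L' = L)) :
    LevelInv V k (Function.update f (insert x S) (f S + stepCost V S x)) L'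
      (insert (S, x) Pr) := by
  have hcard : (insert x S).card = k + 1 := by rw [Finset.card_insert_of_notMem hx, hk]
  have hsmall : ∀ T : Finset (Fin m), T.card ≤ k →
      Function.update f (insert x S) (f S + stepCost V S x) T = f T := fun T hT =>
    Function.update_of_ne (by rintro rfl; omega) _ _
  have hfS : f S ≠ 0 := (H.ne_zero S).2 (.inl ⟨hS, hk.le⟩)
  have hmem : ∀ T, T ∈ L' ↔ T = insert x S ∨ T ∈ L := by
    intro T
    rcases hL with ⟨-, rfl⟩ | ⟨-, h0, rfl⟩
    · simp [or_comm]
    · have : insert x S ∈ L' := ((H.ne_zero _).1 h0).resolve_left fun h => by omega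
      exact ⟨.inr, by rintro (rfl | h) <;> assumption⟩
  refine ⟨fun T => ?_, fun T hT => ?_, fun T hT => ?_, ?_, fun T => ?_,
    fun T y hT hc hy hi => ?_, ?_, fun T h0 hne => ?_⟩
  · rw [hmem]
    by_cases hT : T = insert x S
    · subst hT
      simp [hfS]
    · rw [Function.update_of_ne hT, H.ne_zero]
      simp [hT]
  · rcases (hmem T).1 hT with rfl | h
    exacts [hJ, H.isIdeal T h]
  · rcases (hmem T).1 hT with rfl | h
    exacts [hcard, H.card T h]
  · rcases hL with ⟨h0, rfl⟩ | ⟨-, -, rfl⟩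
    · refine List.Nodup.append H.nodup (List.nodup_singleton _) ?_
      rw [List.disjoint_singleton]
      exact fun h => (H.ne_zero _).2 (.inr h) h0
    · exact H.nodup
  · by_cases hT : T = insert x S
    · subst hT
      have h1 := H.bound S
      have h2 := stepCost_le V S x
      rw [Function.update_self, hcard]
      rw [hk] at h1
      rw [add_mul]
      omega
    · rw [Function.update_of_ne hT]
      exact H.bound T
  · rw [hsmall _ (by rw [Finset.card_insert_of_notMem hy]; omega), hsmall T hc.le]
    exact H.le T y hT hc hy hi
  · rintro T y (h | h)
    · obtain ⟨rfl, rfl⟩ := Prod.mk.inj h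
      exact ⟨hk, (hmem _).2 (.inl rfl), by rw [hsmall _ hk.le, Function.update_self]⟩
    · obtain ⟨h1, h2, h3⟩ := H.considered T y h
      refine ⟨h1, (hmem _).2 (.inr h2), ?_⟩
      rw [hsmall T h1.le]
      by_cases hT : insert y T = insert x S
      · rw [hT] at h2 h3 ⊢
        rw [Function.update_self]
        have h4 : f (insert x S) ≠ 0 := (H.ne_zero _).2 (.inr h2)
        rcases hL with ⟨h0, -⟩ | ⟨h5, -⟩
        · exact absurd h0 h4
        · omega
      · rwa [Function.update_of_ne hT]
  · by_cases hT : T = insert x S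
    · subst hT
      refine ⟨x, Finset.mem_insert_self _ _, ?_⟩
      rw [Finset.erase_insert hx, hsmall _ hk.le, Function.update_self]
      exact ⟨hS, rfl⟩
    · rw [Function.update_of_ne hT] at h0 ⊢
      obtain ⟨y, hy, hi, he⟩ := H.exists_eq T h0 hne
      have hc : T.card ≤ k + 1 := by
        rcases (H.ne_zero T).1 h0 with h | h
        · omega
        · exact (H.card T h).le
      refine ⟨y, hy, hi, ?_⟩
      rw [hsmall _ (by rw [Finset.card_erase_of_mem hy]; omega)]
      exact he

/-- Removing a maximal element from an ideal of size k + 1 leaves an ideal of size k, and the pair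
leading back has been considered. So no ideal is missed. -/
theorem mem_iff (H : LevelInv V k f L Pr) (hn : 1 ≤ n)
    (hPr : ∀ S x, IsIdeal V S → S.card = k → x ∉ S → IsIdeal V (insert x S) → (S, x) ∈ Pr) :
    S ∈ L ↔ IsIdeal V S ∧ S.card = k + 1 := by
  refine ⟨fun h => ⟨H.isIdeal S h, H.card S h⟩, fun ⟨hS, hc⟩ => ?_⟩
  obtain ⟨x, hx, hi⟩ := hS.exists_erase hn (Finset.card_pos.1 (by omega))
  have := (H.considered _ _ (hPr _ x hi (by rw [Finset.card_erase_of_mem hx]; omega)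
    (Finset.notMem_erase _ _) (by rwa [Finset.insert_erase hx]))).2.1
  rwa [Finset.insert_erase hx] at this

/-- With all extensions considered, their inequalities become the Bellman inequalities of the
finished level. -/
theorem next (H : LevelInv V k f L Pr) (hn : 1 ≤ n)
    (hPr : ∀ S x, IsIdeal V S → S.card = k → x ∉ S → IsIdeal V (insert x S) → (S, x) ∈ Pr) :
    LevelInv V (k + 1) f [] ∅ where
  ne_zero S := by
    rw [H.ne_zero, H.mem_iff hn hPr, ← and_or_left]
    simp [Nat.le_succ_iff]
  isIdeal := by simp
  card := by simp
  nodup := List.nodup_nil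
  bound := H.bound
  le S x hS hc hx hi := by
    rcases Nat.lt_succ_iff_lt_or_eq.1 hc with hc | hc
    · exact H.le S x hS hc hx hi
    · exact (H.considered S x (hPr S x hS hc hx hi)).2.2
  considered := by simp
  exists_eq := H.exists_eq

theorem isBellman (H : LevelInv V m f [] ∅) : IsBellman V f where
  ne_zero S := by
    rw [H.ne_zero]
    simpa using fun _ => (Finset.card_le_univ S).trans_eq (Fintype.card_fin m)
  le S x hS hx hi := by
    refine H.le S x hS ?_ hx hi
    have := Finset.card_le_univ (insert x S)
    rw [Finset.card_insert_of_notMem hx, Fintype.card_fin] at this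
    exact this
  exists_eq S hS hne := by
    refine H.exists_eq S ?_ hne
    rw [H.ne_zero]
    exact .inl ⟨hS, (Finset.card_le_univ S).trans_eq (Fintype.card_fin m)⟩

end LevelInv

end

end Kemeny

/-! ### The algorithm -/

namespace Kemeny

open Ram

/-- Cost of placing candidate `R 11` after the set `R sr`, in `R 5`; moreover `R 6` is `0` if this
respects the unanimity order. -/
def costCmd (sr : ℕ) : Cmd :=
  .seq (.mov 0 sr) <| .seq (.const 5 0) <| .seq (.const 6 0) <| .rep 1 40 <|
    .seq (.ld 0 2 1) <| .ifle 2 0 (.sub 0 0 2) <|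
      .seq (.ld 1 3 1) <| .seq (.add 3 3 11) <| .seq (.ld 3 4 3) <| .seq (.add 5 5 4) <|
        .ifle 41 4 (.const 6 1) .skip

/-- The parameters and tables that all phases of the algorithm use. -/
structure Tables {m n : ℕ} (V : Profile m n) (r : ℕ) (h : Store) : Prop where
  reg_m : h.reg 40 = m
  reg_n : h.reg 41 = n
  reg_r : h.reg 42 = r
  pow : ∀ i < m, h.arr 0 i = 2 ^ i
  row : ∀ i < m, h.arr 1 i = i * m
  wt : ∀ a b : Fin m, h.arr 3 (a * m + b) = wt V a b

/-- The states agree except for the registers below `c`. -/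
structure Frame (c : ℕ) (h h' : Store) : Prop where
  reg : ∀ i, c ≤ i → h'.reg i = h.reg i
  arr : h'.arr = h.arr
  inp : h'.inp = h.inp
  out : h'.out = h.out

theorem Frame.refl (c : ℕ) (h : Store) : Frame c h h := ⟨fun _ _ => rfl, rfl, rfl, rfl⟩

theorem Frame.set {c : ℕ} {h h' : Store} (F : Frame c h h') {i : ℕ} (hi : i < c) (x : ℕ) :
    Frame c h (h'.set i x) :=
  ⟨fun j hj => by rw [Store.set_reg_of_ne _ _ _ _ (by omega), F.reg j hj], F.arr, F.inp, F.out⟩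

theorem Frame.tables {m n r c : ℕ} {V : Profile m n} {h h' : Store} (F : Frame c h h')
    (hc : c ≤ 40) (H : Tables V r h) : Tables V r h' where
  reg_m := by rw [F.reg _ hc, H.reg_m]
  reg_n := by rw [F.reg _ (by omega), H.reg_n]
  reg_r := by rw [F.reg _ (by omega), H.reg_r]
  pow := by rw [F.arr]; exact H.pow
  row := by rw [F.arr]; exact H.row
  wt := by rw [F.arr]; exact H.wt

/-- One downward scan of the candidates peels the bits of the key off and adds up the counts of the
candidates outside `S`. The flag is raised when a count reaches n, since counts never exceed n. -/
theorem wp_costCmd {m n r B : ℕ} {V : Profile m n} (hB1 : 1 < 2 ^ B)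
    (hB2 : m * m < 2 ^ B) (hB3 : m * n < 2 ^ B) {sr : ℕ} {h : Store}
    (H : Tables V r h) {S : Finset (Fin m)} (hS : h.reg sr = key S) {x : Fin m}
    (hx : h.reg 11 = x) :
    wp B (costCmd sr) h fun h' k => Frame 10 h h' ∧ h'.reg 5 = stepCost V S x ∧
      (h'.reg 6 = 0 ↔ ∀ y ∉ S, wt V y x ≠ n) ∧ k ≤ 10 * m + 10 := by
  simp only [costCmd, wp_seq, wp_mov, wp_const]
  refine ⟨by omega, by omega, wp_rep (T := 8) (fun k h' => Frame 10 h h' ∧ h'.reg 0 = lowKey S k ∧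
    h'.reg 5 = highCost V S x k ∧ (h'.reg 6 = 0 ↔ ∀ y ∉ S, k ≤ (y : ℕ) → wt V y x ≠ n)) ?_ ?_ ?_⟩
  · simp (disch := omega) only [Store.set_reg_of_ne, Store.set_reg_self, H.reg_m, hS, lowKey_top,
      highCost_top]
    refine ⟨((((Frame.refl _ _).set ?_ _).set ?_ _).set ?_ _).set ?_ _, trivial, trivial, ?_⟩
    any_goals omega
    simp only [true_iff]
    intro y _ hy
    omega
  · rintro k h' hk ⟨F, h0, h5, h6⟩
    simp (disch := omega) only [Store.set_reg_of_ne, H.reg_m] at hk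
    have hx' : h'.reg 11 = x := by rw [F.reg _ (by omega), hx]
    have hn' : h'.reg 41 = n := by rw [F.reg _ (by omega), H.reg_n]
    let y : Fin m := ⟨k, hk⟩
    have hy : k = y := rfl
    have hw : h.arr 3 (k * m + x) = wt V y x := by rw [← H.wt y x]
    have hrow : k * m + x < m * m :=
      calc k * m + x < k * m + m := by omega
        _ = (k + 1) * m := by ring
        _ ≤ m * m := Nat.mul_le_mul_right _ hk
    simp (disch := omega) only [wp_seq, wp_ld, wp_ifle, wp_sub, wp_add, wp_const, wp_skip,
      Store.set_reg_of_ne, Store.set_reg_self, Store.set_arr, hx', hn',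
      h0, h5, hw, F.arr, H.pow k hk, H.row k hk]
    have hF := F.set (i := 1) (by omega) k
    have hle := two_pow_le_lowKey_iff (S := S) (x := y)
    refine ⟨by omega, fun hS1 => ?_, fun hS1 => ?_⟩
    · have hyS := hle.1 hS1
      refine ⟨trivial, ⟨(hF.set (by omega) _).set (by omega) _, ?_, (highCost_of_mem V x hyS).symm,
        h6.trans ⟨fun H z hz hkz => H z hz ?_, fun H z hz hkz => H z hz (by omega)⟩⟩, by omega⟩
      · rw [hy, lowKey_succ_of_mem hyS]
        omega
      · have : k ≠ z := fun he => hz (Fin.ext (hy ▸ he) ▸ hyS)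
        omega
    · have hyS : y ∉ S := fun h => absurd (hle.2 h) (not_le.2 hS1)
      have hlow := lowKey_succ_of_notMem hyS
      have hhigh := highCost_of_notMem V x hyS
      have hbound := highCost_le V S x y
      have hF' := ((((hF.set (i := 2) (by omega) (2 ^ k)).set (i := 3) (by omega) (k * m)).set (i := 3)
        (by omega) (k * m + x)).set (i := 4) (by omega) (wt V y x)).set (i := 5) (by omega)
        (highCost V S x (k + 1) + wt V y x)
      refine ⟨by omega, by omega, by omega, by rw [hy]; omega, fun hw1 => ⟨hB1, trivial,
        ⟨hF'.set (by omega) _, hlow, hhigh.symm, ?_⟩, by omega⟩, fun hw1 => ⟨trivial,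
        ⟨hF', hlow, hhigh.symm, h6.trans ⟨fun H z hz hkz => ?_,
          fun H z hz hkz => H z hz (by omega)⟩⟩, by omega⟩⟩
      · simp only [one_ne_zero, false_iff]
        exact fun H => H y hyS hy.le (le_antisymm (wt_le V y x) hw1)
      · by_cases hzy : z = y
        · rw [hzy]
          exact hw1.ne
        · have : k ≠ z := fun he => hzy (Fin.ext (he.symm.trans hy))
          exact H z hz (by omega)
  · rintro h' k ⟨F, -, h5, h6⟩ hk
    rw [highCost_zero] at h5
    simp (disch := omega) only [Store.set_reg_of_ne, H.reg_m] at hk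
    exact ⟨F, h5, by simpa using h6, by omega⟩

end Kemeny

/-! ### The forward pass -/

namespace Kemeny

open Ram

/-- Considers the extension of the ideal `R 12` by the candidate `R 11`: updates its value in the
dynamic program and appends it to the queue if it is new. -/
def extendCmd : Cmd :=
  .seq (.ld 0 15 11) <| .ifle 15 13 (.sub 13 13 15) <| .seq (costCmd 12) <| .ite 6 .skip <|
    .seq (.add 16 12 15) <| .seq (.add 17 14 5) <| .seq (.ld 4 18 16) <|
      .ite 18 (.ifle 18 17 .skip (.st 4 16 17)) <|
        .seq (.st 4 16 17) <| .seq (.st 5 31 16) (.inc 31)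

/-- Considers all extensions of the ideal at the head of the queue. -/
def expandCmd : Cmd :=
  .seq (.ld 5 12 30) <| .seq (.ld 4 14 12) <| .seq (.mov 13 12) <|
    .seq (.rep 11 40 extendCmd) (.inc 30)

/-- One level of the dynamic program. -/
def levelCmd : Cmd := .seq (.sub 21 31 30) (.rep 20 21 expandCmd)

/-- The numbers that occur are below `2 ^ B`. -/
structure Fits (m n r I B : ℕ) : Prop where
  one : 1 < 2 ^ B
  sq : m * m < 2 ^ B
  cost : 1 + m * (m * n) + m * n < 2 ^ B
  pow : 2 ^ m < 2 ^ B
  queue : (m + 2) * (I + r + 1) < 2 ^ B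

/-- The table of the dynamic program, as a function on sets of candidates. -/
def table {m : ℕ} (h : Store) (S : Finset (Fin m)) : ℕ := h.arr 4 (key S)

theorem table_setArr {m : ℕ} (h : Store) (S : Finset (Fin m)) (v : ℕ) :
    table (h.setArr 4 (key S) v) = Function.update (table h) S v := by
  funext T
  rw [table, Store.setArr_arr_same]
  by_cases hT : T = S
  · simp [hT]
  · rw [Function.update_of_ne hT, Function.update_of_ne (key_injective.ne hT), table]

theorem table_setArr_queue {m : ℕ} (h : Store) (i v : ℕ) :
    table (m := m) (h.setArr 5 i v) = table h := by
  funext T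
  rw [table, Store.setArr_arr_of_ne _ _ _ _ _ (by omega), table]

/-- The part of the queue that starts at `lo` contains the sets in `L`. -/
def Window {m : ℕ} (h : Store) (lo : ℕ) (L : List (Finset (Fin m))) : Prop :=
  ∀ i (hi : i < L.length), h.arr 5 (lo + i) = key L[i]

/-- The states agree except for the registers below `c`, the ends of the current part of the
queue, the table of the dynamic program, and the queue from `lo` on. -/
structure QueueFrame (c lo : ℕ) (h h' : Store) : Prop where
  reg : ∀ i, c ≤ i → i ≠ 30 → i ≠ 31 → h'.reg i = h.reg i
  arr : ∀ a, a ≠ 4 → a ≠ 5 → h'.arr a = h.arr a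
  queue : ∀ i < lo, h'.arr 5 i = h.arr 5 i
  inp : h'.inp = h.inp
  out : h'.out = h.out

namespace QueueFrame

variable {c lo : ℕ} {h h' : Store}

theorem refl (c lo : ℕ) (h : Store) : QueueFrame c lo h h :=
  ⟨fun _ _ _ _ => rfl, fun _ _ _ => rfl, fun _ _ => rfl, rfl, rfl⟩

theorem trans {h'' : Store} (F : QueueFrame c lo h h') (F' : QueueFrame c lo h' h'') :
    QueueFrame c lo h h'' where
  reg i h1 h2 h3 := (F'.reg i h1 h2 h3).trans (F.reg i h1 h2 h3)
  arr a h1 h2 := (F'.arr a h1 h2).trans (F.arr a h1 h2)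
  queue i hi := (F'.queue i hi).trans (F.queue i hi)
  inp := F'.inp.trans F.inp
  out := F'.out.trans F.out

theorem set (F : QueueFrame c lo h h') {i : ℕ} (hi : i < c ∨ i = 30 ∨ i = 31) (x : ℕ) :
    QueueFrame c lo h (h'.set i x) :=
  ⟨fun j h1 h2 h3 => by rw [Store.set_reg_of_ne _ _ _ _ (by omega), F.reg j h1 h2 h3],
    F.arr, F.queue, F.inp, F.out⟩

theorem setArr_table (F : QueueFrame c lo h h') (i x : ℕ) : QueueFrame c lo h (h'.setArr 4 i x) :=
  ⟨F.reg, fun a h1 h2 => by rw [Store.setArr_arr_of_ne _ _ _ _ _ h1, F.arr a h1 h2],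
    fun i hi => by rw [Store.setArr_arr_of_ne _ _ _ _ _ (by omega), F.queue i hi], F.inp, F.out⟩

theorem setArr_queue (F : QueueFrame c lo h h') {i : ℕ} (hi : lo ≤ i) (x : ℕ) :
    QueueFrame c lo h (h'.setArr 5 i x) :=
  ⟨F.reg, fun a h1 h2 => by rw [Store.setArr_arr_of_ne _ _ _ _ _ h2, F.arr a h1 h2],
    fun j hj => by rw [Store.setArr_arr_same, Function.update_of_ne (by omega), F.queue j hj],
    F.inp, F.out⟩

theorem mono {c' lo' : ℕ} (hc : c ≤ c') (hlo : lo' ≤ lo) (F : QueueFrame c lo h h') :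
    QueueFrame c' lo' h h' :=
  ⟨fun i hi => F.reg i (hc.trans hi), F.arr, fun i hi => F.queue i (by omega), F.inp, F.out⟩

theorem frame {c' : ℕ} (hc : c' ≤ c) {h'' : Store} (F : QueueFrame c lo h h') (F' : Frame c' h' h'') :
    QueueFrame c lo h h'' :=
  ⟨fun i h1 h2 h3 => by rw [F'.reg i (by omega), F.reg i h1 h2 h3],
    fun a h1 h2 => by rw [F'.arr, F.arr a h1 h2], fun i hi => by rw [F'.arr, F.queue i hi],
    by rw [F'.inp, F.inp], by rw [F'.out, F.out]⟩

theorem tables {m n r : ℕ} {V : Profile m n} (hc : c ≤ 40) (F : QueueFrame c lo h h')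
    (H : Tables V r h) :
    Tables V r h' where
  reg_m := by rw [F.reg _ (by omega) (by omega) (by omega), H.reg_m]
  reg_n := by rw [F.reg _ (by omega) (by omega) (by omega), H.reg_n]
  reg_r := by rw [F.reg _ (by omega) (by omega) (by omega), H.reg_r]
  pow := by rw [F.arr _ (by omega) (by omega)]; exact H.pow
  row := by rw [F.arr _ (by omega) (by omega)]; exact H.row
  wt := by rw [F.arr _ (by omega) (by omega)]; exact H.wt

end QueueFrame

theorem Window.append {m : ℕ} {h h' : Store} {lo : ℕ} {L : List (Finset (Fin m))}
    {S : Finset (Fin m)} (H : Window h lo L)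
    (h5 : h'.arr 5 = Function.update (h.arr 5) (lo + L.length) (key S)) :
    Window h' lo (L ++ [S]) := by
  intro i hi
  rw [List.length_append, List.length_singleton] at hi
  rw [h5]
  rcases Nat.lt_succ_iff_lt_or_eq.1 hi with hi' | rfl
  · rw [Function.update_of_ne (by omega), H i hi', List.getElem_append_left hi']
  · simp

/-- The link from the number of ideals to the running time: no level of the queue is longer than
this. -/
theorem LevelInv.length_le {m n k : ℕ} {V : Profile m n} {f : Finset (Fin m) → ℕ}
    {L : List (Finset (Fin m))} {Pr : Set (Finset (Fin m) × Fin m)} (H : LevelInv V k f L Pr) :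
    L.length ≤ (ideals V).card := by
  rw [← List.toFinset_card_of_nodup H.nodup]
  exact Finset.card_le_card fun S hS => mem_ideals.2 (H.isIdeal S (List.mem_toFinset.1 hS))

/-- Between two extensions, the queue and the table represent a state of the dynamic program. -/
structure QueueInv {m n : ℕ} (V : Profile m n) (k lo : ℕ) (h : Store)
    (L : List (Finset (Fin m))) (Pr : Set (Finset (Fin m) × Fin m)) : Prop where
  level : LevelInv V k (table h) L Pr
  window : Window h lo L
  tail : h.reg 31 = lo + L.length

theorem QueueInv.set {m n k lo : ℕ} {V : Profile m n} {h : Store} {L : List (Finset (Fin m))}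
    {Pr : Set (Finset (Fin m) × Fin m)} (I : QueueInv V k lo h L Pr) {i : ℕ} (hi : i ≠ 31) (x : ℕ) :
    QueueInv V k lo (h.set i x) L Pr :=
  ⟨I.level, I.window, by rw [Store.set_reg_of_ne _ _ _ _ hi.symm, I.tail]⟩

/-- There are five outcomes: `x` already lies in `S`, the extension is not an ideal, the stored
value is at least as good, the stored value is worse, or the entry is 0 and the set is new. Only the
last one lengthens the queue. -/
theorem wp_extendCmd {m n r B : ℕ} {V : Profile m n} (hn : 1 ≤ n)
    (hB : Fits m n r (ideals V).card B) {h : Store} (H : Tables V r h) {k lo : ℕ}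
    {L : List (Finset (Fin m))} {Pr : Set (Finset (Fin m) × Fin m)} (I : QueueInv V k lo h L Pr)
    (hlo : lo + (ideals V).card + 1 < 2 ^ B)
    {S : Finset (Fin m)} (hS : IsIdeal V S) (hk : S.card = k) {x : Fin m} (h11 : h.reg 11 = x)
    (h12 : h.reg 12 = key S) (h13 : h.reg 13 = lowKey S (x + 1)) (h14 : h.reg 14 = table h S) :
    wp B extendCmd h fun h' t => h'.reg 11 = x ∧ h'.reg 12 = key S ∧ h'.reg 13 = lowKey S x ∧
      h'.reg 14 = table h' S ∧ h'.reg 30 = h.reg 30 ∧ QueueFrame 20 lo h h' ∧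
      (∃ L' Pr', QueueInv V k lo h' L' Pr' ∧ Pr ⊆ Pr' ∧
        (x ∉ S → IsIdeal V (insert x S) → (S, x) ∈ Pr')) ∧ t ≤ 10 * m + 20 := by
  have hle := two_pow_le_lowKey_iff (S := S) (x := x)
  have hB1 := hB.one
  have hB2 := hB.sq
  have hB3 := hB.cost
  have hB4 := hB.pow
  simp (disch := omega) only [extendCmd, wp_seq, wp_ld, wp_ifle, wp_sub,
    Store.set_reg_of_ne, Store.set_reg_self, h11, h12, h13, h14, H.pow x x.2]
  refine ⟨by omega, fun hS1 => ?_, fun hS1 => ?_⟩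
  · have hxS := hle.1 hS1
    refine ⟨trivial, trivial, ?_, rfl, trivial,
      ((QueueFrame.refl 20 lo h).set (by omega) _).set (by omega) _,
      ⟨L, Pr, ⟨I.level, I.window, ?_⟩, subset_rfl, fun h => absurd hxS h⟩, by omega⟩
    · rw [lowKey_succ_of_mem hxS]
      omega
    · simp (disch := omega) only [Store.set_reg_of_ne, I.tail]
  have hxS : x ∉ S := fun h => absurd (hle.2 h) (not_le.2 hS1)
  have F0 := (Frame.refl 16 h).set (i := 15) (by omega) (2 ^ (x : ℕ))
  refine wp_mono _ _ _ _ ?_ (wp_costCmd (V := V) (r := r) (S := S) (x := x) hB1 hB2 (by omega)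
    (F0.tables (by omega) H) (by simp (disch := omega) only [Store.set_reg_of_ne, h12])
    (by simp (disch := omega) only [Store.set_reg_of_ne, h11]))
  rintro h1 t ⟨F1, h5, h6, ht⟩
  have e11 : h1.reg 11 = x := by
    rw [F1.reg _ (by omega)]; simp (disch := omega) only [Store.set_reg_of_ne, h11]
  have e12 : h1.reg 12 = key S := by
    rw [F1.reg _ (by omega)]; simp (disch := omega) only [Store.set_reg_of_ne, h12]
  have e13 : h1.reg 13 = lowKey S x := by
    rw [F1.reg _ (by omega)]
    simp (disch := omega) only [Store.set_reg_of_ne, h13, lowKey_succ_of_notMem hxS]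
  have e14 : h1.reg 14 = table h S := by
    rw [F1.reg _ (by omega)]; simp (disch := omega) only [Store.set_reg_of_ne, h14]
  have e15 : h1.reg 15 = 2 ^ (x : ℕ) := by
    rw [F1.reg _ (by omega)]; simp (disch := omega) only [Store.set_reg_self]
  have e30 : h1.reg 30 = h.reg 30 := by
    rw [F1.reg _ (by omega)]; simp (disch := omega) only [Store.set_reg_of_ne]
  have e31 : h1.reg 31 = lo + L.length := by
    rw [F1.reg _ (by omega)]; simp (disch := omega) only [Store.set_reg_of_ne, I.tail]
  have F2 : QueueFrame 20 lo h h1 := ((QueueFrame.refl 20 lo h).set (by omega) _).frame (by omega) F1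
  have earr : h1.arr = h.arr := F1.arr
  have etab : ∀ T : Finset (Fin m), table h1 T = table h T := fun T => by rw [table, earr, table]
  have etab' : table (m := m) h1 = table h := funext etab
  have hkey := key_insert hxS
  have hkeylt := key_lt (insert x S)
  have eins : h1.arr 4 (key S + 2 ^ (x : ℕ)) = table h (insert x S) := by
    rw [earr, table, hkey]
  have hcost := stepCost_le V S x
  have hbd := I.level.bound S
  -- Together with `bound`, this keeps the sum of value and step cost below 2^B.
  have hSm : S.card * (m * n) ≤ m * (m * n) :=
    Nat.mul_le_mul_right _ ((Finset.card_le_univ S).trans_eq (Fintype.card_fin m))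
  have hlen := I.level.length_le
  simp (disch := omega) only [wp_seq, wp_ld, wp_ifle, wp_ite, wp_st, wp_inc, wp_add, wp_skip,
    Store.set_reg_of_ne, Store.set_reg_self, Store.set_arr, Store.setArr_reg, e11, e12, e13, e14,
    e15, e30, e31, h5, eins]
  refine ⟨fun h60 => ⟨trivial, trivial, trivial, (etab S).symm, trivial, F2,
    ⟨L, Pr, ⟨etab' ▸ I.level, fun i hi => ?_, e31⟩, subset_rfl, fun _ hi => ?_⟩, by omega⟩,
    fun h60 => ⟨by omega, by omega, by omega, fun h0 => ⟨fun hle1 => ?_, fun hlt => ?_⟩,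
      fun h0 => ?_⟩⟩
  · rw [earr]
    exact I.window i hi
  · exact absurd (h6.2 ((isIdeal_insert_iff hS hn).1 hi)) h60
  · have hJ := (isIdeal_insert_iff hS hn).2 (h6.1 h60)
    refine ⟨trivial, trivial, trivial, (etab S).symm, trivial, ?_,
      ⟨L, insert (S, x) Pr, ⟨?_, fun i hi => ?_, ?_⟩, Set.subset_insert _ _,
        fun _ _ => Set.mem_insert _ _⟩, by omega⟩
    · exact ((F2.set (by omega) _).set (by omega) _).set (by omega) _
    · exact etab' ▸ I.level.consider_of_le hk hxS h0 hle1
    · simp only [Store.set_arr, earr]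
      exact I.window i hi
    · simp (disch := omega) only [Store.set_reg_of_ne, e31]
  · have hJ := (isIdeal_insert_iff hS hn).2 (h6.1 h60)
    refine ⟨by omega, trivial, trivial, trivial, ?_, trivial, ?_,
      ⟨L, insert (S, x) Pr, ⟨?_, fun i hi => ?_, ?_⟩, Set.subset_insert _ _,
        fun _ _ => Set.mem_insert _ _⟩, by omega⟩
    · rw [← hkey, table_setArr, Function.update_of_ne (fun h => hxS (by rw [h]; simp))]
      exact (etab S).symm
    · exact (((F2.set (by omega) _).set (by omega) _).set (by omega) _).setArr_table _ _
    · rw [← hkey, table_setArr]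
      exact etab' ▸ I.level.consider_update hS hk hxS hJ (.inr ⟨hlt.le, h0, rfl⟩)
    · rw [Store.setArr_arr_of_ne _ _ _ _ _ (by omega)]
      simp only [Store.set_arr, earr]
      exact I.window i hi
    · simp (disch := omega) only [Store.set_reg_of_ne, Store.setArr_reg, e31]
  · have hJ := (isIdeal_insert_iff hS hn).2 (h6.1 h60)
    have htab (a b c : ℕ) (h : Store) : table (m := m) (((h.setArr 4 (key (insert x S)) a).setArr 5
        b c).set 31 (b + 1)) = Function.update (table h) (insert x S) a := by
      rw [← table_setArr, ← table_setArr_queue _ b c]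
      rfl
    rw [← hkey, htab]
    refine ⟨by omega, by omega, by omega, trivial, trivial, trivial, ?_, trivial, ?_,
      ⟨L ++ [insert x S], insert (S, x) Pr, ⟨?_, Window.append (h := h) I.window ?_, ?_⟩,
        Set.subset_insert _ _, fun _ _ => Set.mem_insert _ _⟩, by omega⟩
    · rw [Function.update_of_ne (fun h => hxS (by rw [h]; simp))]
      exact (etab S).symm
    · exact (((((F2.set (by omega) _).set (by omega) _).set (by omega) _).setArr_table _
        _).setArr_queue (by omega) _).set (by omega) _
    · rw [htab]
      exact etab' ▸ I.level.consider_update hS hk hxS hJ (.inl ⟨h0, rfl⟩)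
    · rw [Store.set_arr, Store.setArr_arr_same, Store.setArr_arr_of_ne _ _ _ _ _ (by omega)]
      simp only [Store.set_arr, earr]
    · rw [Store.set_reg_self, List.length_append, List.length_singleton, add_assoc]

/-- The head lies below `lo`, where nothing is overwritten. The loop invariant says that the
candidates from `j` on have been tried. -/
theorem wp_expandCmd {m n r B : ℕ} {V : Profile m n} (hn : 1 ≤ n)
    (hB : Fits m n r (ideals V).card B) {h : Store} (H : Tables V r h) {k lo : ℕ}
    {L : List (Finset (Fin m))} {Pr : Set (Finset (Fin m) × Fin m)} (I : QueueInv V k lo h L Pr)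
    (hlo : lo + (ideals V).card + 1 < 2 ^ B)
    {S : Finset (Fin m)} (hS : IsIdeal V S) (hk : S.card = k) (hhead : h.reg 30 < lo)
    (h5 : h.arr 5 (h.reg 30) = key S) :
    wp B expandCmd h fun h' t => h'.reg 30 = h.reg 30 + 1 ∧ QueueFrame 20 lo h h' ∧
      (∃ L' Pr', QueueInv V k lo h' L' Pr' ∧ Pr ⊆ Pr' ∧
        ∀ x ∉ S, IsIdeal V (insert x S) → (S, x) ∈ Pr') ∧ t ≤ m * (10 * m + 21) + 6 := by
  simp (disch := omega) only [expandCmd, wp_seq, wp_ld, wp_mov, wp_inc, Store.set_reg_of_ne,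
    Store.set_reg_self, Store.set_arr, h5]
  refine ⟨by omega, by omega, wp_rep (T := 10 * m + 20) (fun j h' => h'.reg 12 = key S ∧
    h'.reg 13 = lowKey S j ∧ h'.reg 14 = table h' S ∧ h'.reg 30 = h.reg 30 ∧
    QueueFrame 20 lo h h' ∧ ∃ L' Pr', QueueInv V k lo h' L' Pr' ∧ Pr ⊆ Pr' ∧
      ∀ x ∉ S, j ≤ (x : ℕ) → IsIdeal V (insert x S) → (S, x) ∈ Pr') ?_ ?_ ?_⟩
  · simp (disch := omega) only [Store.set_reg_of_ne, Store.set_reg_self, H.reg_m, lowKey_top]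
    refine ⟨trivial, trivial, rfl, trivial, ?_, L, Pr, ?_, subset_rfl, fun x _ hx => by omega⟩
    · exact ((((QueueFrame.refl 20 lo h).set (by omega) _).set (by omega) _).set (by omega) _).set
        (by omega) _
    · exact (((I.set (by omega) _).set (by omega) _).set (by omega) _).set (by omega) _
  · rintro j h' hj ⟨h12, h13, h14, h30, F, L', Pr', I', hPr, hx⟩
    simp (disch := omega) only [Store.set_reg_of_ne, H.reg_m] at hj
    let x : Fin m := ⟨j, hj⟩
    have F' := F.set (i := 11) (by omega) j
    refine wp_mono _ _ _ _ ?_ (wp_extendCmd hn hB (F'.tables (by omega) H)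
      (I'.set (by omega) j) hlo hS hk (x := x) (Store.set_reg_self _ _ _)
      (by rw [Store.set_reg_of_ne _ _ _ _ (by omega), h12])
      (by rw [Store.set_reg_of_ne _ _ _ _ (by omega), h13])
      (by rw [Store.set_reg_of_ne _ _ _ _ (by omega), h14]; rfl))
    rintro h'' t ⟨g11, g12, g13, g14, g30, G, ⟨L'', Pr'', I'', hPr', hx'⟩, ht⟩
    rw [Store.set_reg_of_ne _ _ _ _ (by omega), h30] at g30
    refine ⟨g11, ⟨g12, g13, g14, g30, F'.trans G, L'', Pr'', I'', hPr.trans hPr',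
      fun y hy hjy hi => ?_⟩, ht⟩
    by_cases hyx : y = x
    · subst hyx
      exact hx' hy hi
    · have : j ≠ y := fun he => hyx (Fin.ext he.symm)
      exact hPr' (hx y hy (by omega) hi)
  · rintro h' t ⟨-, -, -, h30, F, L', Pr', I', hPr, hx⟩ ht
    simp (disch := omega) only [Store.set_reg_of_ne, H.reg_m] at ht
    rw [h30]
    refine ⟨by omega, rfl, F.set (by omega) _, ⟨L', Pr',
      I'.set (by omega) _, hPr, fun x hxS => hx x hxS (Nat.zero_le _)⟩, ?_⟩
    have : 10 * m + 20 + 1 = 10 * m + 21 := rfl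
    rw [this] at ht
    omega

/-- The levels up to `k` are finished, and the current part of the queue lists level `k`. -/
structure AtLevel {m n : ℕ} (V : Profile m n) (k : ℕ) (h : Store) (L : List (Finset (Fin m))) :
    Prop where
  level : LevelInv V k (table h) [] ∅
  mem : ∀ S, S ∈ L ↔ IsIdeal V S ∧ S.card = k
  nodup : L.Nodup
  window : Window h (h.reg 30) L
  tail : h.reg 31 = h.reg 30 + L.length
  tail_le : h.reg 31 ≤ (k + 1) * (ideals V).card

theorem AtLevel.length_le {m n k : ℕ} {V : Profile m n} {h : Store} {L : List (Finset (Fin m))}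
    (A : AtLevel V k h L) : L.length ≤ (ideals V).card := by
  rw [← List.toFinset_card_of_nodup A.nodup]
  exact Finset.card_le_card fun S hS => mem_ideals.2 ((A.mem S).1 (List.mem_toFinset.1 hS)).1

/-- New ideals are appended behind the old end of the queue, so the current level stays readable
while the next one is built. Each level has at most as many entries as there are ideals, and each
entry costs O(m²) steps. -/
theorem wp_levelCmd {m n r B : ℕ} {V : Profile m n} (hn : 1 ≤ n)
    (hB : Fits m n r (ideals V).card B) {h : Store} (H : Tables V r h) {k : ℕ} (hk : k < m)
    {L : List (Finset (Fin m))} (A : AtLevel V k h L) :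
    wp B levelCmd h fun h' t => (∃ L', AtLevel V (k + 1) h' L') ∧ QueueFrame 22 0 h h' ∧
      t ≤ (ideals V).card * (m * (10 * m + 21) + 7) + 3 := by
  have hA := A.tail
  have hA' := A.tail_le
  have hlen := A.length_le
  have hlo : h.reg 31 + (ideals V).card + 1 < 2 ^ B := by
    have h1 : (k + 1) * (ideals V).card ≤ m * (ideals V).card := Nat.mul_le_mul_right _ hk
    have h2 := hB.queue
    have h3 : (m + 2) * ((ideals V).card + r + 1) =
      m * (ideals V).card + 2 * (ideals V).card + m * (r + 1) + 2 * (r + 1) := by ring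
    omega
  have hcount : h.reg 31 - h.reg 30 = L.length := by omega
  simp (disch := omega) only [levelCmd, wp_seq, wp_sub, hcount]
  refine wp_rep (T := m * (10 * m + 21) + 6) (fun j h' => j ≤ L.length ∧
    h'.reg 30 = h.reg 30 + (L.length - j) ∧ QueueFrame 22 (h.reg 31) h h' ∧
    ∃ L' Pr', QueueInv V k (h.reg 31) h' L' Pr' ∧
      ∀ i (hi : i < L.length), i + j < L.length →
        ∀ x ∉ L[i], IsIdeal V (insert x L[i]) → (L[i], x) ∈ Pr') ?_ ?_ ?_
  · simp (disch := omega) only [Store.set_reg_of_ne, Store.set_reg_self]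
    refine ⟨le_rfl, by omega, ((QueueFrame.refl 22 _ h).set (by omega) _).set (by omega) _, [], ∅,
      ⟨A.level, fun i hi => by simp at hi, ?_⟩, fun i _ hi => by omega⟩
    simp (disch := omega) only [Store.set_reg_of_ne, List.length_nil, add_zero]
  · rintro j h' hj ⟨hj', h30, F, L', Pr', I, hx⟩
    have hi : L.length - (j + 1) < L.length := by omega
    have hS := (A.mem _).1 (List.getElem_mem hi)
    have F' := F.set (i := 20) (by omega) j
    have e30 : (h'.set 20 j).reg 30 = h.reg 30 + (L.length - (j + 1)) := by
      rw [Store.set_reg_of_ne _ _ _ _ (by omega), h30]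
    refine wp_mono _ _ _ _ ?_ (wp_expandCmd hn hB (F'.tables (by omega) H) (I.set (by omega) j) hlo
      hS.1 hS.2 (by omega) (by rw [e30, F'.queue _ (by omega), A.window]))
    rintro h'' t ⟨g30, G, ⟨L'', Pr'', I'', hPr, hx'⟩, ht⟩
    refine ⟨?_, ⟨by omega, by omega, F'.trans (G.mono (by omega) le_rfl), L'', Pr'', I'',
      fun i hi hij x hxi hins => ?_⟩, ht⟩
    · rw [G.reg _ (by omega) (by omega) (by omega), Store.set_reg_self]
    · by_cases he : i = L.length - (j + 1)
      · subst he
        exact hx' x hxi hins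
      · exact hPr (hx i hi (by omega) x hxi hins)
  · rintro h' t ⟨-, h30, F, L', Pr', I, hx⟩ ht
    simp (disch := omega) only [Store.set_reg_self] at ht
    have hPr : ∀ S x, IsIdeal V S → S.card = k → x ∉ S → IsIdeal V (insert x S) →
        (S, x) ∈ Pr' := by
      intro S x hS hc hxS hins
      obtain ⟨i, hi, rfl⟩ := List.getElem_of_mem ((A.mem S).2 ⟨hS, hc⟩)
      exact hx i hi (by omega) x hxS hins
    have hlen' := I.level.length_le
    have e30 : h'.reg 30 = h.reg 31 := by omega
    refine ⟨⟨L', I.level.next hn hPr, fun S => I.level.mem_iff hn hPr, I.level.nodup, ?_, ?_, ?_⟩,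
      F.mono le_rfl (Nat.zero_le _), ?_⟩
    · rw [e30]
      exact I.window
    · rw [e30]
      exact I.tail
    · rw [I.tail, add_mul _ 1, one_mul]
      omega
    · have : L.length * (m * (10 * m + 21) + 6 + 1) ≤
        (ideals V).card * (m * (10 * m + 21) + 7) := Nat.mul_le_mul_right _ hlen
      omega

end Kemeny

/-! ### The beam of optimal prefixes -/

namespace Kemeny

open Ram

/-- Considers prepending the candidate `R 11` to the partial ranking in node `R 30`, where the set
of the candidates that are not yet placed is `R 12`. -/
def prependCmd : Cmd :=
  .seq (.ld 0 15 11) <| .ifle 15 13 (.seq (.sub 13 13 15) <| .seq (.sub 16 12 15) <|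
    .seq (.ld 4 18 16) <| .ite 18 (.seq (costCmd 16) <| .seq (.add 17 18 5) <|
      .ifle 17 14 (.ite 23 (.seq (.st 5 31 16) <| .seq (.st 6 31 11) <| .seq (.st 7 31 30) <|
        .seq (.const 19 1) <| .seq (.sub 23 23 19) (.inc 31)) .skip) .skip) .skip) .skip

/-- Considers all partial rankings that extend the one at the head of the queue. -/
def prependAllCmd : Cmd :=
  .seq (.ld 5 12 30) <| .seq (.ld 4 14 12) <| .seq (.mov 13 12) <|
    .seq (.rep 11 40 prependCmd) (.inc 30)

/-- Extends the optimal partial rankings by one candidate, keeping at most `R 42` of them. -/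
def beamCmd : Cmd := .seq (.sub 21 31 30) <| .seq (.mov 23 42) (.rep 20 21 prependAllCmd)

/-- Node `p` represents the partial ranking `l`, through pointers to the nodes of its ends. -/
def Node {m : ℕ} (A : ℕ → ℕ → ℕ) : List (Fin m) → ℕ → Prop
  | [], p => A 5 p = key (rest ([] : List (Fin m)))
  | x :: l, p => A 5 p = key (rest (x :: l)) ∧ A 6 p = x ∧ A 7 p < p ∧ Node A l (A 7 p)

theorem Node.key_eq {m : ℕ} {A : ℕ → ℕ → ℕ} {l : List (Fin m)} {p : ℕ} (H : Node A l p) :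
    A 5 p = key (rest l) := by
  cases l with
  | nil => exact H
  | cons x l => exact H.1

/-- Pointers strictly decrease, so a node below `lo` reaches only cells below `lo` and survives all
later writes. -/
theorem Node.congr {m : ℕ} {A A' : ℕ → ℕ → ℕ} {lo : ℕ}
    (hA : ∀ a, 5 ≤ a → a ≤ 7 → ∀ i < lo, A' a i = A a i) {l : List (Fin m)} :
    ∀ {p : ℕ}, p < lo → Node A l p → Node A' l p := by
  induction l with
  | nil => exact fun hp H => (hA 5 (by omega) (by omega) _ hp).trans H
  | cons x l ih =>
    rintro p hp ⟨h5, h6, h7, H⟩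
    rw [Node, hA 5 (by omega) (by omega) _ hp, hA 6 (by omega) (by omega) _ hp,
      hA 7 (by omega) (by omega) _ hp]
    exact ⟨h5, h6, h7, ih (h7.trans hp) H⟩

/-- The states agree except for the registers below `c`, the ends of the current part of the
queue, the counter of the beam, and the nodes from `lo` on. -/
structure BeamFrame (c lo : ℕ) (h h' : Store) : Prop where
  reg : ∀ i, c ≤ i → i ≠ 23 → i ≠ 30 → i ≠ 31 → h'.reg i = h.reg i
  arr : ∀ a < 5, h'.arr a = h.arr a
  node : ∀ a, 5 ≤ a → a ≤ 7 → ∀ i < lo, h'.arr a i = h.arr a i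
  inp : h'.inp = h.inp
  out : h'.out = h.out

namespace BeamFrame

variable {c lo : ℕ} {h h' : Store}

theorem refl (c lo : ℕ) (h : Store) : BeamFrame c lo h h :=
  ⟨fun _ _ _ _ _ => rfl, fun _ _ => rfl, fun _ _ _ _ _ => rfl, rfl, rfl⟩

theorem trans {h'' : Store} (F : BeamFrame c lo h h') (F' : BeamFrame c lo h' h'') :
    BeamFrame c lo h h'' where
  reg i h1 h2 h3 h4 := (F'.reg i h1 h2 h3 h4).trans (F.reg i h1 h2 h3 h4)
  arr a ha := (F'.arr a ha).trans (F.arr a ha)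
  node a h1 h2 i hi := (F'.node a h1 h2 i hi).trans (F.node a h1 h2 i hi)
  inp := F'.inp.trans F.inp
  out := F'.out.trans F.out

theorem set (F : BeamFrame c lo h h') {i : ℕ} (hi : i < c ∨ i = 23 ∨ i = 30 ∨ i = 31) (x : ℕ) :
    BeamFrame c lo h (h'.set i x) :=
  ⟨fun j h1 h2 h3 h4 => by rw [Store.set_reg_of_ne _ _ _ _ (by omega), F.reg j h1 h2 h3 h4],
    F.arr, F.node, F.inp, F.out⟩

theorem setArr (F : BeamFrame c lo h h') {a i : ℕ} (ha : 5 ≤ a) (hi : lo ≤ i) (x : ℕ) :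
    BeamFrame c lo h (h'.setArr a i x) :=
  ⟨F.reg, fun b hb => by rw [Store.setArr_arr_of_ne _ _ _ _ _ (by omega), F.arr b hb],
    fun b h1 h2 j hj => by
      by_cases hba : b = a
      · subst hba
        rw [Store.setArr_arr_same, Function.update_of_ne (by omega), F.node b h1 h2 j hj]
      · rw [Store.setArr_arr_of_ne _ _ _ _ _ hba, F.node b h1 h2 j hj], F.inp, F.out⟩

theorem mono {c' lo' : ℕ} (hc : c ≤ c') (hlo : lo' ≤ lo) (F : BeamFrame c lo h h') :
    BeamFrame c' lo' h h' :=
  ⟨fun i hi => F.reg i (hc.trans hi), F.arr, fun a h1 h2 i hi => F.node a h1 h2 i (by omega),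
    F.inp, F.out⟩

theorem frame {c' : ℕ} (hc : c' ≤ c) {h'' : Store} (F : BeamFrame c lo h h')
    (F' : Frame c' h' h'') : BeamFrame c lo h h'' :=
  ⟨fun i h1 h2 h3 h4 => by rw [F'.reg i (by omega), F.reg i h1 h2 h3 h4],
    fun a ha => by rw [F'.arr, F.arr a ha],
    fun a h1 h2 i hi => by rw [F'.arr, F.node a h1 h2 i hi],
    by rw [F'.inp, F.inp], by rw [F'.out, F.out]⟩

theorem tables {m n r : ℕ} {V : Profile m n} (hc : c ≤ 40) (F : BeamFrame c lo h h')
    (H : Tables V r h) : Tables V r h' where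
  reg_m := by rw [F.reg _ (by omega) (by omega) (by omega) (by omega), H.reg_m]
  reg_n := by rw [F.reg _ (by omega) (by omega) (by omega) (by omega), H.reg_n]
  reg_r := by rw [F.reg _ (by omega) (by omega) (by omega) (by omega), H.reg_r]
  pow := by rw [F.arr _ (by omega)]; exact H.pow
  row := by rw [F.arr _ (by omega)]; exact H.row
  wt := by rw [F.arr _ (by omega)]; exact H.wt

theorem table_eq {m : ℕ} (F : BeamFrame c lo h h') (S : Finset (Fin m)) :
    table h' S = table h S := by
  rw [table, F.arr _ (by omega), table]

end BeamFrame

/-- `M` lists optimal partial rankings of `k + 1` candidates, at most `r` of them; the extensions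
in `Pr` have been considered. -/
structure Beam {m n : ℕ} (V : Profile m n) (f : Finset (Fin m) → ℕ) (k r : ℕ)
    (M : List (List (Fin m))) (Pr : Set (List (Fin m) × Fin m)) : Prop where
  tight : ∀ l ∈ M, Tight V f l
  length : ∀ l ∈ M, l.length = k + 1
  nodup : M.Nodup
  length_le : M.length ≤ r
  sub : ∀ x l, x :: l ∈ M → (l, x) ∈ Pr
  complete : M.length = r ∨ ∀ l x, (l, x) ∈ Pr → Tight V f (x :: l) → x :: l ∈ M

/-- `M` lists optimal partial rankings of `k` candidates, namely either `r` of them or all. -/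
structure IsBeam {m n : ℕ} (V : Profile m n) (f : Finset (Fin m) → ℕ) (k r : ℕ)
    (M : List (List (Fin m))) : Prop where
  tight : ∀ l ∈ M, Tight V f l
  length : ∀ l ∈ M, l.length = k
  nodup : M.Nodup
  length_le : M.length ≤ r
  complete : M.length = r ∨ ∀ l, Tight V f l → l.length = k → l ∈ M

section

variable {m n k r : ℕ} {V : Profile m n} {f : Finset (Fin m) → ℕ} {M : List (List (Fin m))}
  {Pr : Set (List (Fin m) × Fin m)}

theorem Beam.empty (V : Profile m n) (f : Finset (Fin m) → ℕ) (k r : ℕ) : Beam V f k r [] ∅ :=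
  ⟨by simp, by simp, List.nodup_nil, by simp, by simp, .inr (by simp)⟩

theorem Beam.skip (H : Beam V f k r M Pr) {l : List (Fin m)} {x : Fin m}
    (h : M.length = r ∨ ¬ Tight V f (x :: l)) : Beam V f k r M (insert (l, x) Pr) :=
  { H with
    sub := fun y l' hm => .inr (H.sub y l' hm)
    complete := by
      rcases h with h | h
      · exact .inl h
      · refine H.complete.imp_right fun hc l' y hy ht => ?_
        rcases hy with hy | hy
        · obtain ⟨rfl, rfl⟩ := Prod.mk.inj hy
          exact absurd ht h
        · exact hc l' y hy ht }

/-- Distinctness comes for free: every listed ranking stems from a considered pair, and the present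
pair is new. -/
theorem Beam.append (H : Beam V f k r M Pr) {l : List (Fin m)} {x : Fin m} (hl : l.length = k)
    (h : Tight V f (x :: l)) (hPr : (l, x) ∉ Pr) (hlt : M.length < r) :
    Beam V f k r (M ++ [x :: l]) (insert (l, x) Pr) where
  tight l' hl' := by
    rcases List.mem_append.1 hl' with h' | h'
    · exact H.tight _ h'
    · rwa [List.mem_singleton.1 h']
  length l' hl' := by
    rcases List.mem_append.1 hl' with h' | h'
    · exact H.length _ h'
    · rw [List.mem_singleton.1 h', List.length_cons, hl]
  nodup := by
    refine List.Nodup.append H.nodup (List.nodup_singleton _) ?_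
    rw [List.disjoint_singleton]
    exact fun h' => hPr (H.sub _ _ h')
  length_le := by
    rw [List.length_append, List.length_singleton]
    exact hlt
  sub y l' hm := by
    rcases List.mem_append.1 hm with h' | h'
    · exact .inr (H.sub _ _ h')
    · obtain ⟨rfl, rfl⟩ := List.cons.inj (List.mem_singleton.1 h')
      exact .inl rfl
  complete := by
    refine .inr fun l' y hy ht => ?_
    rcases hy with hy | hy
    · obtain ⟨rfl, rfl⟩ := Prod.mk.inj hy
      simp
    · exact List.mem_append_left _ ((H.complete.resolve_left hlt.ne) l' y hy ht)

theorem IsBeam.nil (V : Profile m n) (f : Finset (Fin m) → ℕ) (hr : 1 ≤ r) :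
    IsBeam V f 0 r [[]] :=
  ⟨by simp [Tight], by simp, by simp, by simpa, .inr (by simp)⟩

/-- If the previous beam was complete, so is the new one unless it is full. If the previous beam
held r ends, each has a tight prolongation, and these are distinct because their tails are; so the
new beam is full as well. -/
theorem Beam.isBeam (H : Beam V f k r M Pr) (hf : IsBellman V f) (hk : k < m)
    {M₀ : List (List (Fin m))} (H₀ : IsBeam V f k r M₀) (hPr : ∀ l ∈ M₀, ∀ x, (l, x) ∈ Pr) :
    IsBeam V f (k + 1) r M where
  tight := H.tight
  length := H.length
  nodup := H.nodup
  length_le := H.length_le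
  complete := by
    refine or_iff_not_imp_left.2 fun hr l hl hlen => ?_
    have hc := H.complete.resolve_left hr
    rcases H₀.complete with h₀ | h₀
    · refine absurd (le_antisymm H.length_le ?_) hr
      have hsub : M₀ ⊆ M.map List.tail := fun l' hl' => by
        obtain ⟨x, hx⟩ := (H₀.tight l' hl').exists_cons hf
          (rest_nonempty (by rw [H₀.length l' hl']; exact hk))
        exact List.mem_map.2 ⟨_, hc _ _ (hPr l' hl' x) hx, rfl⟩
      have := (H₀.nodup.subperm hsub).length_le
      rwa [List.length_map, h₀] at this
    · cases l with
      | nil => simp at hlen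
      | cons x l => exact hc _ _ (hPr l (h₀ l hl.1 (by simpa using hlen)) x) hl

end

/-- The nodes from `lo` on represent the partial rankings in `M`. -/
structure BeamInv {m n : ℕ} (V : Profile m n) (f : Finset (Fin m) → ℕ) (k r lo : ℕ) (h : Store)
    (M : List (List (Fin m))) (Pr : Set (List (Fin m) × Fin m)) : Prop where
  beam : Beam V f k r M Pr
  node : ∀ i (hi : i < M.length), Node h.arr M[i] (lo + i)
  tail : h.reg 31 = lo + M.length
  counter : h.reg 23 = r - M.length

theorem BeamInv.set {m n k r lo : ℕ} {V : Profile m n} {f : Finset (Fin m) → ℕ} {h : Store}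
    {M : List (List (Fin m))} {Pr : Set (List (Fin m) × Fin m)} (I : BeamInv V f k r lo h M Pr)
    {i : ℕ} (h23 : i ≠ 23) (h31 : i ≠ 31) (x : ℕ) : BeamInv V f k r lo (h.set i x) M Pr :=
  ⟨I.beam, I.node, by rw [Store.set_reg_of_ne _ _ _ _ h31.symm, I.tail],
    by rw [Store.set_reg_of_ne _ _ _ _ h23.symm, I.counter]⟩

theorem BeamInv.frame {m n k r lo c : ℕ} {V : Profile m n} {f : Finset (Fin m) → ℕ}
    {h h' : Store} {M : List (List (Fin m))} {Pr : Set (List (Fin m) × Fin m)}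
    (I : BeamInv V f k r lo h M Pr) (F : Frame c h h') (hc : c ≤ 23) :
    BeamInv V f k r lo h' M Pr :=
  ⟨I.beam, by rw [F.arr]; exact I.node, by rw [F.reg _ (by omega), I.tail],
    by rw [F.reg _ hc, I.counter]⟩

theorem BeamInv.skip {m n k r lo : ℕ} {V : Profile m n} {f : Finset (Fin m) → ℕ} {h : Store}
    {M : List (List (Fin m))} {Pr : Set (List (Fin m) × Fin m)} (I : BeamInv V f k r lo h M Pr)
    {l : List (Fin m)} {x : Fin m} (hs : M.length = r ∨ ¬ Tight V f (x :: l)) :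
    BeamInv V f k r lo h M (insert (l, x) Pr) :=
  { I with beam := I.beam.skip hs }

/-- Going backwards, the table itself reveals whether the smaller set is an ideal, since it is
nonzero exactly there. The admissibility flag of `costCmd` is therefore ignored. -/
theorem wp_prependCmd {m n r B : ℕ} {V : Profile m n}
    (hB : Fits m n r (ideals V).card B) {h : Store} (H : Tables V r h)
    {f : Finset (Fin m) → ℕ} (hf : table h = f) (hD : LevelInv V m f [] ∅) {k lo : ℕ} {M : List (List (Fin m))}
    {Pr : Set (List (Fin m) × Fin m)} (I : BeamInv V f k r lo h M Pr)
    (hlo : lo + r + 1 < 2 ^ B) {l : List (Fin m)} (hl : Tight V f l) (hk : l.length = k)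
    (hnode : Node h.arr l (h.reg 30)) (h30 : h.reg 30 < lo) {x : Fin m} (hPr : (l, x) ∉ Pr)
    (h11 : h.reg 11 = x) (h12 : h.reg 12 = key (rest l)) (h13 : h.reg 13 = lowKey (rest l) (x + 1))
    (h14 : h.reg 14 = f (rest l)) :
    wp B prependCmd h fun h' t => h'.reg 11 = x ∧ h'.reg 12 = key (rest l) ∧
      h'.reg 13 = lowKey (rest l) x ∧ h'.reg 14 = f (rest l) ∧ h'.reg 30 = h.reg 30 ∧
      BeamFrame 20 lo h h' ∧ (∃ M', BeamInv V f k r lo h' M' (insert (l, x) Pr)) ∧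
      t ≤ 10 * m + 30 := by
  subst hf
  have hle := two_pow_le_lowKey_iff (S := rest l) (x := x)
  have hB1 := hB.one
  have hB2 := hB.sq
  have hB3 := hB.cost
  simp (disch := omega) only [prependCmd, wp_seq, wp_ld, wp_ifle, wp_sub, wp_ite, wp_skip,
    Store.set_reg_of_ne, Store.set_reg_self, Store.set_arr, h11, h12, h13, h14, H.pow x x.2]
  refine ⟨by omega, fun hS1 => ?_, fun hS1 => ?_⟩
  swap
  · have hxS : x ∉ rest l := fun h => absurd (hle.2 h) (not_le.2 hS1)
    refine ⟨trivial, trivial, lowKey_succ_of_notMem hxS, trivial, trivial,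
      (BeamFrame.refl 20 lo h).set (by omega) _,
      ⟨M, (I.set (by omega) (by omega) _).skip (.inr fun ht => hxS (mem_rest.2 ht.2.1))⟩, by omega⟩
  have hxS := hle.1 hS1
  have hkey : key (rest l) - 2 ^ (x : ℕ) = key (rest (x :: l)) := by
    rw [rest_cons, key_erase hxS]
  have hlow : lowKey (rest l) (x + 1) - 2 ^ (x : ℕ) = lowKey (rest l) x := by
    rw [lowKey_succ_of_mem hxS]
    omega
  have htab : h.arr 4 (key (rest (x :: l))) = table h (rest (x :: l)) := rfl
  simp only [hkey, hlow, htab]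
  have F0 := ((((Frame.refl 19 h).set (i := 15) (by omega) (2 ^ (x : ℕ))).set (i := 13) (by omega)
    (lowKey (rest l) x)).set (i := 16) (by omega) (key (rest (x :: l)))).set (i := 18) (by omega)
    (table h (rest (x :: l)))
  have F0' := (BeamFrame.refl 20 lo h).frame (by omega) F0
  have I0 := I.frame F0 (by omega)
  refine ⟨by omega, fun hne => ?_, fun h0 => ?_⟩
  swap
  · refine ⟨trivial, trivial, trivial, trivial, trivial, F0', ⟨M, I0.skip (.inr fun ht => ?_)⟩,
      by omega⟩
    exact (hD.isBellman.ne_zero _).2 ht.isIdeal h0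
  have hideal := (hD.isBellman.ne_zero _).1 hne
  have hins := insert_rest_cons (mem_rest.1 hxS)
  -- This inequality makes the machine's test "at most" equivalent to the equality required for
  -- tightness.
  have hbell := hD.isBellman.le _ x hideal (by simp [mem_rest]) (by rw [hins]; exact hl.isIdeal)
  rw [hins] at hbell
  refine wp_mono _ _ _ _ ?_ (wp_costCmd (V := V) (r := r) (S := rest (x :: l)) (x := x) hB1 hB2
    (by omega) (F0.tables (by omega) H)
    (by simp (disch := omega) only [Store.set_reg_of_ne, Store.set_reg_self])
    (by simp (disch := omega) only [Store.set_reg_of_ne, h11]))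
  rintro h1 t ⟨F1, h5, -, ht⟩
  have e11 : h1.reg 11 = x := by
    rw [F1.reg _ (by omega)]; simp (disch := omega) only [Store.set_reg_of_ne, h11]
  have e12 : h1.reg 12 = key (rest l) := by
    rw [F1.reg _ (by omega)]; simp (disch := omega) only [Store.set_reg_of_ne, h12]
  have e13 : h1.reg 13 = lowKey (rest l) x := by
    rw [F1.reg _ (by omega)]
    simp (disch := omega) only [Store.set_reg_of_ne, Store.set_reg_self]
  have e14 : h1.reg 14 = table h (rest l) := by
    rw [F1.reg _ (by omega)]; simp (disch := omega) only [Store.set_reg_of_ne, h14]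
  have e16 : h1.reg 16 = key (rest (x :: l)) := by
    rw [F1.reg _ (by omega)]
    simp (disch := omega) only [Store.set_reg_of_ne, Store.set_reg_self]
  have e18 : h1.reg 18 = table h (rest (x :: l)) := by
    rw [F1.reg _ (by omega)]
    simp (disch := omega) only [Store.set_reg_self]
  have e30 : h1.reg 30 = h.reg 30 := by
    rw [F1.reg _ (by omega)]; simp (disch := omega) only [Store.set_reg_of_ne]
  have F2 : BeamFrame 20 lo h h1 := F0'.frame (by omega) F1
  have I1 := I0.frame F1 (by omega)
  have earr : h1.arr = h.arr := F1.arr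
  have e23 := I1.counter
  have e31 := I1.tail
  have hcost := stepCost_le V (rest (x :: l)) x
  have hbd := hD.bound (rest (x :: l))
  have hSm : (rest (x :: l)).card * (m * n) ≤ m * (m * n) :=
    Nat.mul_le_mul_right _ ((Finset.card_le_univ _).trans_eq (Fintype.card_fin m))
  have hlen := I.beam.length_le
  simp (disch := omega) only [wp_st, wp_inc, wp_add, wp_const, Store.set_reg_of_ne, Store.set_reg_self, Store.setArr_reg, e11, e12, e13, e14,
    e16, e18, e23, e30, e31, h5]
  refine ⟨by omega, fun hle1 => ⟨fun hc => ?_, fun hc => ?_⟩, fun hlt => ?_⟩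
  · have htight : Tight V (table h) (x :: l) := ⟨hl, mem_rest.1 hxS, hideal, by omega⟩
    refine ⟨by omega, by omega, by omega, by omega, by omega, trivial, trivial, trivial, trivial,
      trivial, ?_, ⟨M ++ [x :: l], I.beam.append hk htight hPr (by omega), ?_, ?_, ?_⟩, by omega⟩
    · exact ((((((F2.set (by omega) _).setArr (by omega) (by omega) _).setArr (by omega) (by omega)
        _).setArr (by omega) (by omega) _).set (by omega) _).set (by omega) _).set (by omega) _
    -- The three cells of the new node lie beyond all existing nodes, so the old nodes, including
    -- the one pointed to, are unchanged.
    · have hG := ((((BeamFrame.refl 20 (lo + M.length) h1).set (i := 17) (by omega)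
        (table h (rest (x :: l)) + stepCost V (rest (x :: l)) x)).setArr (a := 5)
        (by omega) le_rfl (key (rest (x :: l)))).setArr (a := 6) (by omega) le_rfl
        x).setArr (a := 7) (by omega) le_rfl (h.reg 30)
      intro i hi
      rw [List.length_append, List.length_singleton] at hi
      simp only [Store.set_arr]
      rcases Nat.lt_succ_iff_lt_or_eq.1 hi with hi' | rfl
      · rw [List.getElem_append_left hi']
        exact (I1.node i hi').congr hG.node (by omega)
      · have hq : Node h1.arr l (h.reg 30) := by rwa [earr]
        have := hq.congr hG.node (by omega)
        simp only [List.getElem_append_right le_rfl, Nat.sub_self, List.getElem_singleton, Node]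
        simp (disch := omega) only [Store.setArr_arr_of_ne, Store.setArr_arr_self]
        refine ⟨trivial, trivial, by omega, this⟩
    · rw [Store.set_reg_self, List.length_append, List.length_singleton, add_assoc]
    · rw [Store.set_reg_of_ne _ _ _ _ (by omega), Store.set_reg_self, List.length_append,
        List.length_singleton, Nat.sub_sub]
  · exact ⟨trivial, trivial, trivial, trivial, trivial, F2.set (by omega) _,
      ⟨M, (I1.set (by omega) (by omega) _).skip (.inl (by omega))⟩, by omega⟩
  · refine ⟨trivial, trivial, trivial, trivial, trivial, F2.set (by omega) _,
      ⟨M, (I1.set (by omega) (by omega) _).skip (.inr fun ht => ?_)⟩, by omega⟩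
    have := ht.2.2.2
    omega

theorem wp_prependAllCmd {m n r B : ℕ} {V : Profile m n}
    (hB : Fits m n r (ideals V).card B) {h : Store} (H : Tables V r h)
    {f : Finset (Fin m) → ℕ} (hf : table h = f) (hD : LevelInv V m f [] ∅) {k lo : ℕ}
    {M : List (List (Fin m))} {Pr : Set (List (Fin m) × Fin m)} (I : BeamInv V f k r lo h M Pr)
    (hlo : lo + r + 1 < 2 ^ B) {l : List (Fin m)} (hl : Tight V f l) (hk : l.length = k)
    (hnode : Node h.arr l (h.reg 30)) (h30 : h.reg 30 < lo) (hPr : ∀ x, (l, x) ∉ Pr) :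
    wp B prependAllCmd h fun h' t => h'.reg 30 = h.reg 30 + 1 ∧ BeamFrame 20 lo h h' ∧
      (∃ M', BeamInv V f k r lo h' M' (Pr ∪ {q | q.1 = l})) ∧ t ≤ m * (10 * m + 31) + 6 := by
  have h4 : h.arr 4 (key (rest l)) = f (rest l) := by rw [← hf, table]
  simp (disch := omega) only [prependAllCmd, wp_seq, wp_ld, wp_mov, wp_inc, Store.set_reg_of_ne,
    Store.set_reg_self, Store.set_arr, hnode.key_eq, h4]
  refine ⟨by omega, by omega, wp_rep (T := 10 * m + 30) (fun j h' => h'.reg 12 = key (rest l) ∧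
    h'.reg 13 = lowKey (rest l) j ∧ h'.reg 14 = f (rest l) ∧ h'.reg 30 = h.reg 30 ∧
    BeamFrame 20 lo h h' ∧ ∃ M', BeamInv V f k r lo h' M'
      (Pr ∪ {q | q.1 = l ∧ j ≤ (q.2 : ℕ)})) ?_ ?_ ?_⟩
  · simp (disch := omega) only [Store.set_reg_of_ne, Store.set_reg_self, H.reg_m, lowKey_top]
    have he : Pr ∪ {q | q.1 = l ∧ m ≤ (q.2 : ℕ)} = Pr := by
      refine Set.union_eq_self_of_subset_right ?_
      rintro ⟨l', x⟩ ⟨-, hx⟩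
      exact absurd x.2 (not_lt.2 hx)
    rw [he]
    refine ⟨trivial, trivial, trivial, trivial, ?_, M, ?_⟩
    · exact ((((BeamFrame.refl 20 lo h).set (by omega) _).set (by omega) _).set (by omega) _).set
        (by omega) _
    · exact (((I.set (by omega) (by omega) _).set (by omega) (by omega) _).set (by omega)
        (by omega) _).set (by omega) (by omega) _
  · rintro j h' hj ⟨h12, h13, h14, g30, F, M', I'⟩
    simp (disch := omega) only [Store.set_reg_of_ne, H.reg_m] at hj
    let x : Fin m := ⟨j, hj⟩
    have F' := F.set (i := 11) (by omega) j
    have e30 : (h'.set 11 j).reg 30 = h.reg 30 := by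
      rw [Store.set_reg_of_ne _ _ _ _ (by omega), g30]
    have hset : insert (l, x) (Pr ∪ {q | q.1 = l ∧ j + 1 ≤ (q.2 : ℕ)}) =
        Pr ∪ {q | q.1 = l ∧ j ≤ (q.2 : ℕ)} := by
      ext ⟨l', y⟩
      simp only [Set.mem_insert_iff, Set.mem_union, Set.mem_ofPred_eq, Prod.mk.injEq, Fin.ext_iff, x]
      constructor
      · rintro (⟨h1, h2⟩ | h1 | ⟨h1, h2⟩)
        exacts [.inr ⟨h1, h2.ge⟩, .inl h1, .inr ⟨h1, by omega⟩]
      · rintro (h1 | ⟨h1, h2⟩)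
        · exact .inr (.inl h1)
        · rcases h2.eq_or_lt with h3 | h3
          exacts [.inl ⟨h1, h3.symm⟩, .inr (.inr ⟨h1, h3⟩)]
    rw [← hset]
    refine wp_mono _ _ _ _ ?_ (wp_prependCmd hB (F'.tables (by omega) H)
      ((funext F'.table_eq).trans hf) hD (I'.set (by omega) (by omega) j) hlo hl hk
      (e30 ▸ hnode.congr F'.node h30) (e30 ▸ h30) (x := x) ?_ (Store.set_reg_self _ _ _)
      (by rw [Store.set_reg_of_ne _ _ _ _ (by omega), h12])
      (by rw [Store.set_reg_of_ne _ _ _ _ (by omega), h13])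
      (by rw [Store.set_reg_of_ne _ _ _ _ (by omega), h14]))
    · rintro h'' t ⟨g11, g12, g13, g14, g30', G, ⟨M'', I''⟩, ht⟩
      exact ⟨g11, ⟨g12, g13, g14, g30'.trans e30, F'.trans G, M'', I''⟩, ht⟩
    · rintro (h1 | ⟨-, h1⟩)
      · exact hPr x h1
      · simp [x] at h1
  · rintro h' t ⟨-, -, -, g30, F, M', I'⟩ ht
    simp (disch := omega) only [Store.set_reg_of_ne, H.reg_m] at ht
    simp only [Nat.zero_le, and_true] at I'
    rw [g30]
    refine ⟨by omega, rfl, F.set (by omega) _, ⟨M', I'.set (by omega) (by omega) _⟩, ?_⟩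
    have : 10 * m + 30 + 1 = 10 * m + 31 := rfl
    rw [this] at ht
    omega

/-- The current part of the queue represents the optimal partial rankings in `M`. -/
structure AtBeam {m n : ℕ} (V : Profile m n) (f : Finset (Fin m) → ℕ) (k r : ℕ) (h : Store)
    (M : List (List (Fin m))) : Prop where
  beam : IsBeam V f k r M
  node : ∀ i (hi : i < M.length), Node h.arr M[i] (h.reg 30 + i)
  tail : h.reg 31 = h.reg 30 + M.length
  tail_le : h.reg 31 ≤ (m + 1) * (ideals V).card + k * r

/-- The current beam has at most r entries, and each costs O(m²) steps; this is where the factor r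
in the running time arises. -/
theorem wp_beamCmd {m n r B : ℕ} {V : Profile m n} (hB : Fits m n r (ideals V).card B)
    {h : Store} (H : Tables V r h) {f : Finset (Fin m) → ℕ} (hf : table h = f)
    (hD : LevelInv V m f [] ∅) {k : ℕ} (hk : k < m) {M : List (List (Fin m))}
    (A : AtBeam V f k r h M) :
    wp B beamCmd h fun h' t => (∃ M', AtBeam V f (k + 1) r h' M') ∧ BeamFrame 22 0 h h' ∧
      t ≤ r * (m * (10 * m + 31) + 7) + 4 := by
  have hA := A.tail
  have hA' := A.tail_le
  have hlen := A.beam.length_le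
  have hlo : h.reg 31 + r + 1 < 2 ^ B := by
    have h1 : k * r ≤ m * r := Nat.mul_le_mul_right _ hk.le
    have h2 := hB.queue
    have h3 : (m + 2) * ((ideals V).card + r + 1) =
      (m + 1) * (ideals V).card + (ideals V).card + m * r + 2 * r + m + 2 := by ring
    omega
  have hcount : h.reg 31 - h.reg 30 = M.length := by omega
  simp (disch := omega) only [beamCmd, wp_seq, wp_sub, wp_mov, Store.set_reg_of_ne, hcount, H.reg_r]
  refine wp_rep (T := m * (10 * m + 31) + 6) (fun j h' => j ≤ M.length ∧
    h'.reg 30 = h.reg 30 + (M.length - j) ∧ BeamFrame 22 (h.reg 31) h h' ∧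
    ∃ M', BeamInv V f k r (h.reg 31) h' M' {q | ∃ i, ∃ hi : i < M.length,
      i + j < M.length ∧ q.1 = M[i]}) ?_ ?_ ?_
  · simp (disch := omega) only [Store.set_reg_of_ne, Store.set_reg_self]
    have he : {q : List (Fin m) × Fin m | ∃ i, ∃ hi : i < M.length, i + M.length < M.length ∧
        q.1 = M[i]} = ∅ := by
      ext q
      simp only [Set.mem_ofPred_eq, Set.mem_empty_iff_false, iff_false]
      rintro ⟨i, _, hi, -⟩
      omega
    rw [he]
    refine ⟨le_rfl, by omega, (((BeamFrame.refl 22 _ h).set (by omega) _).set (by omega) _).set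
      (by omega) _, [], Beam.empty V f k r, fun i hi => by simp at hi, ?_, ?_⟩
    all_goals simp (disch := omega) only [Store.set_reg_of_ne, Store.set_reg_self, List.length_nil,
      add_zero, Nat.sub_zero]
  · rintro j h' hj ⟨hj', h30, F, M', I⟩
    have hi : M.length - (j + 1) < M.length := by omega
    have hmem := List.getElem_mem hi
    have F' := F.set (i := 20) (by omega) j
    have e30 : (h'.set 20 j).reg 30 = h.reg 30 + (M.length - (j + 1)) := by
      rw [Store.set_reg_of_ne _ _ _ _ (by omega), h30]
    refine wp_mono _ _ _ _ ?_ (wp_prependAllCmd hB (F'.tables (by omega) H)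
      ((funext F'.table_eq).trans hf) hD (I.set (by omega) (by omega) j) hlo
      (A.beam.tight _ hmem) (A.beam.length _ hmem)
      (e30 ▸ (A.node _ hi).congr F'.node (by omega)) (by omega) ?_)
    · rintro h'' t ⟨g30, G, ⟨M'', I''⟩, ht⟩
      refine ⟨?_, ⟨by omega, by omega, F'.trans (G.mono (by omega) le_rfl), M'', ?_⟩, ht⟩
      · rw [G.reg _ (by omega) (by omega) (by omega) (by omega), Store.set_reg_self]
      · convert I'' using 1
        ext q
        simp only [Set.mem_union, Set.mem_ofPred_eq]
        constructor
        · rintro ⟨i, hi', hij, he⟩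
          by_cases hie : i = M.length - (j + 1)
          · subst hie
            exact .inr he
          · exact .inl ⟨i, hi', by omega, he⟩
        · rintro (⟨i, hi', hij, he⟩ | he)
          · exact ⟨i, hi', by omega, he⟩
          · exact ⟨_, hi, by omega, he⟩
    · rintro x ⟨i, hi', hij, he⟩
      -- No end is expanded twice because the beam has no repetitions, so the pair is indeed new.
      have := (A.beam.nodup.getElem_inj_iff (hi := hi) (hj := hi')).1 he
      omega
  · rintro h' t ⟨-, h30, F, M', I⟩ ht
    simp (disch := omega) only [Store.set_reg_of_ne, Store.set_reg_self] at ht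
    have hbeam : IsBeam V f (k + 1) r M' := I.beam.isBeam hD.isBellman hk A.beam fun l hl x => by
      obtain ⟨i, hi, rfl⟩ := List.getElem_of_mem hl
      exact ⟨i, hi, by omega, rfl⟩
    have hlen' := hbeam.length_le
    have e30 : h'.reg 30 = h.reg 31 := by omega
    refine ⟨⟨M', hbeam, ?_, ?_, ?_⟩, F.mono le_rfl (Nat.zero_le _), ?_⟩
    · rw [e30]
      exact I.node
    · rw [e30]
      exact I.tail
    · rw [I.tail, add_mul k 1, one_mul]
      omega
    · have : M.length * (m * (10 * m + 31) + 6 + 1) ≤ r * (m * (10 * m + 31) + 7) :=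
        Nat.mul_le_mul_right _ hlen
      omega

end Kemeny

/-! ### Reading the candidates and preparing the arrays -/

namespace Kemeny

open Ram

/-- Reads the parameters and computes the tables of powers of two and of row addresses. -/
def setupCmd : Cmd :=
  .seq (.read 40) <| .seq (.read 41) <| .seq (.read 42) <| .seq (.const 0 1) <|
    .seq (.const 1 0) <| .seq (.const 2 0) <| .rep 3 40 <|
      .seq (.st 0 2 0) <| .seq (.st 1 2 1) <| .seq (.add 0 0 0) <| .seq (.add 1 1 40) (.inc 2)

/-- Counts that the `R 13`-th candidate of the current vote is before the candidate `R 12`. -/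
def bumpCmd : Cmd :=
  .seq (.ld 2 14 13) <| .seq (.ld 1 15 14) <| .seq (.add 15 15 12) <| .seq (.ld 3 16 15) <|
    .seq (.inc 16) (.st 3 15 16)

/-- Reads the next candidate of a vote. -/
def candCmd : Cmd :=
  .seq (.read 12) <| .seq (.rep 13 10 bumpCmd) <| .seq (.st 2 10 12) (.inc 10)

/-- Reads a vote. -/
def voteCmd : Cmd := .seq (.const 10 0) (.rep 11 40 candCmd)

/-- Reads all votes. -/
def votesCmd : Cmd := .rep 20 41 voteCmd

theorem pair_inj {m : ℕ} {a a' b b' : Fin m} (h : (a * m + b : ℕ) = a' * m + b') :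
    a = a' ∧ b = b' := by
  have key : ∀ a b : Fin m, (a * m + b : ℕ) / m = a := fun a b => by
    rw [mul_comm, Nat.mul_add_div (by omega), Nat.div_eq_of_lt b.2, add_zero]
  have ha : (a : ℕ) = a' := by rw [← key a b, h, key]
  rw [ha] at h
  exact ⟨Fin.ext ha, Fin.ext (by omega)⟩

theorem pair_lt {m : ℕ} (a b : Fin m) : (a * m + b : ℕ) < m * m :=
  calc (a * m + b : ℕ) < a * m + m := by omega
    _ = (a + 1) * m := by ring
    _ ≤ m * m := Nat.mul_le_mul_right _ a.2

/-- The machine only adds and subtracts, so powers of two are tabulated by doubling and the row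
addresses i·m by repeated addition. -/
theorem wp_setupCmd {m n r B : ℕ} (hB : 1 < 2 ^ B) (hB2 : m * m < 2 ^ B) (hB3 : 2 ^ m < 2 ^ B)
    {l : List ℕ} :
    wp B setupCmd ⟨fun _ => 0, fun _ _ => 0, m :: n :: r :: l, []⟩ fun h t =>
      h.reg 40 = m ∧ h.reg 41 = n ∧ h.reg 42 = r ∧ (∀ i < m, h.arr 0 i = 2 ^ i) ∧
      (∀ i < m, h.arr 1 i = i * m) ∧ (∀ a, 2 ≤ a → ∀ i, h.arr a i = 0) ∧ h.inp = l ∧ h.out = [] ∧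
      t ≤ 6 * m + 8 := by
  simp (disch := omega) only [setupCmd, wp_seq, wp_read, wp_const, Store.setInp_inp, List.headD_cons, List.tail_cons]
  refine ⟨hB, by omega, by omega, wp_rep (T := 5) (fun j h => j ≤ m ∧ h.reg 40 = m ∧
    h.reg 41 = n ∧ h.reg 42 = r ∧ h.reg 0 = 2 ^ (m - j) ∧ h.reg 1 = (m - j) * m ∧
    h.reg 2 = m - j ∧ (∀ i < m - j, h.arr 0 i = 2 ^ i) ∧ (∀ i < m - j, h.arr 1 i = i * m) ∧
    (∀ a, 2 ≤ a → ∀ i, h.arr a i = 0) ∧ h.inp = l ∧ h.out = []) ?_ ?_ ?_⟩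
  · simp (disch := omega) [Store.set_reg_of_ne]
  · rintro j h hj ⟨hj', h40, h41, h42, h0, h1, h2, hpow, hrow, harr, hinp, hout⟩
    have hp : (2 : ℕ) ^ (m - j) = 2 ^ (m - (j + 1)) + 2 ^ (m - (j + 1)) := by
      rw [show m - j = (m - (j + 1)) + 1 by omega, pow_succ, mul_two]
    have hm : (m - j) * m = (m - (j + 1)) * m + m := by
      rw [show m - j = (m - (j + 1)) + 1 by omega, add_mul, one_mul]
    have hple : (2 : ℕ) ^ (m - j) ≤ 2 ^ m := Nat.pow_le_pow_right (by omega) (by omega)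
    have hmle : (m - j) * m ≤ m * m := Nat.mul_le_mul_right _ (by omega)
    have hlt : m ≤ m * m := Nat.le_mul_self m
    simp (disch := omega) only [wp_seq, wp_st, wp_add, wp_inc, Store.set_reg_of_ne,
      Store.set_reg_self, Store.setArr_reg, Store.set_arr, Store.set_inp, Store.set_out,
      Store.setArr_inp, Store.setArr_out, h40, h41, h42, h0, h1, h2, Store.setArr_arr_of_ne,
      Store.setArr_arr_same]
    refine ⟨by omega, by omega, by omega, by omega, by omega, trivial, ⟨by omega, trivial, trivial,
      trivial, hp.symm, hm.symm, by omega, fun i hi => ?_, fun i hi => ?_, ?_, hinp, hout⟩,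
      by omega⟩
    · by_cases he : i = m - (j + 1)
      · rw [he, Function.update_self]
      · rw [Function.update_of_ne he, hpow i (by omega)]
    · by_cases he : i = m - (j + 1)
      · rw [he, Function.update_self]
      · rw [Function.update_of_ne he, hrow i (by omega)]
    · intro a ha i
      rw [Store.setArr_arr_of_ne _ _ _ _ _ (by omega),
        Store.setArr_arr_of_ne _ _ _ _ _ (by omega), Store.set_arr, harr a ha]
  · rintro h t ⟨-, h40, h41, h42, -, -, -, hpow, hrow, harr, hinp, hout⟩ ht
    simp (disch := omega) only [Store.set_reg_of_ne, Store.set_reg_self, Store.setInp_reg] at ht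
    exact ⟨h40, h41, h42, hpow, hrow, harr, hinp, hout, by omega⟩

/-- The number of votes before the `i`-th one that place `a` before `b`. -/
def wtBelow {m n : ℕ} (V : Profile m n) (i : ℕ) (a b : Fin m) : ℕ :=
  (Finset.univ.filter fun i' : Fin n => (i' : ℕ) < i ∧ Prefers (V i') a b).card

theorem wtBelow_zero {m n : ℕ} (V : Profile m n) (a b : Fin m) : wtBelow V 0 a b = 0 := by
  simp [wtBelow]

theorem wtBelow_top {m n : ℕ} (V : Profile m n) (a b : Fin m) : wtBelow V n a b = wt V a b := by
  simp [wtBelow, wt]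

theorem wtBelow_succ {m n : ℕ} (V : Profile m n) (i : Fin n) (a b : Fin m) :
    wtBelow V (i + 1) a b = wtBelow V i a b + if Prefers (V i) a b then 1 else 0 := by
  rw [wtBelow, wtBelow, Finset.card_filter, Finset.card_filter,
    ← Finset.add_sum_erase _ _ (Finset.mem_univ i), ← Finset.add_sum_erase _ _ (Finset.mem_univ i)]
  have : ∀ i' ∈ Finset.univ.erase i, (if (i' : ℕ) < i + 1 ∧ Prefers (V i') a b then 1 else 0) =
      if (i' : ℕ) < i ∧ Prefers (V i') a b then 1 else 0 := fun i' hi' => by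
    have : (i' : ℕ) ≠ i := fun he => (Finset.mem_erase.1 hi').1 (Fin.ext he)
    refine if_congr (and_congr_left fun _ => ?_) rfl rfl
    omega
  rw [Finset.sum_congr rfl this]
  simp [add_comm]

theorem wtBelow_le {m n : ℕ} (V : Profile m n) (i : ℕ) (a b : Fin m) : wtBelow V i a b ≤ n :=
  (Finset.card_le_univ _).trans_eq (by simp)

/-- The states agree except for registers below `c`, the tables `2` and `3`, and the input. -/
structure ReadFrame (c : ℕ) (h h' : Store) : Prop where
  reg : ∀ i, c ≤ i → h'.reg i = h.reg i
  arr : ∀ a, a ≠ 2 → a ≠ 3 → h'.arr a = h.arr a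
  out : h'.out = h.out

namespace ReadFrame

variable {c : ℕ} {h h' : Store}

theorem refl (c : ℕ) (h : Store) : ReadFrame c h h :=
  ⟨fun _ _ => rfl, fun _ _ _ => rfl, rfl⟩

theorem trans {h'' : Store} (F : ReadFrame c h h') (F' : ReadFrame c h' h'') :
    ReadFrame c h h'' :=
  ⟨fun i hi => (F'.reg i hi).trans (F.reg i hi),
    fun a h1 h2 => (F'.arr a h1 h2).trans (F.arr a h1 h2), F'.out.trans F.out⟩

theorem set (F : ReadFrame c h h') {i : ℕ} (hi : i < c) (x : ℕ) : ReadFrame c h (h'.set i x) :=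
  ⟨fun j hj => by rw [Store.set_reg_of_ne _ _ _ _ (by omega), F.reg j hj], F.arr, F.out⟩

theorem setArr (F : ReadFrame c h h') {a : ℕ} (ha : a = 2 ∨ a = 3) (i x : ℕ) :
    ReadFrame c h (h'.setArr a i x) :=
  ⟨F.reg, fun b h1 h2 => by rw [Store.setArr_arr_of_ne _ _ _ _ _ (by omega), F.arr b h1 h2], F.out⟩

theorem setInp (F : ReadFrame c h h') (l : List ℕ) : ReadFrame c h (h'.setInp l) :=
  ⟨F.reg, F.arr, F.out⟩

end ReadFrame

/-- A pair of candidates is counted when its later member is read, once for each candidate read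
earlier in the same vote; positions never have to be compared. The last summand of the loop
invariant records the pairs already counted for the new candidate. -/
theorem wp_candCmd {m B : ℕ} (hB : m * m < 2 ^ B) {h : Store} (σ : Ranking m)
    (hrow : ∀ i < m, h.arr 1 i = i * m) {p : ℕ} (hp : p < m) (h10 : h.reg 10 = p) {l : List ℕ}
    (hinp : h.inp = (σ ⟨p, hp⟩ : ℕ) :: l) (h2 : ∀ q : Fin m, (q : ℕ) < p → h.arr 2 q = σ q)
    {w : Fin m → Fin m → ℕ} (hw : ∀ a b, w a b + 1 < 2 ^ B)
    (h3 : ∀ a b : Fin m, h.arr 3 (a * m + b) =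
      w a b + if Prefers σ a b ∧ (σ.symm b : ℕ) < p then 1 else 0) :
    wp B candCmd h fun h' t => h'.reg 11 = h.reg 11 ∧ h'.reg 10 = p + 1 ∧ h'.inp = l ∧
      (∀ q : Fin m, (q : ℕ) < p + 1 → h'.arr 2 q = σ q) ∧
      (∀ a b : Fin m, h'.arr 3 (a * m + b) =
        w a b + if Prefers σ a b ∧ (σ.symm b : ℕ) < p + 1 then 1 else 0) ∧
      ReadFrame 20 h h' ∧ t ≤ 7 * m + 5 := by
  let c : Fin m := σ ⟨p, hp⟩
  have hc : σ.symm c = ⟨p, hp⟩ := by simp [c]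
  have hpos : ∀ a b : Fin m, (σ.symm a : ℕ) = σ.symm b ↔ a = b := fun a b => by
    rw [← Fin.ext_iff, σ.symm.injective.eq_iff]
  simp (disch := omega) only [candCmd, wp_seq, wp_read, wp_st, wp_inc, hinp, List.headD_cons,
    List.tail_cons, Store.setArr_reg]
  refine wp_rep (T := 6) (fun j h' => j ≤ p ∧ h'.reg 10 = p ∧ h'.reg 11 = h.reg 11 ∧ h'.reg 12 = c ∧
    h'.inp = l ∧ h'.arr 2 = h.arr 2 ∧ ReadFrame 20 h h' ∧ ∀ a b : Fin m, h'.arr 3 (a * m + b) =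
      (w a b + if Prefers σ a b ∧ (σ.symm b : ℕ) < p then 1 else 0) +
        if b = c ∧ j ≤ (σ.symm a : ℕ) ∧ (σ.symm a : ℕ) < p then 1 else 0) ?_ ?_ ?_
  · simp (disch := omega) only [Store.set_reg_of_ne, Store.set_reg_self, Store.set_arr,
      Store.set_inp, Store.setInp_inp, Store.setInp_arr, Store.setInp_reg, h10, h3]
    refine ⟨le_rfl, trivial, trivial, rfl, trivial, trivial,
      (((ReadFrame.refl 20 h).set (by omega) _).setInp l).set (by omega) _, fun a b => ?_⟩
    rw [if_neg (c := b = c ∧ _) (by omega), add_zero]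
  · rintro j h' hj ⟨hj', g10, g11, g12, ginp, g2, F, g3⟩
    simp (disch := omega) only [Store.set_reg_of_ne, Store.setInp_reg, h10] at hj
    let a : Fin m := σ ⟨j, by omega⟩
    have ha : σ.symm a = ⟨j, by omega⟩ := by simp [a]
    have e2 : h.arr 2 j = a := h2 ⟨j, by omega⟩ hj
    have e1 : h'.arr 1 a = a * m := by rw [F.arr _ (by omega) (by omega), hrow a a.2]
    have hpair := pair_lt a c
    have e3 : h'.arr 3 (a * m + c) = w a c := by
      rw [g3, ha, hc]
      simp
    have hwac := hw a c
    simp (disch := omega) only [bumpCmd, wp_seq, wp_ld, wp_add, wp_inc, wp_st, Store.set_reg_of_ne,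
      Store.set_reg_self, Store.set_arr, Store.setArr_reg, Store.set_inp, Store.setArr_inp,
      Store.setArr_arr_of_ne, Store.setArr_arr_same, g10, g11, g12, ginp, g2, e2, e1, e3]
    refine ⟨by omega, by omega, by omega, by omega, by omega, by omega, trivial,
      ⟨by omega, trivial, trivial, trivial, trivial, trivial, ?_, fun a' b' => ?_⟩, by omega⟩
    · exact ((((((F.set (by omega) _).set (by omega) _).set (by omega) _).set (by omega) _).set
        (by omega) _).set (by omega) _).setArr (by omega) _ _
    · by_cases he : a' = a ∧ b' = c
      · obtain ⟨rfl, rfl⟩ := he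
        rw [Function.update_self, ha, hc]
        simp [hj]
      · rw [Function.update_of_ne (fun h => he (pair_inj h)), g3]
        congr 1
        refine if_congr ?_ rfl rfl
        have := hpos a' a
        rw [ha] at this
        simp only at this
        constructor
        · rintro ⟨h1, h2, h3⟩
          exact ⟨h1, by omega, h3⟩
        · rintro ⟨h1, h2, h3⟩
          have : j ≠ σ.symm a' := fun hne => he ⟨this.1 hne.symm, h1⟩
          exact ⟨h1, by omega, h3⟩
  · rintro h' t ⟨-, g10, g11, g12, ginp, g2, F, g3⟩ ht
    simp (disch := omega) only [Store.set_reg_of_ne, Store.setInp_reg, h10] at ht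
    have hm : m ≤ m * m := Nat.le_mul_self m
    simp (disch := omega) only [Store.set_reg_of_ne, Store.set_reg_self, Store.set_arr,
      Store.setArr_reg, Store.set_inp, Store.setArr_inp, Store.setArr_arr_of_ne,
      Store.setArr_arr_same, g10, g11, g12, ginp, g2, g3]
    refine ⟨by omega, by omega, trivial, trivial, trivial, fun q hq => ?_, fun a b => ?_,
      (F.setArr (by omega) _ _).set (by omega) _, by omega⟩
    · by_cases he : (q : ℕ) = p
      · rw [he, Function.update_self]
        rw [show q = ⟨p, hp⟩ from Fin.ext he]
      · rw [Function.update_of_ne he, h2 q (by omega)]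
    · have hb := hpos b c
      rw [hc] at hb
      simp only at hb
      rw [add_assoc]
      congr 1
      simp only [Prefers, Fin.lt_def, Nat.zero_le, true_and]
      by_cases hbc : b = c
      · simp [hbc, hc]
      · have : (σ.symm b : ℕ) ≠ p := fun h => hbc (hb.1 h)
        simp only [hbc, false_and, if_false, add_zero]
        exact if_congr (by omega) rfl rfl

end Kemeny

/-! ### Reading the votes, writing the output, and the whole program -/

namespace Kemeny

open Ram

theorem encodeRanking_drop {m : ℕ} (σ : Ranking m) {p : ℕ} (hp : p < m) :
    (encodeRanking σ).drop p = (σ ⟨p, hp⟩ : ℕ) :: (encodeRanking σ).drop (p + 1) := by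
  rw [List.drop_eq_getElem_cons (by simpa [encodeRanking] using hp)]
  simp [encodeRanking]

theorem wp_voteCmd {m B : ℕ} (hB : m * m < 2 ^ B) {h : Store} (σ : Ranking m)
    (h40 : h.reg 40 = m) (hrow : ∀ i < m, h.arr 1 i = i * m) {l : List ℕ}
    (hinp : h.inp = encodeRanking σ ++ l) {w : Fin m → Fin m → ℕ} (hw : ∀ a b, w a b + 1 < 2 ^ B)
    (h3 : ∀ a b : Fin m, h.arr 3 (a * m + b) = w a b) :
    wp B voteCmd h fun h' t => h'.inp = l ∧
      (∀ a b : Fin m, h'.arr 3 (a * m + b) = w a b + if Prefers σ a b then 1 else 0) ∧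
      ReadFrame 20 h h' ∧ t ≤ m * (7 * m + 6) + 3 := by
  simp (disch := omega) only [voteCmd, wp_seq, wp_const]
  refine ⟨by omega, wp_rep (T := 7 * m + 5) (fun j h' => j ≤ m ∧ h'.reg 10 = m - j ∧
    h'.inp = (encodeRanking σ).drop (m - j) ++ l ∧
    (∀ q : Fin m, (q : ℕ) < m - j → h'.arr 2 q = σ q) ∧ (∀ a b : Fin m, h'.arr 3 (a * m + b) =
      w a b + if Prefers σ a b ∧ (σ.symm b : ℕ) < m - j then 1 else 0) ∧
    ReadFrame 20 h h') ?_ ?_ ?_⟩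
  · simp (disch := omega) only [Store.set_reg_of_ne, Store.set_reg_self, Store.set_arr,
      Store.set_inp, h40, Nat.sub_self, List.drop_zero, hinp, h3]
    refine ⟨le_rfl, trivial, trivial, fun q hq => by omega, fun a b => ?_,
      ((ReadFrame.refl 20 h).set (by omega) _).set (by omega) _⟩
    simp
  · rintro j h' hj ⟨hj', g10, ginp, g2, g3, F⟩
    simp (disch := omega) only [Store.set_reg_of_ne, h40] at hj
    have hp : m - (j + 1) < m := by omega
    have he : m - j = m - (j + 1) + 1 := by omega
    have F' := F.set (i := 11) (by omega) j
    rw [encodeRanking_drop σ hp, List.cons_append] at ginp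
    refine wp_mono _ _ _ _ ?_ (wp_candCmd (h := h'.set 11 j) hB σ
      (fun i hi => by rw [F'.arr _ (by omega) (by omega), hrow i hi]) hp
      (by rw [Store.set_reg_of_ne _ _ _ _ (by omega), g10]) ginp g2 hw g3)
    rintro h'' t ⟨k11, k10, kinp, k2, k3, G, ht⟩
    rw [he]
    exact ⟨k11.trans (Store.set_reg_self _ _ _), ⟨by omega, k10, kinp, k2, k3, F'.trans G⟩, ht⟩
  · rintro h' t ⟨-, -, ginp, -, g3, F⟩ ht
    simp (disch := omega) only [Store.set_reg_of_ne, h40] at ht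
    refine ⟨?_, fun a b => ?_, F, ?_⟩
    · rw [ginp, Nat.sub_zero, List.drop_of_length_le (by simp [encodeRanking]), List.nil_append]
    · rw [g3]
      simp
    · have : 7 * m + 5 + 1 = 7 * m + 6 := rfl
      rw [this] at ht
      omega

theorem wp_votesCmd {m n B : ℕ} (hB : m * m < 2 ^ B) (hn : n + 1 < 2 ^ B) {h : Store}
    (V : Profile m n) (h40 : h.reg 40 = m) (h41 : h.reg 41 = n)
    (hrow : ∀ i < m, h.arr 1 i = i * m)
    (hinp : h.inp = (List.ofFn fun i => encodeRanking (V i)).flatten)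
    (h3 : ∀ a b : Fin m, h.arr 3 (a * m + b) = 0) :
    wp B votesCmd h fun h' t => (∀ a b : Fin m, h'.arr 3 (a * m + b) = wt V a b) ∧
      ReadFrame 22 h h' ∧ t ≤ n * (m * (7 * m + 6) + 4) + 2 := by
  refine wp_rep (T := m * (7 * m + 6) + 3) (fun j h' => j ≤ n ∧
    h'.inp = ((List.ofFn fun i => encodeRanking (V i)).drop (n - j)).flatten ∧
    (∀ a b : Fin m, h'.arr 3 (a * m + b) = wtBelow V (n - j) a b) ∧ ReadFrame 22 h h') ?_ ?_ ?_
  · simp (disch := omega) only [Store.set_arr, Store.set_inp, h41, Nat.sub_self, List.drop_zero,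
      hinp, h3, wtBelow_zero]
    exact ⟨le_rfl, trivial, fun _ _ => trivial, (ReadFrame.refl 22 h).set (by omega) _⟩
  · rintro j h' hj ⟨hj', ginp, g3, F⟩
    rw [h41] at hj
    have hi : n - (j + 1) < n := by omega
    have he : n - j = n - (j + 1) + 1 := by omega
    have F' := F.set (i := 20) (by omega) j
    rw [List.drop_eq_getElem_cons (by simpa using hi), List.flatten_cons, List.getElem_ofFn]
      at ginp
    refine wp_mono _ _ _ _ ?_ (wp_voteCmd (h := h'.set 20 j) hB (V ⟨n - (j + 1), hi⟩)
      (by rw [F'.reg _ (by omega), h40])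
      (fun i hi => by rw [F'.arr _ (by omega) (by omega), hrow i hi]) ginp
      (fun a b => by have := wtBelow_le V (n - (j + 1)) a b; omega) g3)
    rintro h'' t ⟨kinp, k3, G, ht⟩
    refine ⟨by rw [G.reg _ (by omega), Store.set_reg_self], ⟨by omega, ?_, fun a b => ?_,
      F'.trans ⟨fun i hi => G.reg i (by omega), G.arr, G.out⟩⟩, ht⟩
    · rw [kinp, he]
    · rw [k3, he, ← wtBelow_succ V ⟨n - (j + 1), hi⟩]
  · rintro h' t ⟨-, -, g3, F⟩ ht
    rw [h41] at ht
    exact ⟨fun a b => by rw [g3, Nat.sub_zero, wtBelow_top], F, ht⟩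

/-- Writes the partial rankings in the current part of the queue. -/
def outputCmd : Cmd :=
  .seq (.sub 21 31 30) <| .seq (.write 21) <| .rep 20 21 <| .seq (.mov 12 30) <|
    .seq (.rep 11 40 <| .seq (.ld 6 15 12) <| .seq (.write 15) (.ld 7 12 12)) (.inc 30)

/-- Ends are built by prepending, so following the pointers lists the candidates from the most
preferred one on. In the inner invariant, `l` is the part of the ranking still to be written. -/
theorem wp_outputCmd {m B lo : ℕ} {h : Store} (h40 : h.reg 40 = m) (h30 : h.reg 30 = lo)
    {M : List (List (Fin m))} (hM : ∀ l ∈ M, l.length = m)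
    (hnode : ∀ i (hi : i < M.length), Node h.arr M[i] (lo + i)) (h31 : h.reg 31 = lo + M.length)
    (hB : lo + M.length < 2 ^ B) (hout : h.out = []) :
    wp B outputCmd h fun h' t =>
      h'.out = M.length :: (M.map fun l => l.map Fin.val).flatten ∧
      t ≤ M.length * (4 * m + 5) + 4 := by
  have hcount : h.reg 31 - h.reg 30 = M.length := by omega
  simp (disch := omega) only [outputCmd, wp_seq, wp_sub, wp_write, Store.set_reg_self,
    Store.set_out, hcount, hout, List.nil_append]
  refine wp_rep (T := 4 * m + 4) (fun j h' => j ≤ M.length ∧ h'.reg 40 = m ∧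
    h'.reg 21 = M.length ∧ h'.reg 30 = lo + (M.length - j) ∧ h'.arr = h.arr ∧
    h'.out = M.length :: ((M.take (M.length - j)).map fun l => l.map Fin.val).flatten)
      ?_ ?_ ?_
  · simp (disch := omega) only [Store.set_reg_of_ne, Store.set_reg_self, Store.set_arr,
      Store.set_out, Store.setOut_reg, Store.setOut_arr, Store.setOut_out, h40, h30, Nat.sub_self]
    simp
  · rintro j h' hj ⟨hj', g40, g21, g30, garr, gout⟩
    have hi : M.length - (j + 1) < M.length := by omega
    simp (disch := omega) only [wp_seq, wp_mov, wp_inc, Store.set_reg_of_ne, g30]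
    refine wp_rep (T := 3) (fun i h'' => h''.reg 40 = m ∧ h''.reg 20 = j ∧ h''.reg 21 = M.length ∧
      h''.reg 30 = lo + (M.length - (j + 1)) ∧ h''.arr = h.arr ∧ ∃ l : List (Fin m),
      l.length = i ∧ Node h.arr l (h''.reg 12) ∧ h''.out ++ l.map Fin.val =
        h'.out ++ M[M.length - (j + 1)].map Fin.val) ?_ ?_ ?_
    · simp (disch := omega) only [Store.set_reg_of_ne, Store.set_reg_self, Store.set_arr,
        Store.set_out, g40, g21, g30, garr]
      exact ⟨trivial, trivial, trivial, trivial, trivial, _, hM _ (List.getElem_mem hi),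
        hnode _ hi, rfl⟩
    · rintro i h'' hi' ⟨k40, k20, k21, k30, karr, l, hl, hnl, kout⟩
      obtain ⟨x, l, rfl⟩ := List.exists_cons_of_length_eq_add_one hl
      obtain ⟨-, h6, -, h7⟩ := hnl
      simp (disch := omega) only [wp_seq, wp_ld, wp_write, Store.set_reg_of_ne, Store.set_reg_self,
        Store.set_arr, Store.set_out, Store.setOut_reg, Store.setOut_arr, Store.setOut_out, k40,
        k20, k21, k30, karr, h6]
      refine ⟨by omega, by omega, trivial, ⟨trivial, trivial, trivial, trivial, trivial, l,
        by simpa using hl, h7, ?_⟩, by omega⟩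
      rw [← kout]
      simp
    · rintro h'' t ⟨k40, k20, k21, k30, karr, l, hl, -, kout⟩ ht
      simp (disch := omega) only [Store.set_reg_of_ne, g40] at ht
      rw [List.length_eq_zero_iff.1 hl] at kout
      simp only [List.map_nil, List.append_nil] at kout
      simp only [Store.set_reg_self, Store.set_arr, Store.set_out, k20, k30, karr, kout, gout]
      simp only [k40, k21]
      refine ⟨by omega, trivial, ⟨by omega, trivial, trivial, by omega, trivial, ?_⟩, by omega⟩
      rw [show M.length - j = M.length - (j + 1) + 1 by omega, List.take_add_one,
        List.getElem?_eq_getElem hi]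
      simp only [Option.toList_some, List.map_append, List.flatten_append, List.map_cons,
        List.map_nil, List.flatten_cons, List.flatten_nil, List.append_nil, List.cons_append]
  · rintro h' t ⟨-, -, -, -, -, gout⟩ ht
    simp (disch := omega) only [Store.setOut_reg, Store.set_reg_self] at ht
    rw [Nat.sub_zero, List.take_length] at gout
    have : 4 * m + 4 + 1 = 4 * m + 5 := rfl
    rw [this] at ht
    exact ⟨gout, by omega⟩

/-- The algorithm. -/
def mainCmd : Cmd :=
  .seq setupCmd <| .seq votesCmd <| .seq (.const 30 0) <| .seq (.const 31 1) <|
    .seq (.const 0 0) <| .seq (.const 1 1) <| .seq (.st 4 0 1) <| .seq (.st 5 0 0) <|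
      .seq (.rep 22 40 levelCmd) <| .seq (.rep 22 40 beamCmd) outputCmd

theorem AtLevel.set {m n k : ℕ} {V : Profile m n} {h : Store} {L : List (Finset (Fin m))}
    (A : AtLevel V k h L) {i : ℕ} (h30 : i ≠ 30) (h31 : i ≠ 31) (x : ℕ) :
    AtLevel V k (h.set i x) L where
  level := A.level
  mem := A.mem
  nodup := A.nodup
  window := by rw [Store.set_reg_of_ne _ _ _ _ h30.symm]; exact A.window
  tail := by
    rw [Store.set_reg_of_ne _ _ _ _ h30.symm, Store.set_reg_of_ne _ _ _ _ h31.symm, A.tail]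
  tail_le := by rw [Store.set_reg_of_ne _ _ _ _ h31.symm]; exact A.tail_le

theorem AtBeam.set {m n k r : ℕ} {V : Profile m n} {f : Finset (Fin m) → ℕ} {h : Store}
    {M : List (List (Fin m))} (A : AtBeam V f k r h M) {i : ℕ} (h30 : i ≠ 30) (h31 : i ≠ 31)
    (x : ℕ) : AtBeam V f k r (h.set i x) M where
  beam := A.beam
  node := by rw [Store.set_reg_of_ne _ _ _ _ h30.symm]; exact A.node
  tail := by
    rw [Store.set_reg_of_ne _ _ _ _ h30.symm, Store.set_reg_of_ne _ _ _ _ h31.symm, A.tail]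
  tail_le := by rw [Store.set_reg_of_ne _ _ _ _ h31.symm]; exact A.tail_le

/-- The last level of the queue consists of the full candidate set alone. Its entry in array 5
already is the node of the empty end, so the beam starts without any further preparation. -/
theorem AtLevel.atBeam {m n r : ℕ} {V : Profile m n} {h : Store} {L : List (Finset (Fin m))}
    (A : AtLevel V m h L) (hr : 1 ≤ r) : AtBeam V (table h) 0 r h [[]] := by
  have hL : ∀ S, S ∈ L ↔ S = Finset.univ := fun S => by
    rw [A.mem]
    constructor
    · rintro ⟨-, hc⟩
      exact Finset.eq_univ_of_card S (by rw [hc, Fintype.card_fin])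
    · rintro rfl
      exact ⟨fun _ _ _ _ => Finset.mem_univ _, by simp⟩
  have hL' : L.length = 1 := by
    rw [← List.toFinset_card_of_nodup A.nodup, Finset.card_eq_one]
    exact ⟨Finset.univ, by ext S; simp [hL]⟩
  have h0 := A.window 0 (by omega)
  rw [(hL _).1 (List.getElem_mem _)] at h0
  refine ⟨IsBeam.nil V _ hr, fun i hi => ?_, by rw [A.tail, hL']; rfl, by simpa using A.tail_le⟩
  have : i = 0 := by simpa using hi
  subst this
  simpa [Node, rest] using h0

theorem one_le_card_ideals {m n : ℕ} (V : Profile m n) : 1 ≤ (ideals V).card :=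
  Finset.card_pos.2 ⟨∅, mem_ideals.2 fun x hx => by simp at hx⟩

/-- The tight lists of length m are the Kemeny rankings. A full beam contains r of them, and
otherwise it contains all; both cases give the minimum of r and |K(V)|. -/
theorem IsBeam.exists_isSolution {m n r : ℕ} {V : Profile m n} {f : Finset (Fin m) → ℕ}
    {M : List (List (Fin m))} (H : IsBeam V f m r M) (hf : IsBellman V f) (hn : 1 ≤ n) :
    ∃ L : List (Ranking m), IsSolution V r L ∧
      encodeOutput L = M.length :: (M.map fun l => l.map Fin.val).flatten := by
  have hL : ∀ M : List (List (Fin m)), (∀ l ∈ M, l.Nodup ∧ l.length = m) →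
      ∃ L : List (Ranking m), L.map (fun Q : Ranking m => List.ofFn Q) = M := by
    intro M
    induction M with
    | nil => exact fun _ => ⟨[], rfl⟩
    | cons l M ih =>
      intro hM
      obtain ⟨L, rfl⟩ := ih fun l hl => hM l (List.mem_cons_of_mem _ hl)
      obtain ⟨Q, rfl⟩ := exists_ranking (hM l List.mem_cons_self).1 (hM l List.mem_cons_self).2
      exact ⟨Q :: L, rfl⟩
  obtain ⟨L, rfl⟩ := hL M fun l hl => ⟨(H.tight l hl).nodup, H.length l hl⟩
  have hnodup : L.Nodup := H.nodup.of_map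
  have hmem : ∀ Q ∈ L, Q ∈ kemenyRankings V := fun Q hQ =>
    (mem_kemenyRankings_iff hn hf).2 (H.tight _ (List.mem_map.2 ⟨Q, hQ, rfl⟩))
  have hlen : L.length ≤ r := by simpa using H.length_le
  have hcard : L.length ≤ (kemenyRankings V).card := by
    rw [← List.toFinset_card_of_nodup hnodup]
    exact Finset.card_le_card fun Q hQ => hmem Q (List.mem_toFinset.1 hQ)
  refine ⟨L, ⟨hnodup, hmem, ?_⟩, ?_⟩
  · rcases H.complete with hr | hc
    · rw [List.length_map] at hr
      omega
    · have : (kemenyRankings V).card ≤ L.length := by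
        rw [← List.toFinset_card_of_nodup hnodup]
        refine Finset.card_le_card fun Q hQ => List.mem_toFinset.2 ?_
        obtain ⟨Q', hQ', he⟩ := List.mem_map.1
          (hc _ ((mem_kemenyRankings_iff hn hf).1 hQ) List.length_ofFn)
        rwa [← DFunLike.coe_injective (List.ofFn_injective he)]
      omega
  · rw [encodeOutput, List.length_map, List.map_map]
    congr 3
    funext Q
    simp [encodeRanking, List.map_ofFn, Function.comp_def]

/-- A bound for the number of steps of the algorithm, when there are `I` ideals. -/
def stepBound (m n r I : ℕ) : ℕ :=
  6 * m + n * (m * (7 * m + 6) + 4) + m * (I * (m * (10 * m + 21) + 7) + 4) +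
    m * (r * (m * (10 * m + 31) + 7) + 5) + r * (4 * m + 5) + 30

theorem wp_mainCmd {m n r B : ℕ} (V : Profile m n) (hm : 1 ≤ m) (hn : 1 ≤ n) (hr : 1 ≤ r)
    (hB : Fits m n r (ideals V).card B) :
    wp B mainCmd ⟨fun _ => 0, fun _ _ => 0, encodeInstance V r, []⟩ fun h t =>
      (∃ L, IsSolution V r L ∧ h.out = encodeOutput L) ∧
        t ≤ stepBound m n r (ideals V).card := by
  have hB1 := hB.one
  have hB3 := hB.cost
  have hI := one_le_card_ideals V
  have hn' : n + 1 < 2 ^ B := by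
    have : n ≤ m * n := Nat.le_mul_of_pos_left n hm
    have : m * n ≤ m * (m * n) := Nat.le_mul_of_pos_left _ hm
    omega
  rw [mainCmd, wp_seq]
  refine wp_mono _ _ _ _ ?_ (wp_setupCmd hB.one hB.sq hB.pow)
  rintro h1 t1 ⟨g40, g41, g42, gpow, grow, garr, ginp, gout, ht1⟩
  rw [wp_seq]
  refine wp_mono _ _ _ _ ?_ (wp_votesCmd hB.sq hn' V g40 g41 grow ginp
    fun a b => garr 3 (by omega) _)
  rintro h2 t2 ⟨k3, F2, ht2⟩
  simp (disch := omega) only [wp_seq, wp_const, wp_st, Store.set_reg_of_ne, Store.set_reg_self,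
    Store.setArr_reg]
  refine ⟨by omega, by omega, by omega, by omega, by omega, by omega, ?_⟩
  generalize hh3 : (((((h2.set 30 0).set 31 1).set 0 0).set 1 1).setArr 4 0 1).setArr 5 0 0 = h3
  have e30 : h3.reg 30 = 0 := by
    subst hh3
    simp (disch := omega) only [Store.setArr_reg, Store.set_reg_of_ne, Store.set_reg_self]
  have e31 : h3.reg 31 = 1 := by
    subst hh3
    simp (disch := omega) only [Store.setArr_reg, Store.set_reg_of_ne, Store.set_reg_self]
  have T3 : Tables V r h3 := by
    subst hh3
    constructor <;> simp (disch := omega) only [Store.setArr_reg, Store.set_reg_of_ne,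
      Store.setArr_arr_of_ne, Store.set_arr]
    · rw [F2.reg _ (by omega), g40]
    · rw [F2.reg _ (by omega), g41]
    · rw [F2.reg _ (by omega), g42]
    · rw [F2.arr _ (by omega) (by omega)]; exact gpow
    · rw [F2.arr _ (by omega) (by omega)]; exact grow
    · exact k3
  have hout3 : h3.out = [] := by
    subst hh3
    exact F2.out.trans gout
  have A3 : AtLevel V 0 h3 [∅] := by
    refine ⟨LevelInv.init fun S => ?_, fun S => ?_, List.nodup_singleton _, fun i hi => ?_,
      by rw [e30, e31]; rfl, by rw [e31]; omega⟩
    · subst hh3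
      have hk : key (∅ : Finset (Fin m)) = 0 := by simp [key]
      have hset := table_setArr ((((h2.set 30 0).set 31 1).set 0 0).set 1 1)
        (∅ : Finset (Fin m)) 1
      rw [hk] at hset
      rw [table_setArr_queue, hset, Function.update_apply]
      refine if_congr Iff.rfl rfl ?_
      rw [table, Store.set_arr, Store.set_arr, Store.set_arr, Store.set_arr,
        F2.arr _ (by omega) (by omega), garr _ (by omega)]
    · rw [List.mem_singleton, Finset.card_eq_zero]
      exact ⟨fun h => ⟨by subst h; exact fun x hx => by simp at hx, h⟩, And.right⟩
    · have : i = 0 := by simpa using hi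
      subst this
      rw [e30]
      subst hh3
      simp [key]
  refine wp_rep (T := (ideals V).card * (m * (10 * m + 21) + 7) + 3)
    (fun j h => j ≤ m ∧ QueueFrame 23 0 h3 h ∧ ∃ L, AtLevel V (m - j) h L) ?_ ?_ ?_
  · rw [T3.reg_m, Nat.sub_self]
    exact ⟨le_rfl, (QueueFrame.refl 23 0 h3).set (by omega) _, _, A3.set (by omega) (by omega) _⟩
  · rintro j h hj ⟨hj', F, L, A⟩
    rw [T3.reg_m] at hj
    have F' := F.set (i := 22) (by omega) j
    refine wp_mono _ _ _ _ ?_ (wp_levelCmd hn hB (F'.tables (by omega) T3) (by omega)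
      (A.set (by omega) (by omega) j))
    rintro h' t ⟨⟨L', A'⟩, G, ht⟩
    refine ⟨by rw [G.reg _ (by omega) (by omega) (by omega), Store.set_reg_self], ⟨by omega,
      F'.trans (G.mono (by omega) le_rfl), L', ?_⟩, ht⟩
    rwa [show m - j = m - (j + 1) + 1 by omega]
  rintro h4 t4 ⟨-, F4, L, A4⟩ ht4
  have T4 := F4.tables (by omega) T3
  rw [Nat.sub_zero] at A4
  rw [T3.reg_m] at ht4
  have hD := A4.level
  refine wp_rep (T := r * (m * (10 * m + 31) + 7) + 4)
    (fun j h => j ≤ m ∧ BeamFrame 23 0 h4 h ∧ ∃ M, AtBeam V (table h4) (m - j) r h M) ?_ ?_ ?_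
  · rw [T4.reg_m, Nat.sub_self]
    exact ⟨le_rfl, (BeamFrame.refl 23 0 h4).set (by omega) _, _,
      (A4.atBeam hr).set (by omega) (by omega) _⟩
  · rintro j h hj ⟨hj', F, M, A⟩
    rw [T4.reg_m] at hj
    have F' := F.set (i := 22) (by omega) j
    refine wp_mono _ _ _ _ ?_ (wp_beamCmd hB (F'.tables (by omega) T4) (funext F'.table_eq) hD
      (by omega) (A.set (by omega) (by omega) j))
    rintro h' t ⟨⟨M', A'⟩, G, ht⟩
    refine ⟨by rw [G.reg _ (by omega) (by omega) (by omega) (by omega), Store.set_reg_self],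
      ⟨by omega, F'.trans (G.mono (by omega) le_rfl), M', ?_⟩, ht⟩
    rwa [show m - j = m - (j + 1) + 1 by omega]
  rintro h5 t5 ⟨-, F5, M, A5⟩ ht5
  rw [Nat.sub_zero] at A5
  rw [T4.reg_m] at ht5
  have hlen := A5.beam.length_le
  have htail := A5.tail
  refine wp_mono _ _ _ _ ?_ (wp_outputCmd (B := B) (F5.tables (by omega) T4).reg_m rfl A5.beam.length
    A5.node A5.tail ?_ (by rw [F5.out, F4.out, hout3]))
  · rintro h6 t6 ⟨hout, ht6⟩
    obtain ⟨L, hL, he⟩ := A5.beam.exists_isSolution hD.isBellman hn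
    refine ⟨⟨L, hL, by rw [hout, he]⟩, ?_⟩
    have h1 : M.length * (4 * m + 5) ≤ r * (4 * m + 5) := Nat.mul_le_mul_right _ hlen
    have h2 : m * (r * (m * (10 * m + 31) + 7) + 4 + 1) =
      m * (r * (m * (10 * m + 31) + 7) + 5) := rfl
    have h3 : m * ((ideals V).card * (m * (10 * m + 21) + 7) + 3 + 1) =
      m * ((ideals V).card * (m * (10 * m + 21) + 7) + 4) := rfl
    rw [stepBound]
    omega
  · have h1 := A5.tail_le
    have h2 := hB.queue
    have h3 : (m + 2) * ((ideals V).card + r + 1) =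
      (m + 1) * (ideals V).card + (ideals V).card + m * r + 2 * r + m + 2 := by ring
    omega

end Kemeny

/-! ### Word length, running time and the final estimate -/

namespace Kemeny

open Ram

theorem length_le_bitSize (l : List ℕ) : l.length ≤ bitSize l := by
  rw [bitSize, ← List.length_map (fun x => Nat.size x + 1)]
  exact List.length_le_sum_of_one_le _ (by simp)

theorem lt_two_pow_bitSize {l : List ℕ} {x : ℕ} (h : x ∈ l) : x < 2 ^ bitSize l := by
  have : Nat.size x + 1 ≤ bitSize l := List.le_sum_of_mem (List.mem_map.2 ⟨x, h, rfl⟩)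
  exact Nat.size_le.1 (by omega)

theorem length_encodeInstance {m n : ℕ} (V : Profile m n) (r : ℕ) :
    (encodeInstance V r).length = n * m + 3 := by
  simp [encodeInstance, encodeRanking, List.length_flatten, Function.comp_def, List.map_ofFn]

/-- All numbers involved are at most a constant times the cube of 2^N, so 4N + 10 bits suffice. Here
r is bounded only by 2^N because it is given in binary. -/
theorem fits {m n r I N : ℕ} (hm : m ≤ N) (hn : n ≤ N) (hr : r < 2 ^ N) (hI : I ≤ 2 ^ m) :
    Fits m n r I (4 * N + 10) := by
  have hB : 2 ^ (4 * N + 10) = 1024 * (2 ^ N * 2 ^ N * (2 ^ N * 2 ^ N)) := by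
    rw [pow_add, mul_comm 4 N, pow_mul]
    ring
  have hN : N < 2 ^ N := Nat.lt_two_pow_self
  have hmX : 2 ^ m ≤ 2 ^ N := Nat.pow_le_pow_right (by omega) hm
  rw [show (1024 : ℕ) = 1000 + 24 by omega, add_mul] at hB
  generalize (2 : ℕ) ^ N = X at *
  have hX : 1 ≤ X := by omega
  have h2 : X ≤ X * X := Nat.le_mul_of_pos_left _ hX
  have h4 : X * X ≤ X * X * (X * X) := Nat.le_mul_of_pos_right _ (Nat.mul_pos hX hX)
  have h3 : X * (X * X) ≤ X * X * (X * X) := Nat.mul_le_mul_right _ h2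
  have hmm : m * m ≤ X * X := Nat.mul_le_mul (by omega) (by omega)
  have hmn : m * n ≤ X * X := Nat.mul_le_mul (by omega) (by omega)
  have hmmn : m * (m * n) ≤ X * (X * X) := Nat.mul_le_mul (by omega) hmn
  have hq : (m + 2) * (I + r + 1) ≤ (3 * X) * (3 * X) := Nat.mul_le_mul (by omega) (by omega)
  have hq' : (3 * X) * (3 * X) = 9 * (X * X) := by ring
  constructor <;> omega

/-- Every monomial of the bound is dominated by N^5·A·r, and 271 is the sum of the coefficients. -/
theorem stepBound_le {m n r I N A : ℕ} (hm : m ≤ N) (hn : n ≤ N) (hN : 1 ≤ N) (hr : 1 ≤ r)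
    (hA : 1 ≤ A) (hI : I ≤ 4 * N ^ 2 * A) : stepBound m n r I ≤ 271 * (N ^ 5 * A * r) := by
  have hpow : ∀ i ≤ 5, N ^ i ≤ N ^ 5 := fun i hi => Nat.pow_le_pow_right hN hi
  have h1 : ∀ i ≤ 5, N ^ i * A ≤ N ^ 5 * A * r := fun i hi =>
    (Nat.mul_le_mul_right _ (hpow i hi)).trans (Nat.le_mul_of_pos_right _ hr)
  have h2 : ∀ i ≤ 5, N ^ i * r ≤ N ^ 5 * A * r := fun i hi =>
    Nat.mul_le_mul_right _ ((hpow i hi).trans (Nat.le_mul_of_pos_right _ hA))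
  have h3 : ∀ i ≤ 5, N ^ i ≤ N ^ 5 * A * r := fun i hi =>
    (Nat.le_mul_of_pos_right _ hA).trans (h1 i hi)
  calc stepBound m n r I ≤ stepBound N N r (4 * N ^ 2 * A) := by
        unfold stepBound
        gcongr
    _ = 19 * N ^ 1 + 6 * N ^ 2 + 7 * N ^ 3 + 40 * (N ^ 5 * A) + 84 * (N ^ 4 * A) +
          28 * (N ^ 3 * A) + 10 * (N ^ 3 * r) + 31 * (N ^ 2 * r) + 11 * (N ^ 1 * r) +
          5 * (N ^ 0 * r) + 30 * N ^ 0 := by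
        unfold stepBound
        ring
    _ ≤ 271 * (N ^ 5 * A * r) := by
        have a1 := h3 1 (by omega)
        have a2 := h3 2 (by omega)
        have a3 := h3 3 (by omega)
        have a4 := h1 5 (by omega)
        have a5 := h1 4 (by omega)
        have a6 := h1 3 (by omega)
        have a7 := h2 3 (by omega)
        have a8 := h2 2 (by omega)
        have a9 := h2 1 (by omega)
        have a10 := h2 0 (by omega)
        have a11 := h3 0 (by omega)
        linarith

end Kemeny

theorem mainTheorem5 :
    ∃ (p : Ram.Prog) (c : ℕ), ∀ (m n r : ℕ) (V : Kemeny.Profile m n),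
      1 ≤ m → 1 ≤ n → 1 ≤ r →
      ∃ (L : List (Kemeny.Ranking m)) (t : ℕ),
        p.RunsIn (Kemeny.encodeInstance V r) (Kemeny.encodeOutput L) t ∧
        Kemeny.IsSolution V r L ∧
        t ≤ c * 2 ^ (c * Kemeny.unanimityWidth V) * r *
          Kemeny.bitSize (Kemeny.encodeInstance V r) ^ c := by
  -- The constant is 271 · 380: at most 271·N^5·2^w·r steps, each taking machine time at most 380·N.
  -- It also serves as the exponent, where 6 would do for N and 1 for 2^w.
  refine ⟨Kemeny.mainCmd.compile, 102980, fun m n r V hm hn hr => ?_⟩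
  have hlen := Kemeny.length_le_bitSize (Kemeny.encodeInstance V r)
  rw [Kemeny.length_encodeInstance] at hlen
  have hlt : ∀ x ∈ Kemeny.encodeInstance V r, x < 2 ^ _ := fun x hx =>
    Kemeny.lt_two_pow_bitSize hx
  have hrN := hlt r (by simp [Kemeny.encodeInstance])
  generalize Kemeny.bitSize (Kemeny.encodeInstance V r) = N at *
  have hmN : m ≤ N := (Nat.le_mul_of_pos_left m hn).trans (by omega)
  have hnN : n ≤ N := (Nat.le_mul_of_pos_right n hm).trans (by omega)
  -- Two bounds on the number of ideals are used: the trivial one for the word length, which enters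
  -- only linearly, and the one in terms of the width for the number of steps.
  have hI : (Kemeny.ideals V).card ≤ 2 ^ m := (Finset.card_le_univ _).trans_eq (by simp)
  have hI2 : (Kemeny.ideals V).card ≤ 4 * N ^ 2 * 2 ^ Kemeny.unanimityWidth V :=
    calc (Kemeny.ideals V).card ≤ m * ((m + 1) * 2 ^ (Kemeny.unanimityWidth V + 1)) :=
          Kemeny.card_ideals_le hm V
      _ ≤ N * ((2 * N) * 2 ^ (Kemeny.unanimityWidth V + 1)) :=
          Nat.mul_le_mul hmN (Nat.mul_le_mul_right _ (by omega))
      _ = _ := by ring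
  have hA := Nat.one_le_two_pow (n := Kemeny.unanimityWidth V)
  have hN : 3 ≤ N := by omega
  have hw := Kemeny.wp_mainCmd V hm hn hr (Kemeny.fits hmN hnN hrN hI)
  have hsim : Ram.Sim (4 * N + 10)
      ⟨fun _ => 0, fun _ _ => 0, Kemeny.encodeInstance V r, []⟩
      (Ram.State.init (Kemeny.encodeInstance V r)) :=
    { reg := fun _ => rfl
      arr := fun _ _ _ => rfl
      inp := rfl
      out := rfl
      reg_lt := fun _ => Nat.two_pow_pos _
      arr_lt := fun _ _ _ => Nat.two_pow_pos _
      inp_lt := fun x hx =>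
        (hlt x hx).trans_le (Nat.pow_le_pow_right (by omega) (by omega)) }
  obtain ⟨h', k, s', t, he, hs, ht, ⟨⟨L, hL, hout⟩, hk⟩⟩ :=
    Ram.exec_of_wp (by omega) Kemeny.mainCmd _ _ _ hsim hw
  refine ⟨L, t, ⟨s', he, hs.out.trans hout⟩, hL, ?_⟩
  have hk' := hk.trans (Kemeny.stepBound_le hmN hnN (by omega) hr hA hI2)
  have hT : Ram.stepTime (4 * N + 10) ≤ 380 * N := by unfold Ram.stepTime; omega
  generalize Kemeny.unanimityWidth V = w at *
  generalize hc : 102980 = c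
  have hpw : 2 ^ w ≤ 2 ^ (c * w) :=
    Nat.pow_le_pow_right (by omega) (Nat.le_mul_of_pos_left _ (by omega))
  have hpN : N ^ 6 ≤ N ^ c := Nat.pow_le_pow_right (by omega) (by omega)
  calc t ≤ k * Ram.stepTime (4 * N + 10) := ht
    _ ≤ 271 * (N ^ 5 * 2 ^ w * r) * (380 * N) := Nat.mul_le_mul hk' hT
    _ = 102980 * 2 ^ w * r * N ^ 6 := by ring
    _ ≤ c * 2 ^ (c * w) * r * N ^ c := by rw [hc]; gcongr
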